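/- Let $p_0=(0,0)$, $p_1=(1,0)$, $p_2=(\tfrac12,\tfrac{\sqrt3}{2})$ and $f_i(x)=(x+p_i)/2$ on $\mathbb R^2$, and let $K$ be the Sierpiński gasket, i.e. the unique nonempty compact set with $K=f_0(K)\cup f_1(K)\cup f_2(K)$, equipped with the Euclidean metric. Put $\alpha=\log 3/\log 2$ and $\beta^*=\log 5/\log 2$, and let $\nu$ be the normalized $\alpha$-dimensional Hausdorff measure on $K$. For $\beta>0$ let $$\mathcal E_K(u,u)=\int_K\int_K\frac{(u(x)-u(y))^2}{|x-y|^{\alpha+\beta}}\,\nu(dx)\,\nu(dy),\qquad \mathcal F_K=\{u\in L^2(K;\nu):\mathcal E_K(u,u)<+\infty\}.$$ For $\lambda\in(0,1)$ write $\beta=-\log\lambda/\log2$; then $\lambda<1/5$ if and only if $\beta>\beta^*$. If $\lambda\in(0,1/5)$, or equivalently if $\beta\in(\beta^*,+\infty)$, then $(\mathcal E_K,\mathcal F_K)$ is trivial: a function $u\in L^2(K;\nu)$ belongs to $\mathcal F_K$ if and only if it is constant ($\nu$-almost everywhere). Moreover, the walk dimension of $K$ is $d_w=\beta^*=\log5/\log2$.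 That is, $(K,|\cdot|,\nu)$ is $\alpha$-regular (there is $C>0$ with $C^{-1}r^\alpha\le\nu(B(x,r))\le Cr^\alpha$ for all $x\in K$ and $0<r<\operatorname{diam}K$), and the set of all $\beta>0$ for which $(\mathcal E_K,\mathcal F_K)$ is a regular Dirichlet form on $L^2(K;\nu)$ is exactly the interval $(0,\beta^*)$. -/

import Mathlib

open MeasureTheory Filter Topology Set
open scoped ENNReal

/-! ### Symmetric forms, Dirichlet forms, regularity -/

/-- A bilinear form on `L²(M; μ)`, defined on a linear subspace (its domain). -/
structure L2Form {M : Type*} [MeasurableSpace M] (μ : Measure M) where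
  /-- the domain `F` -/
  domain : Submodule ℝ (Lp ℝ 2 μ)
  /-- the bilinear form `E` on `F` -/
  form : LinearMap.BilinForm ℝ domain

namespace L2Form

/-- The quadratic form `E₁(u,u) = E(u,u) + ‖u‖²` (with the norm of `L²(M; μ)`). -/
noncomputable def energyOne {M : Type*} [MeasurableSpace M] {μ : Measure M} (E : L2Form μ)
    (u : E.domain) : ℝ :=
  E.form u u + ‖(u : Lp ℝ 2 μ)‖ ^ 2

/-- Dirichlet form: a densely defined, symmetric, nonnegative, closed form on which the unit
contraction `u ↦ (0 ∨ u) ∧ 1` operates. -/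
structure IsDirichlet {M : Type*} [MeasurableSpace M] {μ : Measure M} (E : L2Form μ) : Prop where
  dense : Dense (E.domain : Set (Lp ℝ 2 μ))
  symm : ∀ u v : E.domain, E.form u v = E.form v u
  nonneg : ∀ u : E.domain, 0 ≤ E.form u u
  /-- the domain is complete for `E₁` -/
  closed : ∀ u : ℕ → E.domain,
    (∀ ε : ℝ, 0 < ε → ∃ N : ℕ, ∀ m ≥ N, ∀ n ≥ N, E.energyOne (u m - u n) < ε) →
      ∃ v : E.domain, Tendsto (fun n => E.energyOne (u n - v)) atTop (𝓝 0)
  markov : ∀ u : E.domain, ∃ v : E.domain,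
    ((v : Lp ℝ 2 μ) =ᵐ[μ] fun x => min (max 0 ((u : Lp ℝ 2 μ) x)) 1) ∧ E.form v v ≤ E.form u u

/-- Regular Dirichlet form: the continuous compactly supported functions in the domain are
`E₁`-dense in the domain and uniformly dense among all continuous compactly supported functions. -/
structure IsRegularDirichlet {M : Type*} [TopologicalSpace M] [MeasurableSpace M] {μ : Measure M}
    (E : L2Form μ) : Prop extends IsDirichlet E where
  dense_domain : ∀ u : E.domain, ∀ ε : ℝ, 0 < ε → ∃ v : E.domain, ∃ f : M → ℝ,
    Continuous f ∧ HasCompactSupport f ∧ ((v : Lp ℝ 2 μ) =ᵐ[μ] f) ∧ E.energyOne (u - v) < ε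
  dense_uniform : ∀ f : M → ℝ, Continuous f → HasCompactSupport f → ∀ ε : ℝ, 0 < ε →
    ∃ v : E.domain, ∃ g : M → ℝ,
      Continuous g ∧ HasCompactSupport g ∧ ((v : Lp ℝ 2 μ) =ᵐ[μ] g) ∧ ∀ x, |f x - g x| < ε

end L2Form

/-! ### The Besov-type form on a metric measure space -/

/-- The energy `∬ (u(x) - u(y))² / d(x,y)^(α+β) μ(dx) μ(dy)`, with values in `[0, ∞]`. -/
noncomputable def besovEnergy {M : Type*} [MetricSpace M] [MeasurableSpace M] (μ : Measure M)
    (α β : ℝ) (u : M → ℝ) : ℝ≥0∞ :=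
  ∫⁻ x, ∫⁻ y, ENNReal.ofReal ((u x - u y) ^ 2 / dist x y ^ (α + β)) ∂μ ∂μ

section Besov

theorem besov_measurable {M : Type*} [MetricSpace M] [SecondCountableTopology M]
    [MeasurableSpace M] [BorelSpace M] (α β : ℝ) {u v : M → ℝ} (hu : Measurable u)
    (hv : Measurable v) :
    Measurable (fun p : M × M =>
      (u p.1 - u p.2) * (v p.1 - v p.2) / dist p.1 p.2 ^ (α + β)) := by
  have hd : Measurable (fun p : M × M => dist p.1 p.2) := continuous_dist.measurable
  exact (((hu.comp measurable_fst).sub (hu.comp measurable_snd)).mul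
    ((hv.comp measurable_fst).sub (hv.comp measurable_snd))).div (hd.pow_const _)

theorem besovEnergy_lt_top_iff {M : Type*} [MetricSpace M] [SecondCountableTopology M]
    [MeasurableSpace M] [BorelSpace M] {μ : Measure M} [SFinite μ] (α β : ℝ) {u : M → ℝ}
    (hu : Measurable u) :
    besovEnergy μ α β u < ⊤ ↔ Integrable (fun p : M × M =>
      (u p.1 - u p.2) * (u p.1 - u p.2) / dist p.1 p.2 ^ (α + β)) (μ.prod μ) := by
  have hm := besov_measurable α β hu hu
  have h0 : ∀ p : M × M,
      0 ≤ (u p.1 - u p.2) * (u p.1 - u p.2) / dist p.1 p.2 ^ (α + β) := fun p =>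
    div_nonneg (mul_self_nonneg _) (Real.rpow_nonneg dist_nonneg _)
  have he : besovEnergy μ α β u = ∫⁻ p, ENNReal.ofReal
      ((u p.1 - u p.2) * (u p.1 - u p.2) / dist p.1 p.2 ^ (α + β)) ∂(μ.prod μ) := by
    rw [lintegral_prod _ hm.ennreal_ofReal.aemeasurable]
    simp only [besovEnergy, sq]
  rw [he, ← hasFiniteIntegral_iff_ofReal (ae_of_all _ h0)]
  exact ⟨fun h => ⟨hm.aestronglyMeasurable, h⟩, fun h => h.2⟩

theorem besov_integrable_mul {M : Type*} [MetricSpace M] [SecondCountableTopology M]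
    [MeasurableSpace M] [BorelSpace M] {μ : Measure M} [SFinite μ] (α β : ℝ) {u v : M → ℝ}
    (hu : Measurable u) (hv : Measurable v) (hfu : besovEnergy μ α β u < ⊤)
    (hfv : besovEnergy μ α β v < ⊤) :
    Integrable (fun p : M × M =>
      (u p.1 - u p.2) * (v p.1 - v p.2) / dist p.1 p.2 ^ (α + β)) (μ.prod μ) := by
  rw [besovEnergy_lt_top_iff α β hu] at hfu
  rw [besovEnergy_lt_top_iff α β hv] at hfv
  refine (hfu.add hfv).mono' (besov_measurable α β hu hv).aestronglyMeasurable
    (ae_of_all _ fun p => ?_)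
  have hd : 0 ≤ dist p.1 p.2 ^ (α + β) := Real.rpow_nonneg dist_nonneg _
  simp only [Pi.add_apply]
  rw [Real.norm_eq_abs, abs_div, abs_of_nonneg hd, ← add_div]
  refine div_le_div_of_nonneg_right ?_ hd
  rw [abs_le]
  constructor <;> nlinarith [sq_nonneg (u p.1 - u p.2 + (v p.1 - v p.2)),
    sq_nonneg (u p.1 - u p.2 - (v p.1 - v p.2)), sq_nonneg (u p.1 - u p.2),
    sq_nonneg (v p.1 - v p.2)]

theorem besovEnergy_congr {M : Type*} [MetricSpace M] [MeasurableSpace M] {μ : Measure M}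
    (α β : ℝ) {u v : M → ℝ} (h : u =ᵐ[μ] v) : besovEnergy μ α β u = besovEnergy μ α β v := by
  refine lintegral_congr_ae ?_
  filter_upwards [h] with x hx
  refine lintegral_congr_ae ?_
  filter_upwards [h] with y hy
  rw [hx, hy]

theorem besov_ae_fst_snd {M : Type*} [MeasurableSpace M] {μ : Measure M} [SFinite μ]
    {u v : M → ℝ} (h : u =ᵐ[μ] v) :
    ∀ᵐ p ∂(μ.prod μ), u p.1 = v p.1 ∧ u p.2 = v p.2 :=
  (Measure.quasiMeasurePreserving_fst.ae h).and (Measure.quasiMeasurePreserving_snd.ae h)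

variable {M : Type*} [MetricSpace M] [SecondCountableTopology M] [MeasurableSpace M]
  [BorelSpace M] (μ : Measure M) [SFinite μ] (α β : ℝ)

/-- The domain `F = {u ∈ L²(M; μ) : E(u,u) < ∞}`. -/
noncomputable def besovDomain : Submodule ℝ (Lp ℝ 2 μ) where
  carrier := {u | besovEnergy μ α β u < ⊤}
  zero_mem' := by
    have : besovEnergy μ α β (0 : Lp ℝ 2 μ) = 0 := by
      rw [besovEnergy_congr α β (Lp.coeFn_zero ℝ 2 μ)]
      simp [besovEnergy]
    change besovEnergy μ α β (0 : Lp ℝ 2 μ) < ⊤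
    rw [this]
    exact ENNReal.zero_lt_top
  add_mem' := by
    intro u v hu hv
    change besovEnergy μ α β u < ⊤ at hu
    change besovEnergy μ α β v < ⊤ at hv
    change besovEnergy μ α β (u + v : Lp ℝ 2 μ) < ⊤
    have mu := (Lp.stronglyMeasurable u).measurable
    have mv := (Lp.stronglyMeasurable v).measurable
    rw [besovEnergy_congr α β (Lp.coeFn_add u v), besovEnergy_lt_top_iff α β (mu.add mv)]
    have i1 := besov_integrable_mul α β mu mu hu hu
    have i2 := besov_integrable_mul α β mv mv hv hv
    have i3 := besov_integrable_mul α β mu mv hu hv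
    refine ((i1.add i2).add (i3.const_mul 2)).congr (ae_of_all _ fun p => ?_)
    simp only [Pi.add_apply]
    ring
  smul_mem' := by
    intro c u hu
    change besovEnergy μ α β u < ⊤ at hu
    change besovEnergy μ α β (c • u : Lp ℝ 2 μ) < ⊤
    have mu := (Lp.stronglyMeasurable u).measurable
    rw [besovEnergy_congr α β (Lp.coeFn_smul c u), besovEnergy_lt_top_iff α β (mu.const_smul c)]
    refine ((besov_integrable_mul α β mu mu hu hu).const_mul (c * c)).congr
      (ae_of_all _ fun p => ?_)
    simp only [Pi.smul_apply, smul_eq_mul]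
    ring

/-- The bilinear form `E(u,v) = ∬ (u(x) - u(y)) (v(x) - v(y)) / d(x,y)^(α+β) μ(dx) μ(dy)` on the
domain `F`. -/
noncomputable def besovForm : L2Form μ where
  domain := besovDomain μ α β
  form := LinearMap.mk₂ ℝ
    (fun u v => ∫ p : M × M,
      ((u : Lp ℝ 2 μ) p.1 - (u : Lp ℝ 2 μ) p.2) * ((v : Lp ℝ 2 μ) p.1 - (v : Lp ℝ 2 μ) p.2)
        / dist p.1 p.2 ^ (α + β) ∂(μ.prod μ))
    (by
      intro u v w
      have mm : ∀ z : besovDomain μ α β, Measurable (z : Lp ℝ 2 μ) :=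
        fun z => (Lp.stronglyMeasurable (z : Lp ℝ 2 μ)).measurable
      rw [← integral_add (besov_integrable_mul α β (mm u) (mm w) u.2 w.2)
        (besov_integrable_mul α β (mm v) (mm w) v.2 w.2)]
      refine integral_congr_ae ?_
      filter_upwards [besov_ae_fst_snd (Lp.coeFn_add (u : Lp ℝ 2 μ) (v : Lp ℝ 2 μ))] with p hp
      simp only [Submodule.coe_add, hp.1, hp.2, Pi.add_apply]
      ring)
    (by
      intro c u w
      rw [smul_eq_mul, ← integral_const_mul]
      refine integral_congr_ae ?_
      filter_upwards [besov_ae_fst_snd (Lp.coeFn_smul c (u : Lp ℝ 2 μ))] with p hp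
      simp only [Submodule.coe_smul, hp.1, hp.2, Pi.smul_apply, smul_eq_mul]
      ring)
    (by
      intro w u v
      have mm : ∀ z : besovDomain μ α β, Measurable (z : Lp ℝ 2 μ) :=
        fun z => (Lp.stronglyMeasurable (z : Lp ℝ 2 μ)).measurable
      rw [← integral_add (besov_integrable_mul α β (mm w) (mm u) w.2 u.2)
        (besov_integrable_mul α β (mm w) (mm v) w.2 v.2)]
      refine integral_congr_ae ?_
      filter_upwards [besov_ae_fst_snd (Lp.coeFn_add (u : Lp ℝ 2 μ) (v : Lp ℝ 2 μ))] with p hp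
      simp only [Submodule.coe_add, hp.1, hp.2, Pi.add_apply]
      ring)
    (by
      intro c w u
      rw [smul_eq_mul, ← integral_const_mul]
      refine integral_congr_ae ?_
      filter_upwards [besov_ae_fst_snd (Lp.coeFn_smul c (u : Lp ℝ 2 μ))] with p hp
      simp only [Submodule.coe_smul, hp.1, hp.2, Pi.smul_apply, smul_eq_mul]
      ring)

/-- On its domain the form is given by the (finite) energy. -/
theorem besovForm_self (u : (besovForm μ α β).domain) :
    (besovForm μ α β).form u u = (besovEnergy μ α β (u : Lp ℝ 2 μ)).toReal := by
  have mu := (Lp.stronglyMeasurable (u : Lp ℝ 2 μ)).measurable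
  have hm := besov_measurable α β mu mu
  have hi : (besovForm μ α β).form u u = ∫ p : M × M,
      ((u : Lp ℝ 2 μ) p.1 - (u : Lp ℝ 2 μ) p.2) * ((u : Lp ℝ 2 μ) p.1 - (u : Lp ℝ 2 μ) p.2)
        / dist p.1 p.2 ^ (α + β) ∂(μ.prod μ) := rfl
  rw [hi, integral_eq_lintegral_of_nonneg_ae (ae_of_all _ fun p =>
    div_nonneg (mul_self_nonneg _) (Real.rpow_nonneg dist_nonneg _)) hm.aestronglyMeasurable,
    lintegral_prod _ hm.ennreal_ofReal.aemeasurable]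
  simp only [besovEnergy, sq]

end Besov

/-! ### Walk dimension -/

/-- `α`-regularity: `μ(B(x,r)) ≍ r^α` for all `x ∈ M` and `0 < r < diam M`. -/
def IsAlphaRegular {M : Type*} [MetricSpace M] [MeasurableSpace M] (μ : Measure M) (α : ℝ) :
    Prop :=
  ∃ C : ℝ, 0 < C ∧ ∀ (x : M) (r : ℝ), 0 < r → ENNReal.ofReal r < Metric.ediam (univ : Set M) →
    ENNReal.ofReal (C⁻¹ * r ^ α) ≤ μ (Metric.ball x r) ∧
      μ (Metric.ball x r) ≤ ENNReal.ofReal (C * r ^ α)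

/-- `dw ∈ [0, ∞]` is the walk dimension of the `α`-regular space `(M, d, μ)`: the set of all
`β > 0` for which the Besov-type form is a regular Dirichlet form is the interval `(0, dw)`. -/
def IsWalkDimension {M : Type*} [MetricSpace M] [SecondCountableTopology M] [MeasurableSpace M]
    [BorelSpace M] (μ : Measure M) [SFinite μ] (α : ℝ) (dw : ℝ≥0∞) : Prop :=
  IsAlphaRegular μ α ∧
    {β : ℝ | 0 < β ∧ (besovForm μ α β).IsRegularDirichlet} =
      {β : ℝ | 0 < β ∧ ENNReal.ofReal β < dw}

/-! ### The Sierpiński gasket -/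

/-- The vertices `p₀ = (0,0)`, `p₁ = (1,0)`, `p₂ = (1/2, √3/2)`. -/
noncomputable def gasketVertex : Fin 3 → EuclideanSpace ℝ (Fin 2) :=
  ![!₂[0, 0], !₂[1, 0], !₂[1 / 2, √3 / 2]]

/-- The contractions `fᵢ(x) = (x + pᵢ)/2`. -/
noncomputable def gasketMap (i : Fin 3) (x : EuclideanSpace ℝ (Fin 2)) :
    EuclideanSpace ℝ (Fin 2) :=
  (1 / 2 : ℝ) • (x + gasketVertex i)

/-- The point with address `w₀w₁w₂…`, i.e. the limit of `f_{w₀} ∘ ⋯ ∘ f_{wₙ}`. -/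
noncomputable def gasketPoint (w : ℕ → Fin 3) : EuclideanSpace ℝ (Fin 2) :=
  ∑' k : ℕ, (1 / 2 : ℝ) ^ (k + 1) • gasketVertex (w k)

/-- The Sierpiński gasket: all points with an address. By `eq_sierpinskiGasket_iff` it is the
unique nonempty compact set `K` with `K = f₀(K) ∪ f₁(K) ∪ f₂(K)`. -/
def sierpinskiGasket : Set (EuclideanSpace ℝ (Fin 2)) :=
  range gasketPoint

theorem gasketPoint_bound : ∃ B : ℝ, ∀ i, ‖gasketVertex i‖ ≤ B :=
  ⟨∑ j, ‖gasketVertex j‖, fun i =>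
    Finset.single_le_sum (f := fun j => ‖gasketVertex j‖) (fun _ _ => norm_nonneg _)
      (Finset.mem_univ i)⟩

theorem gasket_summable_aux (B : ℝ) : Summable (fun k : ℕ => (1 / 2 : ℝ) ^ (k + 1) * B) := by
  have h : Summable (fun k : ℕ => (1 / 2 : ℝ) ^ k) :=
    summable_geometric_of_lt_one (by norm_num) (by norm_num)
  exact (h.comp_injective (add_left_injective 1)).mul_right B

theorem gasketPoint_summable (w : ℕ → Fin 3) :
    Summable (fun k : ℕ => (1 / 2 : ℝ) ^ (k + 1) • gasketVertex (w k)) := by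
  obtain ⟨B, hB⟩ := gasketPoint_bound
  refine Summable.of_norm_bounded (gasket_summable_aux B) fun k => ?_
  rw [norm_smul, Real.norm_of_nonneg (by positivity)]
  exact mul_le_mul_of_nonneg_left (hB _) (by positivity)

theorem gasketPoint_eq (w : ℕ → Fin 3) :
    gasketPoint w = gasketMap (w 0) (gasketPoint fun k => w (k + 1)) := by
  unfold gasketPoint gasketMap
  rw [(gasketPoint_summable w).tsum_eq_zero_add, smul_add, ← tsum_const_smul'', add_comm]
  congr 1
  · refine tsum_congr fun k => ?_
    rw [smul_smul]
    congr 1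
    ring
  · simp

theorem continuous_gasketPoint : Continuous gasketPoint := by
  obtain ⟨B, hB⟩ := gasketPoint_bound
  refine continuous_tsum (fun k => ?_) (gasket_summable_aux B) fun k w => ?_
  · have h : Continuous fun w : ℕ → Fin 3 => gasketVertex (w k) :=
      (continuous_of_discreteTopology (f := gasketVertex)).comp (continuous_apply k)
    exact h.const_smul ((1 / 2 : ℝ) ^ (k + 1))
  · rw [norm_smul, Real.norm_of_nonneg (by positivity)]
    exact mul_le_mul_of_nonneg_left (hB _) (by positivity)

theorem isCompact_sierpinskiGasket : IsCompact sierpinskiGasket :=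
  isCompact_range continuous_gasketPoint

theorem dist_gasketMap (i : Fin 3) (x y : EuclideanSpace ℝ (Fin 2)) :
    dist (gasketMap i x) (gasketMap i y) = 1 / 2 * dist x y := by
  unfold gasketMap
  rw [dist_smul₀, dist_add_right]
  norm_num

theorem sierpinskiGasket_eq : sierpinskiGasket = ⋃ i, gasketMap i '' sierpinskiGasket := by
  ext x
  simp only [mem_iUnion, mem_image, sierpinskiGasket, mem_range]
  constructor
  · rintro ⟨w, rfl⟩
    exact ⟨w 0, _, ⟨_, rfl⟩, (gasketPoint_eq w).symm⟩
  · rintro ⟨i, _, ⟨w, rfl⟩, rfl⟩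
    let w' : ℕ → Fin 3 := fun k => match k with
      | 0 => i
      | n + 1 => w n
    exact ⟨w', gasketPoint_eq w'⟩

theorem gasket_subset_aux {K L : Set (EuclideanSpace ℝ (Fin 2))} (hK : IsCompact K)
    (hL : IsCompact L) (hLn : L.Nonempty) (hKe : K = ⋃ i, gasketMap i '' K)
    (hLe : L = ⋃ i, gasketMap i '' L) : K ⊆ L := by
  obtain ⟨B, hB⟩ := Metric.isBounded_iff.1 (hK.isBounded.union hL.isBounded)
  obtain ⟨z, hz⟩ := hLn
  have key : ∀ n : ℕ, ∀ x ∈ K, ∃ y ∈ L, dist x y ≤ (1 / 2 : ℝ) ^ n * B := by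
    intro n
    induction n with
    | zero => exact fun x hx => ⟨z, hz, by simpa using hB (Or.inl hx) (Or.inr hz)⟩
    | succ n ih =>
      intro x hx
      rw [hKe] at hx
      obtain ⟨i, x', hx', rfl⟩ := mem_iUnion.1 hx
      obtain ⟨y, hy, hxy⟩ := ih x' hx'
      refine ⟨gasketMap i y, ?_, ?_⟩
      · rw [hLe]
        exact mem_iUnion.2 ⟨i, y, hy, rfl⟩
      · rw [dist_gasketMap, pow_succ']
        linarith
  intro x hx
  rw [← hL.isClosed.closure_eq, Metric.mem_closure_iff]
  intro ε hε
  have ht : Tendsto (fun n : ℕ => (1 / 2 : ℝ) ^ n * B) atTop (𝓝 0) := by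
    simpa using (tendsto_pow_atTop_nhds_zero_of_lt_one (r := (1 / 2 : ℝ)) (by norm_num)
      (by norm_num)).mul_const B
  obtain ⟨n, hn⟩ := (ht.eventually (gt_mem_nhds hε)).exists
  obtain ⟨y, hy, hxy⟩ := key n x hx
  exact ⟨y, hy, hxy.trans_lt hn⟩

/-- The Sierpiński gasket is the unique nonempty compact set `K = f₀(K) ∪ f₁(K) ∪ f₂(K)`. -/
theorem eq_sierpinskiGasket_iff (K : Set (EuclideanSpace ℝ (Fin 2))) :
    K = sierpinskiGasket ↔ K.Nonempty ∧ IsCompact K ∧ K = ⋃ i, gasketMap i '' K := by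
  have hn : sierpinskiGasket.Nonempty := ⟨_, fun _ => 0, rfl⟩
  constructor
  · rintro rfl
    exact ⟨hn, isCompact_sierpinskiGasket, sierpinskiGasket_eq⟩
  · rintro ⟨h1, h2, h3⟩
    exact Subset.antisymm
      (gasket_subset_aux h2 isCompact_sierpinskiGasket hn h3 sierpinskiGasket_eq)
      (gasket_subset_aux isCompact_sierpinskiGasket h2 h1 sierpinskiGasket_eq h3)

/-- `α = log 3 / log 2`. -/
noncomputable def gasketDim : ℝ := Real.log 3 / Real.log 2

/-- The normalized `α`-dimensional Hausdorff measure `ν` on the Sierpiński gasket (with the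
Euclidean metric). -/
noncomputable def gasketMeasure : Measure sierpinskiGasket :=
  (Measure.hausdorffMeasure gasketDim (univ : Set sierpinskiGasket))⁻¹ •
    Measure.hausdorffMeasure gasketDim

instance isFiniteMeasure_gasketMeasure : IsFiniteMeasure gasketMeasure where
  measure_univ_lt_top := by
    rw [gasketMeasure, Measure.smul_apply, smul_eq_mul]
    exact (ENNReal.inv_mul_le_one _).trans_lt ENNReal.one_lt_top

/-! Everything is transported to infinite words. The Hausdorff measure on the gasket is finite,
nonzero and invariant under the three half-scale contractions with equal weights. Such an invariant
probability measure is unique, so ν is the image of the Bernoulli measure (`map_point_bernoulli`).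
Distance is replaced by the combinatorial relation `Adj n`: adjacency at level n forces distance at
most 2·2^(-n), its failure forces distance at least 2^(-n)/2, and the adjacency class of a word has
mass at most 4·3^(-n). Inductions on the level peel off first letters.

Triviality for 2^β ≥ 5. Let E_n be the graph energy of the averages of u over n-cells. Averaging
loses at most the factor 3/5 per level: (3/5) E_n ≤ E_(n+1) (`le_cellEnergy_succ`, by a
series-resistance argument with a boundary term that makes the induction close). On the other hand,
Jensen's inequality and a finite Besov energy give E_n ≤ C (3/5)^n N_n, where N_n is the part of the
Besov energy carried by pairs at distance at most 2^(1-n). The two rates cancel and leave E_n ≤ C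
(3/5)^n N_(n+k) for every k. Since N_(n+k) → 0, all E_n vanish, also at the critical exponent. Hence
all cell averages agree, and u is constant almost everywhere (`ae_eq_const_of_besov_finite`).
Constants are not uniformly dense among continuous functions, so the form is not regular.

Regularity for 2^β < 5. Closedness is Fatou's lemma, and the unit contraction shrinks differences.
The domain is fed by functions harmonic on n-cells: the 2/5-2/5-1/5 rule multiplies the total corner
energy by 3/5 per subdivision, so its mean over words by 1/5. The contribution of distances of order
2^(-m) is then of order (2^β/5)^m, which is summable. Interpolating a continuous function gives
uniform density. For u in the domain, interpolating its averages over balls of radius 2^(-n) around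
the corners of the n-cells produces an error at most C N_n, both in energy and in squared L² norm
(`exists_interp_approx`), which gives density in the form norm. -/

namespace Gasket

/-! ### Addresses and the Bernoulli measure -/

/-- Infinite words in the letters `0, 1, 2`. -/
abbrev Address := ℕ → Fin 3

/-- Prepend a letter. -/
def cons (i : Fin 3) (σ : Address) : Address
  | 0 => i
  | k + 1 => σ k

/-- Remove the first letter. -/
def shift (σ : Address) : Address := fun k => σ (k + 1)

@[simp] theorem cons_zero (i : Fin 3) (σ : Address) : cons i σ 0 = i := rfl

@[simp] theorem cons_succ (i : Fin 3) (σ : Address) (k : ℕ) : cons i σ (k + 1) = σ k := rfl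

@[simp] theorem shift_cons (i : Fin 3) (σ : Address) : shift (cons i σ) = σ := rfl

@[simp] theorem cons_shift (σ : Address) : cons (σ 0) (shift σ) = σ := by
  funext k
  cases k <;> rfl

theorem measurable_shift : Measurable shift :=
  measurable_pi_lambda _ fun k => measurable_pi_apply (k + 1)

theorem measurable_cons (i : Fin 3) : Measurable (cons i) := by
  refine measurable_pi_lambda _ fun k => ?_
  cases k with
  | zero => exact measurable_const
  | succ k => exact measurable_pi_apply k

theorem measurable_of_comp_cons {γ : Type*} [MeasurableSpace γ] {f : Address → γ}
    (h : ∀ i, Measurable fun σ => f (cons i σ)) : Measurable f := by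
  have h1 : Measurable fun p : Fin 3 × Address => f (cons p.1 p.2) :=
    measurable_from_prod_countable_right h
  have h2 := h1.comp ((measurable_pi_apply 0).prodMk measurable_shift)
  convert h2 using 1
  funext σ
  simp

/-- The uniform probability measure on the three letters. -/
noncomputable def letterMeasure : Measure (Fin 3) := (3 : ℝ≥0∞)⁻¹ • Measure.count

scoped instance : IsProbabilityMeasure letterMeasure where
  measure_univ := by
    simp [letterMeasure, Measure.count_univ, ENNReal.inv_mul_cancel]

/-- The Bernoulli measure on addresses. -/
noncomputable def bernoulli : Measure Address := Measure.infinitePi fun _ => letterMeasure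

scoped instance : IsProbabilityMeasure bernoulli := by
  unfold bernoulli
  infer_instance

/-- The first letter is independent of the tail, and the tail is again Bernoulli. Through
`lintegral_bernoulli` this drives the integral inductions on the level. -/
theorem map_cons_eq_bernoulli :
    (letterMeasure.prod bernoulli).map (fun p : Fin 3 × Address => cons p.1 p.2) = bernoulli := by
  have hm : Measurable fun p : Fin 3 × Address => cons p.1 p.2 :=
    measurable_from_prod_countable_right measurable_cons
  refine Measure.eq_infinitePi _ fun s t ht => ?_
  -- Coordinate 0 is added with the full factor if it is absent, so that every cylinder splits as a
  -- condition on the first letter times a cylinder in the tail.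
  have hs : (s : Set ℕ).pi t = ((insert 0 s : Finset ℕ) : Set ℕ).pi
      (fun k => if k ∈ s then t k else univ) := by
    ext σ
    simp only [Set.mem_pi, Finset.coe_insert, Set.mem_insert_iff, Finset.mem_coe]
    constructor
    · intro h k _
      split_ifs with hk
      · exact h k hk
      · trivial
    · intro h k hk
      simpa [hk] using h k (Or.inr hk)
  have hp : ∏ k ∈ s, letterMeasure (t k) = ∏ k ∈ insert 0 s,
      letterMeasure (if k ∈ s then t k else univ) := by
    by_cases h0 : 0 ∈ s
    · rw [Finset.insert_eq_of_mem h0]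
      exact Finset.prod_congr rfl fun k hk => by simp [hk]
    · rw [Finset.prod_insert h0]
      simp only [h0, if_false, measure_univ, one_mul]
      exact Finset.prod_congr rfl fun k hk => by simp [hk]
  rw [hs, hp]
  set t' : ℕ → Set (Fin 3) := fun k => if k ∈ s then t k else univ with ht'
  have ht'm : ∀ k, MeasurableSet (t' k) := fun k => MeasurableSet.of_discrete
  set s' : Finset ℕ := (s.erase 0).image Nat.pred with hs'
  have himg : insert 0 s = insert 0 (s'.image Nat.succ) := by
    ext k
    simp only [Finset.mem_insert, hs', Finset.mem_image, Finset.mem_erase]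
    constructor
    · rintro (h | h)
      · exact Or.inl h
      · rcases Nat.eq_zero_or_pos k with h0 | h0
        · exact Or.inl h0
        · exact Or.inr ⟨k - 1, ⟨k, ⟨h0.ne', h⟩, rfl⟩, by simp; omega⟩
    · rintro (h | ⟨a, ⟨b, ⟨hb0, hb⟩, rfl⟩, rfl⟩)
      · exact Or.inl h
      · right
        have : Nat.succ (Nat.pred b) = b := Nat.succ_pred_eq_of_pos (Nat.pos_of_ne_zero hb0)
        rwa [this]
  have hpre : (fun p : Fin 3 × Address => cons p.1 p.2) ⁻¹'
      ((insert 0 s : Finset ℕ) : Set ℕ).pi t' =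
      t' 0 ×ˢ (s' : Set ℕ).pi (fun k => t' (k + 1)) := by
    rw [himg]
    ext ⟨i, σ⟩
    simp [Set.mem_pi]
  have hms : MeasurableSet (((insert 0 s : Finset ℕ) : Set ℕ).pi t') :=
    MeasurableSet.pi (Finset.countable_toSet _) fun k _ => ht'm k
  rw [Measure.map_apply hm hms, hpre, Measure.prod_prod, bernoulli,
    Measure.infinitePi_pi _ (fun k _ => ht'm (k + 1)), himg, Finset.prod_insert (by simp),
    Finset.prod_image (fun a _ b _ h => Nat.succ_injective h)]

theorem lintegral_bernoulli {f : Address → ℝ≥0∞} (hf : Measurable f) :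
    ∫⁻ σ, f σ ∂bernoulli = 3⁻¹ * ∑ i, ∫⁻ σ, f (cons i σ) ∂bernoulli := by
  have hm : Measurable fun p : Fin 3 × Address => cons p.1 p.2 :=
    measurable_from_prod_countable_right measurable_cons
  conv_lhs => rw [← map_cons_eq_bernoulli]
  have hfm : Measurable fun p : Fin 3 × Address => f (cons p.1 p.2) := hf.comp hm
  rw [lintegral_map hf hm, lintegral_prod _ hfm.aemeasurable, letterMeasure,
    lintegral_smul_measure, lintegral_count, tsum_fintype, smul_eq_mul]

theorem integral_bernoulli {f : Address → ℝ} (hf : Integrable f bernoulli) :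
    ∫ σ, f σ ∂bernoulli = 3⁻¹ * ∑ i, ∫ σ, f (cons i σ) ∂bernoulli := by
  have hm : Measurable fun p : Fin 3 × Address => cons p.1 p.2 :=
    measurable_from_prod_countable_right measurable_cons
  have hf' := hf
  rw [← map_cons_eq_bernoulli] at hf'
  conv_lhs => rw [← map_cons_eq_bernoulli]
  have hfi : Integrable (fun p : Fin 3 × Address => f (cons p.1 p.2))
      (letterMeasure.prod bernoulli) := hf'.comp_measurable hm
  rw [integral_map hm.aemeasurable hf'.1, integral_prod _ hfi, letterMeasure,
    integral_smul_measure, integral_fintype .of_finite]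
  simp [Measure.real]

theorem memLp_comp_cons {f : Address → ℝ} (hf : Measurable f)
    (h2 : ∫⁻ σ, ENNReal.ofReal (f σ ^ 2) ∂bernoulli < ⊤) (i : Fin 3) :
    ∫⁻ σ, ENNReal.ofReal (f (cons i σ) ^ 2) ∂bernoulli < ⊤ := by
  rw [lintegral_bernoulli (hf.pow_const 2).ennreal_ofReal] at h2
  have h3 : ∑ i, ∫⁻ σ, ENNReal.ofReal (f (cons i σ) ^ 2) ∂bernoulli < ⊤ := by
    by_contra h
    rw [not_lt, top_le_iff] at h
    rw [h, ENNReal.mul_top (by simp)] at h2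
    exact lt_irrefl _ h2
  exact (ENNReal.sum_lt_top.1 h3) i (Finset.mem_univ i)

theorem measurable_prodMap_cons (i j : Fin 3) :
    Measurable fun p : Address × Address => (cons i p.1, cons j p.2) :=
  ((measurable_cons i).comp measurable_fst).prodMk ((measurable_cons j).comp measurable_snd)

theorem lintegral_bernoulli_prod {G : Address × Address → ℝ≥0∞} (hG : Measurable G) :
    ∫⁻ p, G p ∂(bernoulli.prod bernoulli) =
      9⁻¹ * ∑ i, ∑ j, ∫⁻ p, G (cons i p.1, cons j p.2) ∂(bernoulli.prod bernoulli) := by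
  have h9 : (9 : ℝ≥0∞)⁻¹ = 3⁻¹ * 3⁻¹ := by
    rw [← ENNReal.mul_inv (by norm_num) (by norm_num)]
    norm_num
  have e : ∀ i j, ∫⁻ p, G (cons i p.1, cons j p.2) ∂(bernoulli.prod bernoulli) =
      ∫⁻ σ, ∫⁻ τ, G (cons i σ, cons j τ) ∂bernoulli ∂bernoulli := fun i j =>
    lintegral_prod _ (hG.comp (measurable_prodMap_cons i j)).aemeasurable
  rw [lintegral_prod _ hG.aemeasurable, lintegral_bernoulli hG.lintegral_prod_right', h9,
    mul_assoc]
  congr 1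
  rw [Finset.mul_sum]
  refine Finset.sum_congr rfl fun i _ => ?_
  simp only [e]
  have hi : Measurable fun p : Address × Address => G (cons i p.1, p.2) :=
    hG.comp (((measurable_cons i).comp measurable_fst).prodMk measurable_snd)
  have hj : ∀ j, Measurable fun σ => ∫⁻ τ, G (cons i σ, cons j τ) ∂bernoulli := fun j =>
    (hG.comp (measurable_prodMap_cons i j)).lintegral_prod_right'
  rw [← lintegral_finsetSum Finset.univ fun j _ => hj j,
    ← lintegral_const_mul _ (Finset.measurable_fun_sum _ fun j _ => hj j)]
  refine lintegral_congr fun σ => ?_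
  exact lintegral_bernoulli (hi.comp measurable_prodMk_left)

/-! ### Corner cells and adjacency of cells -/

/-- The first `n` letters of `σ` are all equal to `j`. -/
def Corner (n : ℕ) (j : Fin 3) (σ : Address) : Prop := ∀ k < n, σ k = j

theorem corner_zero (j : Fin 3) (σ : Address) : Corner 0 j σ := fun _ h => absurd h (by simp)

theorem corner_succ {n : ℕ} {j : Fin 3} {σ : Address} :
    Corner (n + 1) j σ ↔ σ 0 = j ∧ Corner n j (shift σ) := by
  constructor
  · exact fun h => ⟨h 0 (by simp), fun k hk => h (k + 1) (by omega)⟩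
  · rintro ⟨h0, h⟩ (_ | k) hk
    · exact h0
    · exact h k (by omega)

theorem measurableSet_corner (n : ℕ) (j : Fin 3) : MeasurableSet {σ | Corner n j σ} := by
  have : {σ : Address | Corner n j σ} = ⋂ k ∈ {k | k < n}, (fun σ : Address => σ k) ⁻¹' {j} := by
    ext σ
    simp [Corner]
  rw [this]
  exact MeasurableSet.biInter (Set.to_countable _) fun k _ =>
    measurable_pi_apply k (measurableSet_singleton j)

/-- The `n`-cells of `σ` and `τ` are equal or share a corner. -/
def Adj : ℕ → Address → Address → Prop
  | 0, _, _ => True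
  | n + 1, σ, τ => (σ 0 = τ 0 ∧ Adj n (shift σ) (shift τ)) ∨
      (σ 0 ≠ τ 0 ∧ Corner n (τ 0) (shift σ) ∧ Corner n (σ 0) (shift τ))

theorem Adj.symm : ∀ {n : ℕ} {σ τ : Address}, Adj n σ τ → Adj n τ σ
  | 0, _, _, _ => trivial
  | _ + 1, _, _, Or.inl h => Or.inl ⟨h.1.symm, h.2.symm⟩
  | _ + 1, _, _, Or.inr h => Or.inr ⟨h.1.symm, h.2.2, h.2.1⟩

theorem Adj.of_succ : ∀ {n : ℕ} {σ τ : Address}, Adj (n + 1) σ τ → Adj n σ τ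
  | 0, _, _, _ => trivial
  | _ + 1, _, _, Or.inl h => Or.inl ⟨h.1, h.2.of_succ⟩
  | _ + 1, _, _, Or.inr h =>
    Or.inr ⟨h.1, fun k hk => h.2.1 k (by omega), fun k hk => h.2.2 k (by omega)⟩

theorem Adj.mono {m n : ℕ} (h : m ≤ n) {σ τ : Address} (ha : Adj n σ τ) : Adj m σ τ := by
  induction n, h using Nat.le_induction with
  | base => exact ha
  | succ n _ ih => exact ih ha.of_succ

theorem adj_cons_self {n : ℕ} {i : Fin 3} {σ τ : Address} :
    Adj (n + 1) (cons i σ) (cons i τ) ↔ Adj n σ τ := by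
  simp [Adj]

theorem adj_cons_of_ne {n : ℕ} {i j : Fin 3} (h : i ≠ j) {σ τ : Address} :
    Adj (n + 1) (cons i σ) (cons j τ) ↔ Corner n j σ ∧ Corner n i τ := by
  simp [Adj, h]

theorem measurableSet_adj (n : ℕ) : MeasurableSet {p : Address × Address | Adj n p.1 p.2} := by
  induction n with
  | zero => simp [Adj]
  | succ n ih =>
    have h0 : ∀ i j : Fin 3, MeasurableSet {p : Address × Address | p.1 0 = i ∧ p.2 0 = j} := by
      intro i j
      have h : Measurable fun σ : Address => σ 0 := measurable_pi_apply 0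
      exact (h.comp measurable_fst (measurableSet_singleton i)).inter
        (h.comp measurable_snd (measurableSet_singleton j))
    have hs : Measurable fun p : Address × Address => (shift p.1, shift p.2) :=
      (measurable_shift.comp measurable_fst).prodMk (measurable_shift.comp measurable_snd)
    have : {p : Address × Address | Adj (n + 1) p.1 p.2} = ⋃ i : Fin 3, ⋃ j : Fin 3,
        {p | p.1 0 = i ∧ p.2 0 = j} ∩ (if i = j then
          (fun p : Address × Address => (shift p.1, shift p.2)) ⁻¹' {p | Adj n p.1 p.2} else
          {p | Corner n j (shift p.1)} ∩ {p | Corner n i (shift p.2)}) := by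
      ext ⟨σ, τ⟩
      simp only [mem_iUnion, mem_inter_iff, mem_ofPred_eq, Adj]
      constructor
      · rintro (h | h)
        · exact ⟨σ 0, τ 0, ⟨rfl, rfl⟩, by rw [if_pos h.1]; exact h.2⟩
        · exact ⟨σ 0, τ 0, ⟨rfl, rfl⟩, by rw [if_neg h.1]; exact h.2⟩
      · rintro ⟨i, j, ⟨rfl, rfl⟩, h⟩
        split_ifs at h with hij
        · exact Or.inl ⟨hij, h⟩
        · exact Or.inr ⟨hij, h⟩
    rw [this]
    refine MeasurableSet.iUnion fun i => MeasurableSet.iUnion fun j => (h0 i j).inter ?_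
    split_ifs
    · exact hs ih
    · exact ((measurable_shift.comp measurable_fst) (measurableSet_corner n j)).inter
        ((measurable_shift.comp measurable_snd) (measurableSet_corner n i))

/-! ### Masses of corner cells and of adjacency classes. -/

theorem measure_bernoulli {s : Set Address} (hs : MeasurableSet s) :
    bernoulli s = 3⁻¹ * ∑ i, bernoulli (cons i ⁻¹' s) := by
  rw [← lintegral_indicator_one hs, lintegral_bernoulli (measurable_one.indicator hs)]
  congr 1
  refine Finset.sum_congr rfl fun i _ => ?_
  rw [← lintegral_indicator_one (measurable_cons i hs)]
  rfl

theorem bernoulli_corner (n : ℕ) (j : Fin 3) :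
    bernoulli {σ | Corner n j σ} = (3⁻¹ : ℝ≥0∞) ^ n := by
  induction n with
  | zero => simp [corner_zero]
  | succ n ih =>
    rw [measure_bernoulli (measurableSet_corner _ _), Finset.sum_eq_single j]
    · have : cons j ⁻¹' {σ | Corner (n + 1) j σ} = {σ | Corner n j σ} := by
        ext σ
        simp [corner_succ]
      rw [this, ih, pow_succ']
    · intro i _ hij
      have : cons i ⁻¹' {σ | Corner (n + 1) j σ} = ∅ := by
        ext σ
        simp [corner_succ, hij]
      rw [this, measure_empty]
    · simp

-- A cell has three corners, and each of them either touches exactly one other cell or is a vertex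
-- of the whole gasket. The sum counts the outer corners, so that itself, neighbours and outer
-- corners always make four. The exact identity passes through the induction, where outer corners of
-- a subcell become neighbours.
open Classical in
theorem bernoulli_adj_add (n : ℕ) (σ : Address) :
    bernoulli {τ | Adj n σ τ} + ∑ j, (if Corner n j σ then (3⁻¹ : ℝ≥0∞) ^ n else 0) =
      4 * (3⁻¹ : ℝ≥0∞) ^ n := by
  induction n generalizing σ with
  | zero =>
    simp [Adj, corner_zero]
    norm_num
  | succ n ih =>
    have hm : MeasurableSet {τ | Adj (n + 1) σ τ} :=
      measurable_prodMk_left (measurableSet_adj (n + 1))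
    have hself : cons (σ 0) ⁻¹' {τ | Adj (n + 1) σ τ} = {τ | Adj n (shift σ) τ} := by
      ext τ
      simp [Adj]
    have hne : ∀ j, j ≠ σ 0 → bernoulli (cons j ⁻¹' {τ | Adj (n + 1) σ τ}) =
        if Corner n j (shift σ) then (3⁻¹ : ℝ≥0∞) ^ n else 0 := by
      intro j hj
      split_ifs with hc
      · rw [← bernoulli_corner n (σ 0)]
        congr 1
        ext τ
        simp [Adj, hj.symm, hc]
      · have : cons j ⁻¹' {τ | Adj (n + 1) σ τ} = ∅ := by
          ext τ
          simp [Adj, hj.symm, hc]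
        rw [this, measure_empty]
    have hcor : ∑ j, (if Corner (n + 1) j σ then (3⁻¹ : ℝ≥0∞) ^ (n + 1) else 0) =
        3⁻¹ * (if Corner n (σ 0) (shift σ) then (3⁻¹ : ℝ≥0∞) ^ n else 0) := by
      rw [Finset.sum_eq_single (σ 0)]
      · simp only [corner_succ, true_and]
        split_ifs <;> simp [pow_succ']
      · intro j _ hj
        simp [corner_succ, hj.symm]
      · simp
    rw [measure_bernoulli hm, hcor, ← mul_add, pow_succ', mul_left_comm, ← ih (shift σ),
      ← Finset.add_sum_erase _ _ (Finset.mem_univ (σ 0)), hself,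
      ← Finset.add_sum_erase _ (fun j => if Corner n j (shift σ) then (3⁻¹ : ℝ≥0∞) ^ n else 0)
        (Finset.mem_univ (σ 0)),
      Finset.sum_congr rfl fun j hj => hne j (Finset.ne_of_mem_erase hj)]
    ring

theorem bernoulli_adj_le (n : ℕ) (σ : Address) :
    bernoulli {τ | Adj n σ τ} ≤ 4 * (3⁻¹ : ℝ≥0∞) ^ n := by
  classical
  rw [← bernoulli_adj_add n σ]
  exact le_self_add

/-! ### Geometry of the gasket -/

/-- The excess over 1 halves at each step, and the a priori bound lets it tend to 0. It yields the
diameter and the range of barycentric coordinates from self-similarity. -/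
theorem le_one_of_le_half_add_half {X : Type*} {f : X → ℝ} {B : ℝ} (hB : ∀ x, f x ≤ B)
    (h : ∀ x, ∃ y, f x ≤ 1 / 2 * f y + 1 / 2) (x : X) : f x ≤ 1 := by
  have key : ∀ n : ℕ, ∀ x, f x ≤ 1 + (1 / 2 : ℝ) ^ n * |B| := by
    intro n
    induction n with
    | zero => exact fun x => by linarith [hB x, le_abs_self B]
    | succ n ih =>
      intro x
      obtain ⟨y, hy⟩ := h x
      have := ih y
      rw [pow_succ']
      linarith
  have ht : Tendsto (fun n : ℕ => 1 + (1 / 2 : ℝ) ^ n * |B|) atTop (𝓝 (1 + 0 * |B|)) :=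
    ((tendsto_pow_atTop_nhds_zero_of_lt_one (by norm_num) (by norm_num)).mul_const _).const_add _
  simpa using ge_of_tendsto' ht fun n => key n x

/-- Barycentric coordinates with respect to the three vertices. -/
noncomputable def coord (i : Fin 3) (x : EuclideanSpace ℝ (Fin 2)) : ℝ :=
  ![1 - x 0 - x 1 / √3, x 0 - x 1 / √3, 2 * x 1 / √3] i

theorem coord_gasketMap (i k : Fin 3) (x : EuclideanSpace ℝ (Fin 2)) :
    coord i (gasketMap k x) = 1 / 2 * coord i x + 1 / 2 * if k = i then 1 else 0 := by
  have h3 : √3 / √3 = 1 := div_self (by positivity)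
  fin_cases i <;> fin_cases k <;>
    simp [coord, gasketMap, gasketVertex] <;> field_simp <;> ring

/-- The gradient of a barycentric coordinate has norm 2/√3; the constant 2 is a convenient upper
bound. -/
theorem abs_coord_sub_le (i : Fin 3) (x y : EuclideanSpace ℝ (Fin 2)) :
    |coord i x - coord i y| ≤ 2 * dist x y := by
  rw [EuclideanSpace.dist_eq, Fin.sum_univ_two, Real.dist_eq, Real.dist_eq, sq_abs, sq_abs]
  have h3 : (0 : ℝ) < √3 := by positivity
  have h3' : √3 ^ 2 = 3 := Real.sq_sqrt (by norm_num)
  -- Measuring heights in units of √3 makes all coefficients rational.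
  obtain ⟨t, ht⟩ : ∃ t, x 1 - y 1 = t * √3 := ⟨(x 1 - y 1) / √3, by field_simp⟩
  set u := x 0 - y 0 with hu
  have ht2 : (x 1 - y 1) / √3 = t := by rw [ht]; field_simp
  have hx : x 0 = u + y 0 := by simp [hu]
  have e2 : x 1 / √3 - y 1 / √3 = t := by rw [← sub_div, ht2]
  refine abs_le_of_sq_le_sq ?_ (by positivity)
  rw [mul_pow, Real.sq_sqrt (by positivity), ht, mul_pow, h3']
  have e : coord i x - coord i y = ![-u - t, u - t, 2 * t] i := by
    fin_cases i
    · simp only [coord, Fin.zero_eta, Matrix.cons_val_zero]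
      linarith
    · simp only [coord, Fin.mk_one, Matrix.cons_val_one, Matrix.cons_val_zero]
      linarith
    · simp only [coord, Fin.reduceFinMk, Matrix.cons_val]
      rw [mul_div_assoc, mul_div_assoc]
      linarith
  rw [e]
  fin_cases i <;> simp <;>
    nlinarith [sq_nonneg (u - t), sq_nonneg (u + t), sq_nonneg u, sq_nonneg t]

theorem ext_coord {x y : EuclideanSpace ℝ (Fin 2)} {i j : Fin 3} (hij : i ≠ j)
    (hi : coord i x = coord i y) (hj : coord j x = coord j y) : x = y := by
  have h3 : √3 ≠ 0 := by positivity
  have h : x 0 = y 0 ∧ x 1 = y 1 := by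
    have e : ∀ z : EuclideanSpace ℝ (Fin 2), z 1 = z 1 / √3 * √3 := fun z => by field_simp
    have q : x 1 = y 1 → x 1 / √3 = y 1 / √3 := fun h => by rw [h]
    suffices x 0 = y 0 ∧ x 1 / √3 = y 1 / √3 by
      exact ⟨this.1, by rw [e x, e y, this.2]⟩
    fin_cases i <;> fin_cases j <;>
      simp [coord] at hi hj hij <;> (try have hi := q hi) <;> (try have hj := q hj) <;>
      constructor <;> linarith
  ext k
  fin_cases k
  · exact h.1
  · exact h.2

theorem dist_gasketVertex_le (i j : Fin 3) : dist (gasketVertex i) (gasketVertex j) ≤ 1 := by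
  have h3' : √3 ^ 2 = 3 := Real.sq_sqrt (by norm_num)
  rw [EuclideanSpace.dist_eq, Fin.sum_univ_two, Real.dist_eq, Real.dist_eq, sq_abs, sq_abs,
    Real.sqrt_le_one]
  fin_cases i <;> fin_cases j <;> simp [gasketVertex] <;> nlinarith

theorem gasketMap_gasketVertex_comm (i j : Fin 3) :
    gasketMap i (gasketVertex j) = gasketMap j (gasketVertex i) := by
  rw [gasketMap, gasketMap, add_comm]

theorem gasketPoint_cons (i : Fin 3) (σ : Address) :
    gasketPoint (cons i σ) = gasketMap i (gasketPoint σ) :=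
  gasketPoint_eq (cons i σ)

theorem gasketPoint_shift (σ : Address) :
    gasketPoint σ = gasketMap (σ 0) (gasketPoint (shift σ)) :=
  gasketPoint_eq σ

theorem gasketPoint_const (i : Fin 3) : gasketPoint (fun _ => i) = gasketVertex i := by
  have h : gasketPoint (fun _ => i) = (1 / 2 : ℝ) • (gasketPoint (fun _ => i) + gasketVertex i) :=
    gasketPoint_eq fun _ => i
  have h2 := congrArg (fun x => (2 : ℝ) • x) h
  simp only [smul_smul, two_smul] at h2
  norm_num at h2
  exact h2

theorem dist_gasketMap_gasketMap_le (i j : Fin 3) (x y : EuclideanSpace ℝ (Fin 2)) :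
    dist (gasketMap i x) (gasketMap j y) ≤ 1 / 2 * dist x y + 1 / 2 := by
  have h : dist (gasketMap i x) (gasketMap j y) =
      1 / 2 * dist (x + gasketVertex i) (y + gasketVertex j) := by
    unfold gasketMap
    rw [dist_smul₀]
    norm_num
  rw [h]
  linarith [dist_add_add_le x (gasketVertex i) y (gasketVertex j), dist_gasketVertex_le i j]

theorem dist_gasketPoint_le_one (σ τ : Address) : dist (gasketPoint σ) (gasketPoint τ) ≤ 1 := by
  obtain ⟨B, hB⟩ := Metric.isBounded_iff.1 isCompact_sierpinskiGasket.isBounded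
  refine le_one_of_le_half_add_half (X := Address × Address) (B := B)
    (f := fun p => dist (gasketPoint p.1) (gasketPoint p.2))
    (fun p => hB ⟨_, rfl⟩ ⟨_, rfl⟩) (fun p => ⟨(shift p.1, shift p.2), ?_⟩) (σ, τ)
  simp only
  conv_lhs => rw [gasketPoint_shift p.1, gasketPoint_shift p.2]
  exact dist_gasketMap_gasketMap_le _ _ _ _

theorem exists_abs_coord_le (i : Fin 3) : ∃ B : ℝ, ∀ σ, |coord i (gasketPoint σ)| ≤ B := by
  refine ⟨2 * 1 + |coord i (gasketPoint fun _ => 0)|, fun σ => ?_⟩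
  have h1 := abs_coord_sub_le i (gasketPoint σ) (gasketPoint fun _ => 0)
  have h2 := dist_gasketPoint_le_one σ (fun _ => 0)
  have h3 := abs_sub_abs_le_abs_sub (coord i (gasketPoint σ)) (coord i (gasketPoint fun _ => 0))
  linarith

theorem coord_gasketPoint (i : Fin 3) (σ : Address) : coord i (gasketPoint σ) =
    1 / 2 * coord i (gasketPoint (shift σ)) + 1 / 2 * if σ 0 = i then 1 else 0 := by
  rw [gasketPoint_shift σ, coord_gasketMap]

theorem coord_gasketPoint_le_one (i : Fin 3) (σ : Address) : coord i (gasketPoint σ) ≤ 1 := by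
  obtain ⟨B, hB⟩ := exists_abs_coord_le i
  refine le_one_of_le_half_add_half (f := fun σ => coord i (gasketPoint σ))
    (fun σ => (le_abs_self _).trans (hB σ)) (fun σ => ⟨shift σ, ?_⟩) σ
  rw [coord_gasketPoint i σ]
  split_ifs <;> linarith

theorem coord_gasketPoint_nonneg (i : Fin 3) (σ : Address) : 0 ≤ coord i (gasketPoint σ) := by
  obtain ⟨B, hB⟩ := exists_abs_coord_le i
  have := le_one_of_le_half_add_half (f := fun σ => 1 - coord i (gasketPoint σ)) (B := 1 + B)
    (fun σ => by linarith [neg_abs_le (coord i (gasketPoint σ)), hB σ])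
    (fun σ => ⟨shift σ, by
      rw [coord_gasketPoint i σ]
      split_ifs <;> linarith⟩) σ
  linarith

/-- The coordinate is the binary number whose digits mark the places where σ has the letter i; a
zero digit at place k costs 2^(-(k+1)). -/
theorem coord_gasketPoint_le {i : Fin 3} : ∀ {k : ℕ} {σ : Address}, σ k ≠ i →
    coord i (gasketPoint σ) ≤ 1 - (1 / 2) ^ (k + 1)
  | 0, σ, h => by
    rw [coord_gasketPoint, if_neg h]
    linarith [coord_gasketPoint_le_one i (shift σ)]
  | k + 1, σ, h => by
    have := coord_gasketPoint_le (k := k) (σ := shift σ) h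
    rw [coord_gasketPoint, pow_succ']
    split_ifs <;> linarith [pow_pos (one_half_pos (α := ℝ)) (k + 1)]

/-- The coordinate i is at least 1/2 on cell i, and stays below 1/2 by at least 2^(-(n+1)) at a
point of cell j whose tail leaves the corner i before n letters. Dividing the gap by the Lipschitz
constant 2 gives the bound. -/
theorem le_dist_of_ne {n k : ℕ} (hk : k < n) {i j : Fin 3} (hij : i ≠ j) {σ τ : Address}
    (h : τ k ≠ i) :
    (1 / 2 : ℝ) ^ (n + 1) / 2 ≤ dist (gasketMap i (gasketPoint σ)) (gasketMap j (gasketPoint τ)) := by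
  have h1 := coord_gasketPoint_le h
  have h2 := coord_gasketPoint_nonneg i σ
  have h3 := abs_coord_sub_le i (gasketMap i (gasketPoint σ)) (gasketMap j (gasketPoint τ))
  rw [coord_gasketMap, coord_gasketMap, if_pos rfl, if_neg hij.symm] at h3
  have h4 := le_abs_self (1 / 2 * coord i (gasketPoint σ) + 1 / 2 * 1 -
    (1 / 2 * coord i (gasketPoint τ) + 1 / 2 * 0))
  have h5 : (1 / 2 : ℝ) ^ n ≤ (1 / 2) ^ (k + 1) :=
    pow_le_pow_of_le_one (by norm_num) (by norm_num) hk
  rw [pow_succ']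
  linarith

theorem le_dist_of_not_adj {n : ℕ} {σ τ : Address} (h : ¬ Adj n σ τ) :
    (1 / 2 : ℝ) ^ n / 2 ≤ dist (gasketPoint σ) (gasketPoint τ) := by
  induction n generalizing σ τ with
  | zero => exact absurd trivial h
  | succ n ih =>
    simp only [Adj, not_or, not_and] at h
    rw [gasketPoint_shift σ, gasketPoint_shift τ]
    by_cases h0 : σ 0 = τ 0
    · rw [h0, dist_gasketMap, pow_succ']
      linarith [ih (h.1 h0)]
    · by_cases hc : Corner n (τ 0) (shift σ)
      · have := h.2 h0 hc
        simp only [Corner, not_forall] at this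
        obtain ⟨k, hk, hne⟩ := this
        exact le_dist_of_ne hk h0 hne
      · simp only [Corner, not_forall] at hc
        obtain ⟨k, hk, hne⟩ := hc
        rw [dist_comm]
        exact le_dist_of_ne hk (Ne.symm h0) hne

theorem adj_of_dist_lt {n : ℕ} {σ τ : Address}
    (h : dist (gasketPoint σ) (gasketPoint τ) < (1 / 2 : ℝ) ^ n / 2) : Adj n σ τ := by
  by_contra hn
  exact absurd (le_dist_of_not_adj hn) (not_le.2 h)

theorem dist_gasketPoint_of_agree {n : ℕ} {σ τ : Address} (h : ∀ k < n, σ k = τ k) :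
    dist (gasketPoint σ) (gasketPoint τ) ≤ (1 / 2) ^ n := by
  induction n generalizing σ τ with
  | zero => simpa using dist_gasketPoint_le_one σ τ
  | succ n ih =>
    rw [gasketPoint_shift σ, gasketPoint_shift τ, h 0 (by simp), dist_gasketMap, pow_succ']
    linarith [ih (σ := shift σ) (τ := shift τ) fun k hk => h (k + 1) (by omega)]

theorem dist_gasketVertex_of_corner {n : ℕ} {j : Fin 3} {σ : Address} (h : Corner n j σ) :
    dist (gasketPoint σ) (gasketVertex j) ≤ (1 / 2) ^ n := by
  rw [← gasketPoint_const]
  exact dist_gasketPoint_of_agree h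

/-- Go through the corner common to the two cells, which exists because f_i(p_j) = f_j(p_i). With
`le_dist_of_not_adj` this makes adjacency comparable to distance of order 2^(-n). -/
theorem dist_le_of_adj {n : ℕ} {σ τ : Address} (h : Adj n σ τ) :
    dist (gasketPoint σ) (gasketPoint τ) ≤ 2 * (1 / 2) ^ n := by
  induction n generalizing σ τ with
  | zero => linarith [dist_gasketPoint_le_one σ τ, pow_zero (1 / 2 : ℝ)]
  | succ n ih =>
    rw [gasketPoint_shift σ, gasketPoint_shift τ, pow_succ']
    rcases h with ⟨h0, h⟩ | ⟨h0, h1, h2⟩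
    · rw [h0, dist_gasketMap]
      linarith [ih h]
    · have e1 := dist_gasketMap (σ 0) (gasketPoint (shift σ)) (gasketVertex (τ 0))
      have e2 := dist_gasketMap (τ 0) (gasketPoint (shift τ)) (gasketVertex (σ 0))
      rw [gasketMap_gasketVertex_comm] at e1
      have := dist_triangle_right (gasketMap (σ 0) (gasketPoint (shift σ)))
        (gasketMap (τ 0) (gasketPoint (shift τ))) (gasketMap (τ 0) (gasketVertex (σ 0)))
      linarith [dist_gasketVertex_of_corner h1, dist_gasketVertex_of_corner h2]

/-! ### The gasket as a metric space -/

/-- The point of the gasket with a given address. -/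
noncomputable def point (σ : Address) : sierpinskiGasket := ⟨gasketPoint σ, σ, rfl⟩

theorem dist_point (σ τ : Address) :
    dist (point σ) (point τ) = dist (gasketPoint σ) (gasketPoint τ) :=
  rfl

theorem point_surjective : Function.Surjective point := by
  rintro ⟨_, σ, rfl⟩
  exact ⟨σ, rfl⟩

theorem continuous_point : Continuous point :=
  continuous_gasketPoint.subtype_mk _

theorem measurable_point : Measurable point := continuous_point.measurable

scoped instance : CompactSpace sierpinskiGasket :=
  isCompact_iff_compactSpace.1 isCompact_sierpinskiGasket

/-- The contractions of the gasket into itself. -/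
noncomputable def contraction (i : Fin 3) (x : sierpinskiGasket) : sierpinskiGasket :=
  ⟨gasketMap i x, by
    obtain ⟨_, σ, rfl⟩ := x
    exact ⟨cons i σ, gasketPoint_cons i σ⟩⟩

theorem point_cons (i : Fin 3) (σ : Address) : point (cons i σ) = contraction i (point σ) :=
  Subtype.ext (gasketPoint_cons i σ)

theorem point_shift (σ : Address) : point σ = contraction (σ 0) (point (shift σ)) := by
  rw [← point_cons, cons_shift]

theorem dist_contraction (i : Fin 3) (x y : sierpinskiGasket) :
    dist (contraction i x) (contraction i y) = 1 / 2 * dist x y :=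
  dist_gasketMap i x y

theorem continuous_contraction (i : Fin 3) : Continuous (contraction i) :=
  (LipschitzWith.of_dist_le_mul (K := 1 / 2) fun x y => by
    rw [dist_contraction]
    simp).continuous

theorem measurable_contraction (i : Fin 3) : Measurable (contraction i) :=
  (continuous_contraction i).measurable

theorem iUnion_range_contraction : ⋃ i, range (contraction i) = univ := by
  refine eq_univ_of_forall fun x => ?_
  obtain ⟨σ, rfl⟩ := point_surjective x
  exact mem_iUnion.2 ⟨σ 0, point (shift σ), (point_shift σ).symm⟩

/-- On cell i the coordinate i is at least 1/2 and the coordinate j at most 1/2, and conversely on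
cell j. On the overlap both equal 1/2, and two barycentric coordinates determine a point. -/
theorem subsingleton_range_inter_range {i j : Fin 3} (hij : i ≠ j) :
    (range (contraction i) ∩ range (contraction j)).Subsingleton := by
  have key : ∀ x ∈ range (contraction i) ∩ range (contraction j),
      coord i (x : EuclideanSpace ℝ (Fin 2)) = 1 / 2 ∧
        coord j (x : EuclideanSpace ℝ (Fin 2)) = 1 / 2 := by
    rintro _ ⟨⟨x, rfl⟩, ⟨y, hy⟩⟩
    obtain ⟨σ, rfl⟩ := point_surjective x
    obtain ⟨τ, rfl⟩ := point_surjective y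
    have hy' : gasketMap j (gasketPoint τ) = gasketMap i (gasketPoint σ) := congrArg Subtype.val hy
    change coord i (gasketMap i (gasketPoint σ)) = 1 / 2 ∧
      coord j (gasketMap i (gasketPoint σ)) = 1 / 2
    have hi := congrArg (coord i) hy'
    have hj := congrArg (coord j) hy'
    simp only [coord_gasketMap, hij, hij.symm, if_true, if_false] at hi hj ⊢
    constructor <;> linarith [coord_gasketPoint_nonneg i σ, coord_gasketPoint_le_one i τ,
      coord_gasketPoint_nonneg j τ, coord_gasketPoint_le_one j σ]
  intro x hx y hy
  exact Subtype.ext (ext_coord hij ((key x hx).1.trans (key y hy).1.symm)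
    ((key x hx).2.trans (key y hy).2.symm))

/-! ### The Hausdorff measure of the gasket -/

theorem log_two_pos : 0 < Real.log 2 := Real.log_pos (by norm_num)

theorem gasketDim_pos : 0 < gasketDim :=
  div_pos (Real.log_pos (by norm_num)) log_two_pos

theorem two_rpow_gasketDim : (2 : ℝ) ^ gasketDim = 3 := by
  rw [Real.rpow_def_of_pos (by norm_num), gasketDim, mul_div_cancel₀ _ log_two_pos.ne',
    Real.exp_log (by norm_num)]

theorem half_pow_rpow_gasketDim (n : ℕ) : ((1 / 2 : ℝ) ^ n) ^ gasketDim = (1 / 3) ^ n := by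
  rw [← Real.rpow_natCast, ← Real.rpow_mul (by norm_num), mul_comm, Real.rpow_mul (by norm_num),
    Real.div_rpow (by norm_num) (by norm_num), two_rpow_gasketDim, Real.one_rpow,
    Real.rpow_natCast]

theorem ofReal_third_pow (n : ℕ) : ENNReal.ofReal ((1 / 3) ^ n) = (3⁻¹ : ℝ≥0∞) ^ n := by
  rw [ENNReal.ofReal_pow (by norm_num), one_div, ENNReal.ofReal_inv_of_pos (by norm_num)]
  norm_num

theorem ennreal_two_rpow_gasketDim : (2 : ℝ≥0∞) ^ gasketDim = 3 := by
  have := ENNReal.ofReal_rpow_of_pos (x := 2) (p := gasketDim) (by norm_num)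
  rw [two_rpow_gasketDim] at this
  simpa using this

/-- Since 4·2^(-n) = 2^(-(n-3))/2, such words are adjacent at level n-3, and 4·3^(-(n-3)) =
108·3^(-n). For n < 3 the right side exceeds 1. -/
theorem bernoulli_dist_lt_le (n : ℕ) (σ : Address) :
    bernoulli {τ | dist (gasketPoint σ) (gasketPoint τ) < 4 * (1 / 2) ^ n} ≤
      108 * (3⁻¹ : ℝ≥0∞) ^ n := by
  by_cases hn : 3 ≤ n
  · obtain ⟨k, rfl⟩ := Nat.exists_eq_add_of_le' hn
    calc bernoulli {τ | dist (gasketPoint σ) (gasketPoint τ) < 4 * (1 / 2) ^ (k + 3)}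
        ≤ bernoulli {τ | Adj k σ τ} := measure_mono fun τ hτ => adj_of_dist_lt (by
          refine lt_of_lt_of_eq hτ ?_
          rw [pow_add]
          ring)
      _ ≤ 4 * (3⁻¹ : ℝ≥0∞) ^ k := bernoulli_adj_le k σ
      _ = 108 * (3⁻¹ : ℝ≥0∞) ^ (k + 3) := by
        rw [← ofReal_third_pow, ← ofReal_third_pow, ← ENNReal.ofReal_ofNat 4,
          ← ENNReal.ofReal_ofNat 108, ← ENNReal.ofReal_mul (by norm_num),
          ← ENNReal.ofReal_mul (by norm_num)]
        congr 1
        rw [pow_add]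
        ring
  · refine prob_le_one.trans ?_
    rw [← ofReal_third_pow, ← ENNReal.ofReal_ofNat 108, ← ENNReal.ofReal_mul (by norm_num),
      ENNReal.one_le_ofReal]
    have : (1 / 3 : ℝ) ^ 3 ≤ (1 / 3) ^ n :=
      pow_le_pow_of_le_one (by norm_num) (by norm_num) (by omega)
    norm_num at this ⊢
    linarith

theorem map_point_ball_le (n : ℕ) (x : sierpinskiGasket) :
    bernoulli.map point (Metric.ball x (4 * (1 / 2) ^ n)) ≤ 108 * (3⁻¹ : ℝ≥0∞) ^ n := by
  obtain ⟨σ, rfl⟩ := point_surjective x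
  rw [Measure.map_apply measurable_point Metric.isOpen_ball.measurableSet]
  refine le_trans (measure_mono fun τ hτ => ?_) (bernoulli_dist_lt_le n σ)
  rw [mem_preimage, Metric.mem_ball, dist_comm] at hτ
  exact hτ

/-- Mass distribution principle: a set of diameter d lies in a ball of comparable radius, so its
mass is at most 108·d^α. This makes the Hausdorff measure nonzero. -/
theorem map_point_le_hausdorffMeasure :
    (108⁻¹ : ℝ≥0∞) • bernoulli.map point ≤ Measure.hausdorffMeasure gasketDim := by
  refine Measure.le_hausdorffMeasure _ _ 1 one_pos fun s hs => ?_
  rw [Measure.smul_apply, smul_eq_mul]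
  rcases s.eq_empty_or_nonempty with rfl | ⟨x, hx⟩
  · simp
  have hle : ∀ y ∈ s, dist y x ≤ (Metric.ediam s).toReal := fun y hy => by
    rw [dist_edist]
    exact ENNReal.toReal_mono (ne_top_of_le_ne_top ENNReal.one_ne_top hs)
      (Metric.edist_le_ediam_of_mem hy hx)
  have hball : ∀ n : ℕ, (Metric.ediam s).toReal < 4 * (1 / 2) ^ n →
      108⁻¹ * bernoulli.map point s ≤ (3⁻¹ : ℝ≥0∞) ^ n := fun n hn => by
    refine (mul_le_mul_right ((measure_mono fun y hy => ?_).trans (map_point_ball_le n x)) _).trans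
      (le_of_eq ?_)
    · exact (hle y hy).trans_lt hn
    · rw [← mul_assoc, ENNReal.inv_mul_cancel (by norm_num) (by norm_num), one_mul]
  -- A set of diameter zero lies in balls of every level, so its mass vanishes; otherwise one dyadic
  -- level is chosen.
  rcases eq_or_ne (Metric.ediam s) 0 with h0 | h0
  · rw [h0] at hball ⊢
    refine ge_of_tendsto' (f := fun n : ℕ => (3⁻¹ : ℝ≥0∞) ^ n) (x := atTop) ?_
      fun n => hball n (by simp)
    rw [ENNReal.zero_rpow_of_pos gasketDim_pos]
    exact ENNReal.tendsto_pow_atTop_nhds_zero_of_lt_one (by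
      rw [ENNReal.inv_lt_one]
      norm_num)
  · have htop := ne_top_of_le_ne_top ENNReal.one_ne_top hs
    have hpos := ENNReal.toReal_pos h0 htop
    obtain ⟨n, hn1, hn2⟩ := exists_nat_pow_near_of_lt_one hpos
      (ENNReal.toReal_mono ENNReal.one_ne_top hs) (one_half_pos (α := ℝ)) one_half_lt_one
    -- At level n+1 the radius is 2·2^(-n), strictly above the diameter, while 3^(-(n+1)) is still
    -- at most the diameter to the power α.
    refine (hball (n + 1) ?_).trans ?_
    · rw [pow_succ]
      linarith
    · rw [← ofReal_third_pow, ← half_pow_rpow_gasketDim,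
        ← ENNReal.ofReal_rpow_of_pos (by positivity)]
      refine ENNReal.rpow_le_rpow ?_ gasketDim_pos.le
      rw [ENNReal.ofReal_le_iff_le_toReal htop]
      exact hn1.le

theorem hausdorffMeasure_univ_ne_zero :
    Measure.hausdorffMeasure gasketDim (univ : Set sierpinskiGasket) ≠ 0 := by
  intro h
  have := map_point_le_hausdorffMeasure univ
  rw [h, Measure.smul_apply, Measure.map_apply measurable_point MeasurableSet.univ] at this
  simp at this

theorem ediam_point_image_le (n : ℕ) (w : Fin n → Fin 3) :
    Metric.ediam (point '' {σ | ∀ k : Fin n, σ k = w k}) ≤ ENNReal.ofReal ((1 / 2) ^ n) := by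
  refine Metric.ediam_le ?_
  rintro _ ⟨σ, hσ, rfl⟩ _ ⟨τ, hτ, rfl⟩
  rw [edist_dist, dist_point]
  exact ENNReal.ofReal_le_ofReal (dist_gasketPoint_of_agree fun k hk =>
    (hσ ⟨k, hk⟩).trans (hτ ⟨k, hk⟩).symm)

/-- The 3^n cells of level n have diameter at most 2^(-n), and (2^(-n))^α = 3^(-n): the covering
sums are at most 1. -/
theorem hausdorffMeasure_univ_ne_top :
    Measure.hausdorffMeasure gasketDim (univ : Set sierpinskiGasket) ≠ ⊤ := by
  have h := Measure.hausdorffMeasure_le_liminf_sum (ι := fun n : ℕ => Fin n → Fin 3) gasketDim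
    (univ : Set sierpinskiGasket) (l := atTop) (fun n : ℕ => ENNReal.ofReal ((1 / 2) ^ n)) (by
      rw [← ENNReal.ofReal_zero]
      exact ENNReal.tendsto_ofReal (tendsto_pow_atTop_nhds_zero_of_lt_one (by norm_num)
        (by norm_num)))
    (fun n w => point '' {σ | ∀ k : Fin n, σ k = w k})
    (Eventually.of_forall fun n w => ediam_point_image_le n w)
    (Eventually.of_forall fun n x _ => by
      obtain ⟨σ, rfl⟩ := point_surjective x
      exact mem_iUnion.2 ⟨fun k => σ k, σ, fun k => rfl, rfl⟩)
  refine ne_top_of_le_ne_top ENNReal.one_ne_top (h.trans ?_)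
  refine (liminf_le_liminf (v := fun _ : ℕ => (1 : ℝ≥0∞)) (Eventually.of_forall fun n => ?_)).trans
    (liminf_const 1).le
  calc ∑ w : Fin n → Fin 3, Metric.ediam (point '' {σ | ∀ k : Fin n, σ k = w k}) ^ gasketDim
      ≤ ∑ w : Fin n → Fin 3, (3⁻¹ : ℝ≥0∞) ^ n := by
        refine Finset.sum_le_sum fun w _ => ?_
        rw [← ofReal_third_pow, ← half_pow_rpow_gasketDim,
          ← ENNReal.ofReal_rpow_of_pos (by positivity)]
        exact ENNReal.rpow_le_rpow (ediam_point_image_le n w) gasketDim_pos.le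
    _ = 1 := by
      simp only [Finset.sum_const, Finset.card_univ, Fintype.card_fun, Fintype.card_fin,
        nsmul_eq_mul, Nat.cast_pow, Nat.cast_ofNat]
      rw [← mul_pow, ENNReal.mul_inv_cancel (by norm_num) (by norm_num), one_pow]

theorem hausdorffMeasure_contraction_image (i : Fin 3) (s : Set sierpinskiGasket) :
    3 * Measure.hausdorffMeasure gasketDim (contraction i '' s) =
      Measure.hausdorffMeasure gasketDim s := by
  refine le_antisymm ?_ ?_
  · have h : LipschitzWith (1 / 2) (contraction i) := LipschitzWith.of_dist_le_mul fun x y => by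
      rw [dist_contraction]
      simp
    have := h.hausdorffMeasure_image_le gasketDim_pos.le s
    have h2 : (((1 / 2 : NNReal) : ℝ≥0∞)) ^ gasketDim = 3⁻¹ := by
      rw [ENNReal.coe_div (by norm_num), ENNReal.coe_one, one_div, ENNReal.inv_rpow]
      norm_num [ennreal_two_rpow_gasketDim]
    rw [h2] at this
    refine (mul_le_mul_right this 3).trans (le_of_eq ?_)
    rw [← mul_assoc, ENNReal.mul_inv_cancel (by norm_num) (by norm_num), one_mul]
  · have h : AntilipschitzWith 2 (contraction i) := AntilipschitzWith.of_le_mul_dist fun x y => by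
      rw [dist_contraction]
      simp
    have := h.le_hausdorffMeasure_image gasketDim_pos.le s
    rwa [ENNReal.coe_ofNat, ennreal_two_rpow_gasketDim] at this

/-- The three cells cover the gasket and overlap only in single points, which are null because α >
0; each contraction divides the measure by 2^α = 3. -/
theorem hausdorffMeasure_selfSimilar {s : Set sierpinskiGasket} (hs : MeasurableSet s) :
    Measure.hausdorffMeasure gasketDim s =
      3⁻¹ * ∑ i, Measure.hausdorffMeasure gasketDim (contraction i ⁻¹' s) := by
  have := Measure.nullSingletonClass_hausdorff sierpinskiGasket gasketDim_pos
  have hr : ∀ i, MeasurableSet (range (contraction i)) := fun i =>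
    (isCompact_range (continuous_contraction i)).isClosed.measurableSet
  have h1 : s = ⋃ i, s ∩ range (contraction i) := by
    rw [← inter_iUnion, iUnion_range_contraction, inter_univ]
  conv_lhs => rw [h1]
  rw [measure_iUnion₀ ?_ fun i => (hs.inter (hr i)).nullMeasurableSet, tsum_fintype,
    Finset.mul_sum]
  · refine Finset.sum_congr rfl fun i _ => ?_
    rw [← hausdorffMeasure_contraction_image i (contraction i ⁻¹' s), image_preimage_eq_inter_range,
      ← mul_assoc,
      ENNReal.inv_mul_cancel (by norm_num) (by norm_num), one_mul]
  · intro i j hij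
    exact ((subsingleton_range_inter_range hij).anti fun x hx =>
      ⟨hx.1.2, hx.2.2⟩).measure_zero _

theorem gasketMeasure_univ : gasketMeasure univ = 1 := by
  rw [gasketMeasure, Measure.smul_apply, smul_eq_mul]
  exact ENNReal.inv_mul_cancel hausdorffMeasure_univ_ne_zero hausdorffMeasure_univ_ne_top

scoped instance : IsProbabilityMeasure gasketMeasure := ⟨gasketMeasure_univ⟩

/-! ### Uniqueness of the self-similar measure. -/

/-- Invariance of a measure under the iterated function system with equal weights. -/
def SelfSimilar (μ : Measure sierpinskiGasket) : Prop :=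
  ∀ s, MeasurableSet s → μ s = 3⁻¹ * ∑ i, μ (contraction i ⁻¹' s)

theorem selfSimilar_gasketMeasure : SelfSimilar gasketMeasure := fun s hs => by
  simp only [gasketMeasure, Measure.smul_apply, smul_eq_mul]
  rw [hausdorffMeasure_selfSimilar hs, ← Finset.mul_sum]
  ring

theorem selfSimilar_map_point : SelfSimilar (bernoulli.map point) := fun s hs => by
  rw [Measure.map_apply measurable_point hs, measure_bernoulli (measurable_point hs)]
  congr 1
  refine Finset.sum_congr rfl fun i _ => ?_
  rw [Measure.map_apply measurable_point (measurable_contraction i hs)]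
  congr 1
  ext σ
  simp [point_cons]

theorem SelfSimilar.integral {μ : Measure sierpinskiGasket} (h : SelfSimilar μ) [IsFiniteMeasure μ]
    {f : sierpinskiGasket → ℝ} (hf : Continuous f) :
    ∫ x, f x ∂μ = 3⁻¹ * ∑ i, ∫ x, f (contraction i x) ∂μ := by
  have hint : ∀ (ν : Measure sierpinskiGasket) [IsFiniteMeasure ν], Integrable f ν := fun ν _ =>
    hf.integrable_of_hasCompactSupport (HasCompactSupport.of_compactSpace f)
  have hμ : μ = (3⁻¹ : ℝ≥0∞) • ∑ i, μ.map (contraction i) := by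
    refine Measure.ext fun s hs => ?_
    rw [h s hs, Measure.smul_apply, smul_eq_mul, Measure.finsetSum_apply]
    congr 1
    exact Finset.sum_congr rfl fun i _ => (Measure.map_apply (measurable_contraction i) hs).symm
  conv_lhs => rw [hμ]
  rw [integral_smul_measure, integral_finsetSum_measure fun i _ => hint _]
  simp only [smul_eq_mul]
  congr 1
  · simp
  · exact Finset.sum_congr rfl fun i _ =>
      integral_map (measurable_contraction i).aemeasurable hf.aestronglyMeasurable

/-- Iterating the invariance n times, both integrals become means of the same 3^n functions f ∘ f_w,
each oscillating by at most ε. Letting ε tend to 0 gives `SelfSimilar.eq`. -/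
theorem SelfSimilar.abs_integral_sub_le {μ ν : Measure sierpinskiGasket} [IsProbabilityMeasure μ]
    [IsProbabilityMeasure ν] (hμ : SelfSimilar μ) (hν : SelfSimilar ν) {ε : ℝ} (n : ℕ)
    {f : sierpinskiGasket → ℝ} (hf : Continuous f)
    (h : ∀ x y, dist x y ≤ (1 / 2) ^ n → |f x - f y| ≤ ε) :
    |∫ x, f x ∂μ - ∫ x, f x ∂ν| ≤ ε := by
  have hint : ∀ (ν : Measure sierpinskiGasket) [IsFiniteMeasure ν] {f : sierpinskiGasket → ℝ},
      Continuous f → Integrable f ν := fun ν _ f hf =>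
    hf.integrable_of_hasCompactSupport (HasCompactSupport.of_compactSpace f)
  induction n generalizing f with
  | zero =>
    have h' : ∀ x y, |f x - f y| ≤ ε := fun x y => h x y (by
      obtain ⟨σ, rfl⟩ := point_surjective x
      obtain ⟨τ, rfl⟩ := point_surjective y
      simpa [dist_point] using dist_gasketPoint_le_one σ τ)
    have h1 : ∀ y, |∫ x, f x ∂μ - f y| ≤ ε := fun y => by
      have : ∫ x, f x ∂μ - f y = ∫ x, (f x - f y) ∂μ := by
        rw [integral_sub (hint μ hf) (integrable_const _)]
        simp
      rw [this, ← Real.norm_eq_abs]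
      refine (norm_integral_le_of_norm_le_const (ae_of_all _ fun x => h' x y)).trans ?_
      simp
    have : ∫ x, f x ∂μ - ∫ x, f x ∂ν = ∫ y, (∫ x, f x ∂μ - f y) ∂ν := by
      rw [integral_sub (integrable_const _) (hint ν hf)]
      simp
    rw [this, ← Real.norm_eq_abs]
    refine (norm_integral_le_of_norm_le_const (ae_of_all _ fun y => h1 y)).trans ?_
    simp
  | succ n ih =>
    rw [hμ.integral hf, hν.integral hf, ← mul_sub, ← Finset.sum_sub_distrib, abs_mul]
    have hi : ∀ i, |∫ x, f (contraction i x) ∂μ - ∫ x, f (contraction i x) ∂ν| ≤ ε := fun i =>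
      ih (hf.comp (continuous_contraction i)) fun x y hxy => h _ _ (by
        rw [dist_contraction, pow_succ']
        linarith)
    have := (Finset.abs_sum_le_sum_abs (fun i => ∫ x, f (contraction i x) ∂μ -
      ∫ x, f (contraction i x) ∂ν) Finset.univ).trans (Finset.sum_le_sum fun i _ => hi i)
    rw [abs_of_pos (by norm_num)]
    simp only [Finset.sum_const, Finset.card_univ, Fintype.card_fin, nsmul_eq_mul,
      Nat.cast_ofNat] at this
    linarith

theorem SelfSimilar.eq {μ ν : Measure sierpinskiGasket} [IsProbabilityMeasure μ]
    [IsProbabilityMeasure ν] (hμ : SelfSimilar μ) (hν : SelfSimilar ν) : μ = ν := by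
  refine ext_of_forall_integral_eq_of_IsFiniteMeasure fun f => ?_
  rw [← sub_eq_zero, ← abs_nonpos_iff]
  refine le_of_forall_pos_le_add fun ε hε => ?_
  obtain ⟨δ, hδ, h⟩ := Metric.uniformContinuous_iff.1
    (CompactSpace.uniformContinuous_of_continuous f.continuous) ε hε
  obtain ⟨n, hn⟩ := exists_pow_lt_of_lt_one hδ (one_half_lt_one (α := ℝ))
  rw [zero_add]
  exact hμ.abs_integral_sub_le hν n f.continuous fun x y hxy => (h (hxy.trans_lt hn)).le

theorem map_point_bernoulli : bernoulli.map point = gasketMeasure :=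
  have : IsProbabilityMeasure (bernoulli.map point) :=
    Measure.isProbabilityMeasure_map measurable_point.aemeasurable
  selfSimilar_map_point.eq selfSimilar_gasketMeasure

/-! ### Volume of balls and α-regularity. -/

theorem gasketMeasure_ball_le (n : ℕ) (x : sierpinskiGasket) :
    gasketMeasure (Metric.ball x (4 * (1 / 2) ^ n)) ≤ 108 * (3⁻¹ : ℝ≥0∞) ^ n := by
  rw [← map_point_bernoulli]
  exact map_point_ball_le n x

theorem bernoulli_agree (n : ℕ) (σ : Address) :
    bernoulli {τ | ∀ k < n, τ k = σ k} = (3⁻¹ : ℝ≥0∞) ^ n := by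
  have : {τ : Address | ∀ k < n, τ k = σ k} = (Finset.range n : Set ℕ).pi fun k => {σ k} := by
    ext τ
    simp [Set.mem_pi]
  rw [this, bernoulli, Measure.infinitePi_pi _ fun k _ => measurableSet_singleton _]
  simp [letterMeasure]

theorem le_gasketMeasure_closedBall (n : ℕ) (x : sierpinskiGasket) :
    (3⁻¹ : ℝ≥0∞) ^ n ≤ gasketMeasure (Metric.closedBall x ((1 / 2) ^ n)) := by
  obtain ⟨σ, rfl⟩ := point_surjective x
  rw [← map_point_bernoulli,
    Measure.map_apply measurable_point Metric.isClosed_closedBall.measurableSet,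
    ← bernoulli_agree n σ]
  exact measure_mono fun τ hτ => dist_gasketPoint_of_agree hτ

theorem isAlphaRegular_gasketMeasure : IsAlphaRegular gasketMeasure gasketDim := by
  have hd : Metric.ediam (univ : Set sierpinskiGasket) ≤ 1 := by
    refine Metric.ediam_le fun x _ y _ => ?_
    obtain ⟨σ, rfl⟩ := point_surjective x
    obtain ⟨τ, rfl⟩ := point_surjective y
    rw [edist_dist, ENNReal.ofReal_le_one]
    exact dist_gasketPoint_le_one σ τ
  refine ⟨108, by norm_num, fun x r hr hr' => ?_⟩
  have hr1 : r ≤ 1 := ENNReal.ofReal_le_one.1 (hr'.le.trans hd)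
  -- With 2^(-(n+1)) < r ≤ 2^(-n), the ball of radius r is squeezed between radii 2^(-(n+1)) and
  -- 4·2^(-(n+1)).
  obtain ⟨n, hn1, hn2⟩ := exists_nat_pow_near_of_lt_one hr hr1 (one_half_pos (α := ℝ))
    one_half_lt_one
  constructor
  · refine le_trans ?_ ((le_gasketMeasure_closedBall (n + 1) x).trans
      (measure_mono (Metric.closedBall_subset_ball hn1)))
    rw [← ofReal_third_pow]
    refine ENNReal.ofReal_le_ofReal ?_
    have h1 := Real.rpow_le_rpow hr.le hn2 gasketDim_pos.le
    rw [half_pow_rpow_gasketDim] at h1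
    rw [pow_succ]
    have := pow_pos (one_div_pos.2 (three_pos (α := ℝ))) n
    linarith
  · refine ((measure_mono (Metric.ball_subset_ball ?_)).trans
      (gasketMeasure_ball_le (n + 1) x)).trans ?_
    · rw [pow_succ]
      linarith [pow_pos (one_half_pos (α := ℝ)) n]
    · rw [← ofReal_third_pow, ← half_pow_rpow_gasketDim, ← ENNReal.ofReal_ofNat 108,
        ← ENNReal.ofReal_mul (by norm_num)]
      refine ENNReal.ofReal_le_ofReal (mul_le_mul_of_nonneg_left ?_ (by norm_num))
      exact Real.rpow_le_rpow (by positivity) hn1.le gasketDim_pos.le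

/-! ### Square integrable functions on addresses -/

theorem ofReal_sq_eq_enorm (x : ℝ) : ENNReal.ofReal (x ^ 2) = ‖x‖ₑ ^ 2 := by
  rw [← sq_abs, ENNReal.ofReal_pow (abs_nonneg x), Real.enorm_eq_ofReal_abs]

theorem lintegral_ofReal_sq {Ω : Type*} [MeasurableSpace Ω] {μ : Measure Ω} (f : Ω → ℝ) :
    ∫⁻ x, ENNReal.ofReal (f x ^ 2) ∂μ = eLpNorm f 2 μ ^ 2 := by
  have := eLpNorm_nnreal_pow_eq_lintegral (f := f) (μ := μ) (p := 2) (by norm_num)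
  simp only [NNReal.coe_ofNat, ENNReal.rpow_ofNat, ENNReal.coe_ofNat] at this
  rw [this]
  exact lintegral_congr fun x => ofReal_sq_eq_enorm (f x)

theorem ofReal_integral_sq_le {Ω : Type*} [MeasurableSpace Ω] {μ : Measure Ω}
    [IsProbabilityMeasure μ] {f : Ω → ℝ} (hf : AEStronglyMeasurable f μ) :
    ENNReal.ofReal ((∫ x, f x ∂μ) ^ 2) ≤ ∫⁻ x, ENNReal.ofReal (f x ^ 2) ∂μ := by
  rw [lintegral_ofReal_sq, ofReal_sq_eq_enorm]
  refine pow_le_pow_left' ?_ 2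
  refine (enorm_integral_le_lintegral_enorm f).trans ?_
  rw [← eLpNorm_one_eq_lintegral_enorm]
  exact eLpNorm_le_eLpNorm_of_exponent_le (by norm_num) hf

/-- Measurable square integrable functions on addresses. -/
def SqInt (U : Address → ℝ) : Prop :=
  Measurable U ∧ ∫⁻ σ, ENNReal.ofReal (U σ ^ 2) ∂bernoulli < ⊤

theorem SqInt.integrable {U : Address → ℝ} (hU : SqInt U) : Integrable U bernoulli := by
  have h : MemLp U 2 bernoulli := by
    refine ⟨hU.1.aestronglyMeasurable, ?_⟩
    have := hU.2
    rw [lintegral_ofReal_sq] at this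
    by_contra h
    rw [not_lt, top_le_iff] at h
    rw [h] at this
    simp at this
  exact h.integrable (by norm_num)

theorem SqInt.comp_cons {U : Address → ℝ} (hU : SqInt U) (i : Fin 3) :
    SqInt fun σ => U (cons i σ) :=
  ⟨hU.1.comp (measurable_cons i), memLp_comp_cons hU.1 hU.2 i⟩

/-- The product of two copies of the Bernoulli measure. -/
noncomputable abbrev bernoulli₂ : Measure (Address × Address) := bernoulli.prod bernoulli

theorem measurable_sub_sq {U V : Address → ℝ} (hU : Measurable U) (hV : Measurable V) :
    Measurable fun p : Address × Address => ENNReal.ofReal ((U p.1 - V p.2) ^ 2) :=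
  (((hU.comp measurable_fst).sub (hV.comp measurable_snd)).pow_const 2).ennreal_ofReal

theorem nine_mul_setLIntegral {S : Set (Address × Address)} (hS : MeasurableSet S)
    {G : Address × Address → ℝ≥0∞} (hG : Measurable G) :
    9 * ∫⁻ p in S, G p ∂bernoulli₂ = ∑ i, ∑ j, ∫⁻ p in
      {p | (cons i p.1, cons j p.2) ∈ S}, G (cons i p.1, cons j p.2) ∂bernoulli₂ := by
  rw [← lintegral_indicator hS, lintegral_bernoulli_prod (hG.indicator hS), ← mul_assoc,
    ENNReal.mul_inv_cancel (by norm_num) (by norm_num), one_mul]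
  refine Finset.sum_congr rfl fun i _ => Finset.sum_congr rfl fun j _ => ?_
  exact (lintegral_indicator (measurable_prodMap_cons i j hS)
    fun p : Address × Address => G (cons i p.1, cons j p.2))

/-- The discrete energy of a function over pairs of addresses in adjacent `n`-cells. -/
noncomputable def adjEnergy (n : ℕ) (U : Address → ℝ) : ℝ≥0∞ :=
  ∫⁻ p in {p | Adj n p.1 p.2}, ENNReal.ofReal ((U p.1 - U p.2) ^ 2) ∂bernoulli₂

/-- Pairs with equal first letters reproduce the energy one level lower; pairs with different
letters i, j are adjacent only through the corner cells facing each other. The factor 9 undoes the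
two weights 1/3. -/
theorem nine_mul_adjEnergy (n : ℕ) {U : Address → ℝ} (hU : Measurable U) :
    9 * adjEnergy (n + 1) U = ∑ i, ∑ j, if i = j then adjEnergy n (fun σ => U (cons i σ)) else
      ∫⁻ p in {p | Corner n j p.1 ∧ Corner n i p.2},
        ENNReal.ofReal ((U (cons i p.1) - U (cons j p.2)) ^ 2) ∂bernoulli₂ := by
  rw [adjEnergy, nine_mul_setLIntegral (measurableSet_adj _) (measurable_sub_sq hU hU)]
  refine Finset.sum_congr rfl fun i _ => Finset.sum_congr rfl fun j _ => ?_
  split_ifs with h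
  · subst h
    simp only [adjEnergy, mem_ofPred_eq, adj_cons_self]
  · simp only [mem_ofPred_eq, adj_cons_of_ne h]

/-! ### Cell averages -/

/-- The average of a function over the cell with a given finite address. -/
noncomputable def cellAverage : (Address → ℝ) → List (Fin 3) → ℝ
  | U, [] => ∫ σ, U σ ∂bernoulli
  | U, i :: l => cellAverage (fun σ => U (cons i σ)) l

/-- The value on each cell is the mean of the values on its three children. -/
def MeanProperty (a : List (Fin 3) → ℝ) : Prop := ∀ l, a l = 3⁻¹ * ∑ i, a (l ++ [i])

theorem SqInt.meanProperty {U : Address → ℝ} (hU : SqInt U) : MeanProperty (cellAverage U) := by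
  intro l
  induction l generalizing U with
  | nil => exact integral_bernoulli hU.integrable
  | cons i l ih => exact ih (hU.comp_cons i)

theorem MeanProperty.cons {a : List (Fin 3) → ℝ} (ha : MeanProperty a) (i : Fin 3) :
    MeanProperty fun l => a (i :: l) := fun l => ha (i :: l)

/-- The energy of a function on the graph of `n`-cells, each edge being counted twice. -/
def cellEnergy : ℕ → (List (Fin 3) → ℝ) → ℝ
  | 0, _ => 0
  | n + 1, a => ∑ i, cellEnergy n (fun l => a (i :: l)) +
      ∑ i, ∑ j, (a (i :: List.replicate n j) - a (j :: List.replicate n i)) ^ 2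

theorem cellEnergy_nonneg (n : ℕ) (a : List (Fin 3) → ℝ) : 0 ≤ cellEnergy n a := by
  induction n generalizing a with
  | zero => exact le_rfl
  | succ n ih =>
    exact add_nonneg (Finset.sum_nonneg fun i _ => ih _)
      (Finset.sum_nonneg fun i _ => Finset.sum_nonneg fun j _ => sq_nonneg _)

/-- The corner terms make the induction close: inside cell i, the terms at the two inner corners pay
for the edges to the other cells, and the one at the outer corner i survives as the new corner term.
At level 0 there is equality, since the doubled energy of three numbers is 6 times their squared
deviation from the mean. -/
theorem le_cellEnergy_succ (n : ℕ) {a : List (Fin 3) → ℝ} (ha : MeanProperty a) :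
    3 / 5 * cellEnergy n a +
        6 * ∑ i, (a (List.replicate (n + 1) i) - a (List.replicate n i)) ^ 2 ≤
      cellEnergy (n + 1) a := by
  induction n generalizing a with
  | zero =>
    have h := ha []
    simp only [cellEnergy, Fin.sum_univ_three, List.replicate, List.nil_append] at h ⊢
    rw [h]
    nlinarith
  | succ n ih =>
    have h1 := fun i => ih (ha.cons i)
    rw [cellEnergy, cellEnergy]
    simp only [List.replicate_succ, Fin.sum_univ_three] at h1 ⊢
    -- Three resistors in series of conductances 3, 1, 3 have effective conductance 1/(1/3 + 1 +
    -- 1/3) = 3/5. Edges being counted twice, the coefficient 6 becomes 3 here.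
    have key : ∀ D E α β : ℝ, 3 / 5 * (D - E) ^ 2 ≤
        3 * (α - D) ^ 2 + 3 * (β - E) ^ 2 + (α - β) ^ 2 := fun D E α β => by
      nlinarith [sq_nonneg (5 * (α - D) + (D - E)), sq_nonneg (5 * (β - E) - (D - E)),
        sq_nonneg (α - D + (β - E))]
    have h0 := h1 0
    have h1' := h1 1
    have h2 := h1 2
    have k01 := key (a (0 :: List.replicate n 1)) (a (1 :: List.replicate n 0))
      (a (0 :: 1 :: List.replicate n 1)) (a (1 :: 0 :: List.replicate n 0))
    have k02 := key (a (0 :: List.replicate n 2)) (a (2 :: List.replicate n 0))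
      (a (0 :: 2 :: List.replicate n 2)) (a (2 :: 0 :: List.replicate n 0))
    have k12 := key (a (1 :: List.replicate n 2)) (a (2 :: List.replicate n 1))
      (a (1 :: 2 :: List.replicate n 2)) (a (2 :: 1 :: List.replicate n 1))
    linarith

theorem cellEnergy_add_ge (n k : ℕ) {a : List (Fin 3) → ℝ} (ha : MeanProperty a) :
    (3 / 5) ^ k * cellEnergy n a ≤ cellEnergy (n + k) a := by
  induction k with
  | zero => simp
  | succ k ih =>
    have h := le_cellEnergy_succ (n + k) ha
    have h2 : 0 ≤ ∑ i, (a (List.replicate (n + k + 1) i) - a (List.replicate (n + k) i)) ^ 2 :=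
      Finset.sum_nonneg fun i _ => sq_nonneg _
    rw [← add_assoc, pow_succ']
    linarith

/-- Level 1 energy zero makes the three children equal, hence equal to their mean, the parent; the
energies inside each child vanish too, so one can descend. -/
theorem eq_nil_of_cellEnergy_eq_zero {a : List (Fin 3) → ℝ} (ha : MeanProperty a)
    (h : ∀ n, cellEnergy n a = 0) (l : List (Fin 3)) : a l = a [] := by
  induction l generalizing a with
  | nil => rfl
  | cons i l ih =>
    have hz : ∀ n, cellEnergy n (fun l => a (i :: l)) = 0 := fun n => by
      have hn := h (n + 1)
      rw [cellEnergy] at hn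
      have h1 : ∑ i, cellEnergy n (fun l => a (i :: l)) = 0 :=
        le_antisymm (by
          have : 0 ≤ ∑ i, ∑ j,
              (a (i :: List.replicate n j) - a (j :: List.replicate n i)) ^ 2 :=
            Finset.sum_nonneg fun i _ => Finset.sum_nonneg fun j _ => sq_nonneg _
          linarith) (Finset.sum_nonneg fun i _ => cellEnergy_nonneg _ _)
      exact (Finset.sum_eq_zero_iff_of_nonneg fun i _ => cellEnergy_nonneg _ _).1 h1 i
        (Finset.mem_univ i)
    rw [ih (ha.cons i) hz]
    have h1 := h 1
    have hm := ha []
    simp only [cellEnergy, Finset.sum_const_zero, zero_add, List.replicate] at h1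
    have hij : ∀ j, a [i] = a [j] := fun j => by
      have h2 := (Finset.sum_eq_zero_iff_of_nonneg fun i _ =>
        Finset.sum_nonneg fun j _ => sq_nonneg (a [i] - a [j])).1 h1 i (Finset.mem_univ i)
      have h3 := (Finset.sum_eq_zero_iff_of_nonneg fun j _ =>
        sq_nonneg (a [i] - a [j])).1 h2 j (Finset.mem_univ j)
      exact sub_eq_zero.1 (pow_eq_zero_iff (by norm_num) |>.1 h3)
    simp only [List.nil_append, ← hij] at hm
    simp at hm
    exact hm.symm

/-! ### Graph energy of averages against integral energy. -/

theorem ofReal_integral_sub_sq_le {U V : Address → ℝ} (hU : SqInt U) (hV : SqInt V) :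
    ENNReal.ofReal ((∫ σ, U σ ∂bernoulli - ∫ σ, V σ ∂bernoulli) ^ 2) ≤
      ∫⁻ p, ENNReal.ofReal ((U p.1 - V p.2) ^ 2) ∂bernoulli₂ := by
  have h1 : Integrable (fun p : Address × Address => U p.1) bernoulli₂ := hU.integrable.comp_fst _
  have h2 : Integrable (fun p : Address × Address => V p.2) bernoulli₂ := hV.integrable.comp_snd _
  have : ∫ σ, U σ ∂bernoulli - ∫ σ, V σ ∂bernoulli = ∫ p, (U p.1 - V p.2) ∂bernoulli₂ := by
    rw [integral_sub h1 h2, integral_fun_fst, integral_fun_snd]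
    simp
  rw [this]
  exact ofReal_integral_sq_le (h1.sub h2).aestronglyMeasurable

theorem measurableSet_corner_prod (n : ℕ) (i j : Fin 3) :
    MeasurableSet {p : Address × Address | Corner n j p.1 ∧ Corner n i p.2} :=
  (measurable_fst (measurableSet_corner n j)).inter (measurable_snd (measurableSet_corner n i))

/-- Jensen's inequality on the product of two corner cells, whose mass is 9^(-n). -/
theorem ofReal_cellAverage_sub_sq_le (n : ℕ) (i j : Fin 3) {U V : Address → ℝ} (hU : SqInt U)
    (hV : SqInt V) :
    ENNReal.ofReal ((cellAverage U (List.replicate n j) -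
        cellAverage V (List.replicate n i)) ^ 2) ≤
      9 ^ n * ∫⁻ p in {p | Corner n j p.1 ∧ Corner n i p.2},
        ENNReal.ofReal ((U p.1 - V p.2) ^ 2) ∂bernoulli₂ := by
  induction n generalizing U V with
  | zero =>
    simp only [corner_zero, and_self, pow_zero, one_mul, ofPred_true, Measure.restrict_univ]
    exact ofReal_integral_sub_sq_le hU hV
  | succ n ih =>
    refine (ih (hU.comp_cons j) (hV.comp_cons i)).trans ?_
    rw [pow_succ, mul_assoc,
      nine_mul_setLIntegral (measurableSet_corner_prod _ _ _) (measurable_sub_sq hU.1 hV.1)]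
    refine mul_le_mul_right ?_ _
    refine le_trans ?_ (Finset.single_le_sum (fun _ _ => zero_le) (Finset.mem_univ j))
    refine le_trans ?_ (Finset.single_le_sum (fun _ _ => zero_le) (Finset.mem_univ i))
    simp only [mem_ofPred_eq, corner_succ, cons_zero, shift_cons, true_and]
    exact le_rfl

theorem ofReal_cellEnergy_le (n : ℕ) {U : Address → ℝ} (hU : SqInt U) :
    ENNReal.ofReal (cellEnergy n (cellAverage U)) ≤ 9 ^ n * adjEnergy n U := by
  induction n generalizing U with
  | zero => simp [cellEnergy]
  | succ n ih =>
    rw [pow_succ, mul_assoc, nine_mul_adjEnergy n hU.1, cellEnergy,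
      ENNReal.ofReal_add (Finset.sum_nonneg fun i _ => cellEnergy_nonneg _ _)
        (Finset.sum_nonneg fun i _ => Finset.sum_nonneg fun j _ => sq_nonneg _),
      ENNReal.ofReal_sum_of_nonneg fun i _ => cellEnergy_nonneg _ _,
      ENNReal.ofReal_sum_of_nonneg fun i _ => Finset.sum_nonneg fun j _ => sq_nonneg _,
      ← Finset.sum_add_distrib, Finset.mul_sum]
    refine Finset.sum_le_sum fun i _ => ?_
    have hi : ENNReal.ofReal (cellEnergy n fun l => cellAverage U (i :: l)) =
        ∑ j, if i = j then ENNReal.ofReal (cellEnergy n fun l => cellAverage U (i :: l)) else 0 := by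
      simp
    rw [hi, ENNReal.ofReal_sum_of_nonneg fun j _ => sq_nonneg _, ← Finset.sum_add_distrib,
      Finset.mul_sum]
    refine Finset.sum_le_sum fun j _ => ?_
    split_ifs with h
    · subst h
      rw [sub_self, zero_pow two_ne_zero, ENNReal.ofReal_zero, add_zero]
      exact ih (hU.comp_cons i)
    · rw [zero_add]
      exact ofReal_cellAverage_sub_sq_le n i j (hU.comp_cons i) (hU.comp_cons j)

/-- Jensen's inequality inside each n-cell, where c is the average: the variance is at most the mean
square difference over pairs in the cell. This replaces a differentiation theorem in passing from
cell averages to values. -/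
theorem lintegral_sub_const_sq_le {U : Address → ℝ} (hU : SqInt U) {c : ℝ}
    (h : ∀ l, cellAverage U l = c) (n : ℕ) :
    ∫⁻ σ, ENNReal.ofReal ((U σ - c) ^ 2) ∂bernoulli ≤ 3 ^ n * adjEnergy n U := by
  induction n generalizing U with
  | zero =>
    simp only [adjEnergy, Adj, pow_zero, one_mul, ofPred_true, Measure.restrict_univ]
    rw [lintegral_prod _ (measurable_sub_sq hU.1 hU.1).aemeasurable]
    refine lintegral_mono fun σ => ?_
    have hc : U σ - c = ∫ τ, (U σ - U τ) ∂bernoulli := by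
      rw [integral_sub (integrable_const _) hU.integrable, ← h []]
      simp [cellAverage]
    simp only
    rw [hc]
    exact ofReal_integral_sq_le (measurable_const.sub hU.1).aestronglyMeasurable
  | succ n ih =>
    rw [lintegral_bernoulli ((hU.1.sub_const c).pow_const 2).ennreal_ofReal]
    have h3 : (3 : ℝ≥0∞) ^ (n + 1) * adjEnergy (n + 1) U =
        3⁻¹ * (3 ^ n * (9 * adjEnergy (n + 1) U)) := by
      have : (9 : ℝ≥0∞) = 3 * 3 := by norm_num
      rw [this, pow_succ]
      calc (3 : ℝ≥0∞) ^ n * 3 * adjEnergy (n + 1) U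
          = 1 * (3 ^ n * (3 * adjEnergy (n + 1) U)) := by ring
        _ = 3⁻¹ * 3 * (3 ^ n * (3 * adjEnergy (n + 1) U)) := by
          rw [ENNReal.inv_mul_cancel (by norm_num) (by norm_num)]
        _ = _ := by ring
    rw [h3, nine_mul_adjEnergy n hU.1, Finset.mul_sum (a := (3 : ℝ≥0∞) ^ n)]
    refine mul_le_mul_right (Finset.sum_le_sum fun i _ => ?_) _
    refine (ih (hU.comp_cons i) fun l => h (i :: l)).trans (mul_le_mul_right ?_ _)
    -- Only pairs inside the same cell are needed; the terms with j ≠ i are dropped.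
    refine le_trans ?_ (Finset.single_le_sum (fun _ _ => zero_le) (Finset.mem_univ i))
    rw [if_pos rfl]

/-! ### The Besov energy on addresses -/

/-- The density of the Besov energy with exponent `s`. -/
noncomputable def besovDensity (s : ℝ) (U : Address → ℝ) (p : Address × Address) : ℝ≥0∞ :=
  ENNReal.ofReal ((U p.1 - U p.2) ^ 2 / dist (gasketPoint p.1) (gasketPoint p.2) ^ s)

/-- The pairs of addresses of points at distance at most `2 ^ (1 - n)`. -/
def nearSet (n : ℕ) : Set (Address × Address) :=
  {p | dist (gasketPoint p.1) (gasketPoint p.2) ≤ 2 * (1 / 2) ^ n}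

/-- The part of the Besov energy carried by pairs at distance at most `2 ^ (1 - n)`. -/
noncomputable def nearEnergy (s : ℝ) (U : Address → ℝ) (n : ℕ) : ℝ≥0∞ :=
  ∫⁻ p in nearSet n, besovDensity s U p ∂bernoulli₂

theorem measurable_dist_gasketPoint :
    Measurable fun p : Address × Address => dist (gasketPoint p.1) (gasketPoint p.2) :=
  (continuous_dist.comp ((continuous_gasketPoint.comp continuous_fst).prodMk
    (continuous_gasketPoint.comp continuous_snd))).measurable

theorem measurable_besovDensity (s : ℝ) {U : Address → ℝ} (hU : Measurable U) :
    Measurable (besovDensity s U) :=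
  ((((hU.comp measurable_fst).sub (hU.comp measurable_snd)).pow_const 2).div
    (measurable_dist_gasketPoint.pow_const s)).ennreal_ofReal

theorem measurableSet_nearSet (n : ℕ) : MeasurableSet (nearSet n) :=
  measurable_dist_gasketPoint measurableSet_Iic

theorem besovEnergy_eq (β : ℝ) {u : sierpinskiGasket → ℝ} (hu : Measurable u) :
    besovEnergy gasketMeasure gasketDim β u =
      ∫⁻ p, besovDensity (gasketDim + β) (fun σ => u (point σ)) p ∂bernoulli₂ := by
  have hm : Measurable fun p : sierpinskiGasket × sierpinskiGasket =>
      ENNReal.ofReal ((u p.1 - u p.2) ^ 2 / dist p.1 p.2 ^ (gasketDim + β)) :=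
    ((((hu.comp measurable_fst).sub (hu.comp measurable_snd)).pow_const 2).div
      (measurable_dist.pow_const _)).ennreal_ofReal
  have hm' : Measurable (besovDensity (gasketDim + β) fun σ => u (point σ)) :=
    measurable_besovDensity _ (hu.comp measurable_point)
  rw [besovEnergy, ← map_point_bernoulli, lintegral_prod _ hm'.aemeasurable,
    lintegral_map (hm.lintegral_prod_right' (ν := bernoulli.map point)) measurable_point]
  refine lintegral_congr fun σ => ?_
  exact lintegral_map (hm.comp measurable_prodMk_left) measurable_point

/-- The energy density defines a finite measure, and the near sets decrease to the pairs of words of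
one point. -/
theorem tendsto_nearEnergy {s : ℝ} (hs : s ≠ 0) {U : Address → ℝ}
    (hfin : ∫⁻ p, besovDensity s U p ∂bernoulli₂ < ⊤) :
    Tendsto (nearEnergy s U) atTop (𝓝 0) := by
  have hfm : IsFiniteMeasure (bernoulli₂.withDensity (besovDensity s U)) :=
    isFiniteMeasure_withDensity hfin.ne
  have hanti : Antitone nearSet := fun m n hmn p hp => by
    refine le_trans (show dist (gasketPoint p.1) (gasketPoint p.2) ≤ 2 * (1 / 2) ^ n from hp) ?_
    exact mul_le_mul_of_nonneg_left (pow_le_pow_of_le_one (by norm_num) (by norm_num) hmn)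
      (by norm_num)
  have hI : ⋂ n, nearSet n ⊆ {p | dist (gasketPoint p.1) (gasketPoint p.2) = 0} := by
    intro p hp
    have ht : Tendsto (fun n : ℕ => 2 * (1 / 2 : ℝ) ^ n) atTop (𝓝 (2 * 0)) :=
      (tendsto_pow_atTop_nhds_zero_of_lt_one (by norm_num) (by norm_num)).const_mul _
    have := ge_of_tendsto' ht fun n => mem_iInter.1 hp n
    rw [mul_zero] at this
    exact le_antisymm this dist_nonneg
  have hm0 : MeasurableSet {p : Address × Address | dist (gasketPoint p.1) (gasketPoint p.2) = 0} :=
    measurable_dist_gasketPoint (measurableSet_singleton 0)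
  -- On coinciding points the denominator is 0^s = 0, as s ≠ 0, and division by zero gives 0: the
  -- density itself vanishes there.
  have hzero : bernoulli₂.withDensity (besovDensity s U) (⋂ n, nearSet n) = 0 := by
    refine measure_mono_null hI ?_
    rw [withDensity_apply _ hm0]
    refine (setLIntegral_congr_fun hm0 fun p hp => ?_).trans lintegral_zero
    have hp' : dist (gasketPoint p.1) (gasketPoint p.2) = 0 := hp
    simp [besovDensity, hp', Real.zero_rpow hs]
  have ht := tendsto_measure_iInter_atTop (μ := bernoulli₂.withDensity (besovDensity s U))
    (fun n => (measurableSet_nearSet n).nullMeasurableSet) hanti ⟨0, measure_ne_top _ _⟩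
  rw [hzero] at ht
  refine ht.congr fun n => ?_
  rw [Function.comp_apply, withDensity_apply _ (measurableSet_nearSet n)]
  rfl

theorem setLIntegral_nearSet_le {s : ℝ} (hs : 0 ≤ s) {U : Address → ℝ}
    (hU : ∀ σ τ, gasketPoint σ = gasketPoint τ → U σ = U τ) (n : ℕ) :
    ∫⁻ p in nearSet n, ENNReal.ofReal ((U p.1 - U p.2) ^ 2) ∂bernoulli₂ ≤
      ENNReal.ofReal ((2 * (1 / 2) ^ n) ^ s) * nearEnergy s U n := by
  rw [nearEnergy, ← lintegral_const_mul' _ _ ENNReal.ofReal_ne_top]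
  refine setLIntegral_mono' (measurableSet_nearSet n) fun p hp => ?_
  rw [besovDensity, ← ENNReal.ofReal_mul (by positivity)]
  refine ENNReal.ofReal_le_ofReal ?_
  rcases eq_or_ne (gasketPoint p.1) (gasketPoint p.2) with h | h
  · rw [hU _ _ h]
    simp
  · have hd : 0 < dist (gasketPoint p.1) (gasketPoint p.2) := dist_pos.2 h
    rw [mul_div_assoc', le_div_iff₀ (Real.rpow_pos_of_pos hd s), mul_comm]
    exact mul_le_mul_of_nonneg_right (Real.rpow_le_rpow hd.le hp hs) (sq_nonneg _)

theorem adjEnergy_le {s : ℝ} (hs : 0 ≤ s) {U : Address → ℝ}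
    (hU : ∀ σ τ, gasketPoint σ = gasketPoint τ → U σ = U τ) (n : ℕ) :
    adjEnergy n U ≤ ENNReal.ofReal ((2 * (1 / 2) ^ n) ^ s) * nearEnergy s U n :=
  (lintegral_mono_set fun _ hp => dist_le_of_adj hp).trans (setLIntegral_nearSet_le hs hU n)

theorem two_mul_half_pow_rpow (β : ℝ) (n : ℕ) : (2 * (1 / 2 : ℝ) ^ n) ^ (gasketDim + β) =
    3 * 2 ^ β * ((1 / 3) ^ n * ((2 ^ β) ^ n)⁻¹) := by
  rw [Real.mul_rpow (by norm_num) (by positivity), Real.rpow_add (by norm_num), two_rpow_gasketDim,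
    Real.rpow_add (by positivity), half_pow_rpow_gasketDim, one_div_pow 2 n,
    Real.div_rpow (by norm_num) (by positivity), Real.one_rpow,
    one_div (((2 : ℝ) ^ n) ^ β), ← Real.rpow_natCast 2 n, ← Real.rpow_natCast (2 ^ β) n,
    ← Real.rpow_mul (by norm_num),
    ← Real.rpow_mul (by norm_num), mul_comm β]

theorem ae_eq_const_of_besov_finite {β : ℝ} (hβ0 : 0 < β) (hβ : 5 ≤ (2 : ℝ) ^ β)
    {U : Address → ℝ} (hU : SqInt U) (hUπ : ∀ σ τ, gasketPoint σ = gasketPoint τ → U σ = U τ)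
    (hfin : ∫⁻ p, besovDensity (gasketDim + β) U p ∂bernoulli₂ < ⊤) :
    ∃ c : ℝ, ∀ᵐ σ ∂bernoulli, U σ = c := by
  have hs : 0 < gasketDim + β := add_pos gasketDim_pos hβ0
  -- The only use of 2^β ≥ 5. The prefactor is 2^(α+β) = 3·2^β.
  have hle : ∀ n, adjEnergy n U ≤ ENNReal.ofReal (3 * 2 ^ β * ((1 / 3) ^ n * (1 / 5) ^ n)) *
      nearEnergy (gasketDim + β) U n := fun n => by
    refine (adjEnergy_le hs.le hUπ n).trans ?_
    rw [two_mul_half_pow_rpow]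
    gcongr
    rw [one_div, inv_pow]
    gcongr
  have hnf : ∀ n, nearEnergy (gasketDim + β) U n ≠ ⊤ := fun n =>
    ((setLIntegral_le_lintegral _ _).trans_lt hfin).ne
  have ht := tendsto_nearEnergy hs.ne' hfin
  have htr : Tendsto (fun n => (nearEnergy (gasketDim + β) U n).toReal) atTop (𝓝 0) := by
    rw [← ENNReal.toReal_zero]
    exact (ENNReal.tendsto_toReal ENNReal.zero_ne_top).comp ht
  -- The rate is 9^n·3^(-n)·5^(-n) = (3/5)^n.
  have hbound : ∀ n, cellEnergy n (cellAverage U) ≤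
      3 * 2 ^ β * (3 / 5) ^ n * (nearEnergy (gasketDim + β) U n).toReal := fun n => by
    have h1 := (ofReal_cellEnergy_le n hU).trans (mul_le_mul_right (hle n) _)
    rw [← ENNReal.ofReal_toReal (hnf n), ← ENNReal.ofReal_mul (by positivity),
      ← ENNReal.ofReal_ofNat 9, ← ENNReal.ofReal_pow (by norm_num),
      ← ENNReal.ofReal_mul (by positivity), ENNReal.ofReal_le_ofReal_iff (by positivity)] at h1
    refine h1.trans (le_of_eq ?_)
    have : (3 / 5 : ℝ) ^ n = 9 ^ n * ((1 / 3) ^ n * (1 / 5) ^ n) := by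
      rw [← mul_pow, ← mul_pow]
      norm_num
    rw [this]
    ring
  have hzero : ∀ n, cellEnergy n (cellAverage U) = 0 := fun n => by
    refine le_antisymm ?_ (cellEnergy_nonneg _ _)
    -- Upper and lower bounds at level n+k decay at the same rate (3/5)^k. It cancels, and the
    -- vanishing tail of the energy decides, even when 2^β = 5.
    have hk : ∀ k, cellEnergy n (cellAverage U) ≤
        3 * 2 ^ β * (3 / 5) ^ n * (nearEnergy (gasketDim + β) U (n + k)).toReal := fun k => by
      have h1 := (cellEnergy_add_ge n k hU.meanProperty).trans (hbound (n + k))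
      have hp : (0 : ℝ) < (3 / 5) ^ k := by positivity
      rw [pow_add] at h1
      refine le_of_mul_le_mul_left (h1.trans (le_of_eq ?_)) hp
      ring
    have ht2 := (htr.comp (tendsto_add_atTop_nat n)).const_mul (3 * 2 ^ β * (3 / 5) ^ n)
    rw [mul_zero] at ht2
    refine ge_of_tendsto' ht2 fun k => ?_
    rw [Function.comp_apply, add_comm k n]
    exact hk k
  have hconst := eq_nil_of_cellEnergy_eq_zero hU.meanProperty hzero
  refine ⟨cellAverage U [], ?_⟩
  have hint : ∫⁻ σ, ENNReal.ofReal ((U σ - cellAverage U []) ^ 2) ∂bernoulli = 0 := by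
    refine le_antisymm ?_ zero_le
    have hn : ∀ n, ∫⁻ σ, ENNReal.ofReal ((U σ - cellAverage U []) ^ 2) ∂bernoulli ≤
        ENNReal.ofReal (3 * 2 ^ β) * nearEnergy (gasketDim + β) U n := fun n => by
      refine (lintegral_sub_const_sq_le hU hconst n).trans
        ((mul_le_mul_right (hle n) _).trans ?_)
      rw [← mul_assoc, ← ENNReal.ofReal_ofNat 3, ← ENNReal.ofReal_pow (by norm_num),
        ← ENNReal.ofReal_mul (by positivity)]
      refine mul_le_mul_left (ENNReal.ofReal_le_ofReal ?_) _
      have h1 : (3 : ℝ) ^ n * (1 / 3) ^ n = 1 := by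
        rw [← mul_pow]
        norm_num
      have h2 : (1 / 5 : ℝ) ^ n ≤ 1 := pow_le_one₀ (by norm_num) (by norm_num)
      calc (3 : ℝ) ^ n * (3 * 2 ^ β * ((1 / 3) ^ n * (1 / 5) ^ n))
          = 3 * 2 ^ β * ((3 ^ n * (1 / 3) ^ n) * (1 / 5) ^ n) := by ring
        _ ≤ 3 * 2 ^ β * (1 * 1) := by rw [h1]; gcongr
        _ = 3 * 2 ^ β := by ring
    have ht2 := ENNReal.Tendsto.const_mul ht
      (Or.inr (ENNReal.ofReal_ne_top (r := 3 * 2 ^ β)))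
    rw [mul_zero] at ht2
    exact ge_of_tendsto' ht2 hn
  rw [lintegral_eq_zero_iff ((hU.1.sub_const _).pow_const 2).ennreal_ofReal] at hint
  filter_upwards [hint] with σ hσ
  have h1 : (U σ - cellAverage U []) ^ 2 ≤ 0 := ENNReal.ofReal_eq_zero.1 hσ
  exact sub_eq_zero.1 (pow_eq_zero_iff (by norm_num) |>.1 (le_antisymm h1 (sq_nonneg _)))

/-! ### Dirichlet form axioms for Besov-type forms -/

theorem besovEnergy_mono {M : Type*} [MetricSpace M] [MeasurableSpace M] {μ : Measure M}
    {α β : ℝ} {u v : M → ℝ} (h : ∀ x y, |v x - v y| ≤ |u x - u y|) :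
    besovEnergy μ α β v ≤ besovEnergy μ α β u :=
  lintegral_mono fun x => lintegral_mono fun y => ENNReal.ofReal_le_ofReal
    (div_le_div_of_nonneg_right (sq_le_sq.2 (h x y)) (Real.rpow_nonneg dist_nonneg _))

section Dirichlet

variable {M : Type*} [MetricSpace M] [SecondCountableTopology M] [MeasurableSpace M]
  [BorelSpace M] {μ : Measure M} [SFinite μ] {α β : ℝ}

theorem mem_besovForm_domain {u : Lp ℝ 2 μ} :
    u ∈ (besovForm μ α β).domain ↔ besovEnergy μ α β u < ⊤ := Iff.rfl

theorem besovForm_energyOne (u : (besovForm μ α β).domain) :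
    (besovForm μ α β).energyOne u =
      (besovEnergy μ α β (u : Lp ℝ 2 μ)).toReal + ‖(u : Lp ℝ 2 μ)‖ ^ 2 := by
  rw [L2Form.energyOne, besovForm_self]

theorem besovForm_symm (u v : (besovForm μ α β).domain) :
    (besovForm μ α β).form u v = (besovForm μ α β).form v u := by
  change ∫ p : M × M, _ ∂(μ.prod μ) = ∫ p : M × M, _ ∂(μ.prod μ)
  exact integral_congr_ae (ae_of_all _ fun p => by simp only [mul_comm])

theorem besovForm_nonneg (u : (besovForm μ α β).domain) : 0 ≤ (besovForm μ α β).form u u := by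
  rw [besovForm_self]
  exact ENNReal.toReal_nonneg

theorem besovForm_markov (u : (besovForm μ α β).domain) : ∃ v : (besovForm μ α β).domain,
    ((v : Lp ℝ 2 μ) =ᵐ[μ] fun x => min (max 0 ((u : Lp ℝ 2 μ) x)) 1) ∧
      (besovForm μ α β).form v v ≤ (besovForm μ α β).form u u := by
  have hmem : MemLp (fun x => min (max 0 ((u : Lp ℝ 2 μ) x)) 1) 2 μ := by
    refine (Lp.memLp (u : Lp ℝ 2 μ)).of_le ?_ (ae_of_all _ fun x => ?_)
    · have hm := (Lp.stronglyMeasurable (u : Lp ℝ 2 μ)).measurable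
      exact ((measurable_const.max hm).min measurable_const).aestronglyMeasurable
    · rw [Real.norm_eq_abs, Real.norm_eq_abs,
        abs_of_nonneg (le_min (le_max_left _ _) zero_le_one)]
      exact (min_le_left _ _).trans (max_le (abs_nonneg _) (le_abs_self _))
  have hle : besovEnergy μ α β hmem.toLp ≤ besovEnergy μ α β (u : Lp ℝ 2 μ) := by
    rw [besovEnergy_congr α β hmem.coeFn_toLp]
    refine besovEnergy_mono fun x y => (abs_min_sub_min_le_max _ _ _ _).trans ?_
    rw [sub_self, abs_zero, max_eq_left (abs_nonneg _)]
    refine (abs_max_sub_max_le_max _ _ _ _).trans ?_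
    rw [sub_self, abs_zero, max_eq_right (abs_nonneg _)]
  have hu : besovEnergy μ α β (u : Lp ℝ 2 μ) < ⊤ := u.2
  refine ⟨⟨hmem.toLp, hle.trans_lt hu⟩, hmem.coeFn_toLp, ?_⟩
  rw [besovForm_self, besovForm_self]
  exact ENNReal.toReal_mono hu.ne hle

/-- Fatou's lemma, applied to the inner and then to the outer integral. -/
theorem besovEnergy_le_liminf {w : ℕ → M → ℝ} {w' : M → ℝ} (hw : ∀ k, Measurable (w k))
    (h : ∀ᵐ x ∂μ, Tendsto (fun k => w k x) atTop (𝓝 (w' x))) :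
    besovEnergy μ α β w' ≤ liminf (fun k => besovEnergy μ α β (w k)) atTop := by
  have hm : ∀ k, Measurable fun p : M × M =>
      ENNReal.ofReal ((w k p.1 - w k p.2) ^ 2 / dist p.1 p.2 ^ (α + β)) := fun k => by
    have := (besov_measurable α β (hw k) (hw k)).ennreal_ofReal
    simpa only [sq] using this
  have h1 : ∀ k x, Measurable fun y => ENNReal.ofReal ((w k x - w k y) ^ 2 /
      dist x y ^ (α + β)) := fun k x => by
    have h := (hm k).comp (measurable_prodMk_left (x := x))
    simpa only [Function.comp_def] using h
  have h2 : ∀ k, Measurable fun x => ∫⁻ y, ENNReal.ofReal ((w k x - w k y) ^ 2 /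
      dist x y ^ (α + β)) ∂μ := fun k => (hm k).lintegral_prod_right'
  have h3 : ∀ᵐ x ∂μ, ∫⁻ y, ENNReal.ofReal ((w' x - w' y) ^ 2 / dist x y ^ (α + β)) ∂μ ≤
      liminf (fun k => ∫⁻ y, ENNReal.ofReal ((w k x - w k y) ^ 2 /
        dist x y ^ (α + β)) ∂μ) atTop := by
    filter_upwards [h] with x hx
    refine le_trans (lintegral_mono_ae ?_) (lintegral_liminf_le fun k => h1 k x)
    filter_upwards [h] with y hy
    have ht : Tendsto (fun k => ENNReal.ofReal ((w k x - w k y) ^ 2 / dist x y ^ (α + β))) atTop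
        (𝓝 (ENNReal.ofReal ((w' x - w' y) ^ 2 / dist x y ^ (α + β)))) :=
      ENNReal.tendsto_ofReal (((hx.sub hy).pow 2).div_const _)
    exact ht.liminf_eq.ge
  exact (lintegral_mono_ae h3).trans (lintegral_liminf_le h2)

theorem besovForm_closed (u : ℕ → (besovForm μ α β).domain)
    (hC : ∀ ε : ℝ, 0 < ε → ∃ N : ℕ, ∀ m ≥ N, ∀ n ≥ N,
      (besovForm μ α β).energyOne (u m - u n) < ε) :
    ∃ v : (besovForm μ α β).domain,
      Tendsto (fun n => (besovForm μ α β).energyOne (u n - v)) atTop (𝓝 0) := by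
  have hcauchy : CauchySeq fun n => (u n : Lp ℝ 2 μ) := by
    refine Metric.cauchySeq_iff.2 fun ε hε => ?_
    obtain ⟨N, hN⟩ := hC (ε ^ 2) (by positivity)
    refine ⟨N, fun m hm n hn => ?_⟩
    have h1 := hN m hm n hn
    rw [besovForm_energyOne] at h1
    have h2 : ‖(u m : Lp ℝ 2 μ) - u n‖ ^ 2 < ε ^ 2 :=
      lt_of_le_of_lt (le_add_of_nonneg_left ENNReal.toReal_nonneg) h1
    rw [dist_eq_norm]
    exact lt_of_pow_lt_pow_left₀ 2 hε.le h2
  obtain ⟨g, hg⟩ := cauchySeq_tendsto_of_complete hcauchy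
  -- Almost everywhere convergence along a subsequence suffices: Fatou in k, with m fixed, bounds
  -- the energy of u m - g by the Cauchy bound.
  obtain ⟨ns, hns, hae⟩ := (tendstoInMeasure_of_tendsto_Lp hg).exists_seq_tendsto_ae
  have hsub : ∀ a b : Lp ℝ 2 μ, besovEnergy μ α β (a - b : Lp ℝ 2 μ) =
      besovEnergy μ α β fun x => a x - b x := fun a b =>
    besovEnergy_congr α β (Lp.coeFn_sub a b)
  have hle : ∀ ε : ℝ, 0 < ε → ∃ N : ℕ, ∀ m ≥ N,
      besovEnergy μ α β (u m - g : Lp ℝ 2 μ) ≤ ENNReal.ofReal ε := by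
    intro ε hε
    obtain ⟨N, hN⟩ := hC ε hε
    refine ⟨N, fun m hm => ?_⟩
    have hf : ∀ k ≥ N, besovEnergy μ α β (fun x => (u m : Lp ℝ 2 μ) x - (u k : Lp ℝ 2 μ) x) ≤
        ENNReal.ofReal ε := fun k hk => by
      have h1 := hN m hm k hk
      rw [besovForm_energyOne] at h1
      have h2 : besovEnergy μ α β ((u m - u k : (besovForm μ α β).domain) : Lp ℝ 2 μ) ≠ ⊤ :=
        (u m - u k).2.ne
      have e : ((u m - u k : (besovForm μ α β).domain) : Lp ℝ 2 μ) = u m - u k := rfl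
      rw [e] at h1 h2
      rw [← hsub, ← ENNReal.ofReal_toReal h2]
      exact ENNReal.ofReal_le_ofReal ((le_add_of_nonneg_right (sq_nonneg _)).trans h1.le)
    rw [hsub]
    refine (besovEnergy_le_liminf (w := fun k x => (u m : Lp ℝ 2 μ) x - (u (ns k) : Lp ℝ 2 μ) x)
      (fun k => (Lp.stronglyMeasurable _).measurable.sub (Lp.stronglyMeasurable _).measurable)
      (hae.mono fun x hx => hx.const_sub _)).trans ?_
    refine (liminf_le_liminf (v := fun _ => ENNReal.ofReal ε) ?_).trans (liminf_const _).le
    filter_upwards [eventually_ge_atTop N] with k hk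
    exact hf (ns k) (hk.trans hns.le_apply)
  obtain ⟨N₁, hN₁⟩ := hle 1 one_pos
  have hv : g ∈ (besovForm μ α β).domain := by
    -- The limit is recovered as g = u N₁ - (u N₁ - g), a difference of elements of the domain.
    have h1 : (u N₁ - g : Lp ℝ 2 μ) ∈ (besovForm μ α β).domain :=
      (hN₁ N₁ le_rfl).trans_lt ENNReal.ofReal_lt_top
    have h2 := (besovForm μ α β).domain.sub_mem (u N₁).2 h1
    rwa [sub_sub_cancel] at h2
  refine ⟨⟨g, hv⟩, ?_⟩
  have h1 : Tendsto (fun n => (besovEnergy μ α β (u n - g : Lp ℝ 2 μ)).toReal) atTop (𝓝 0) := by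
    refine Metric.tendsto_atTop.2 fun ε hε => ?_
    obtain ⟨N, hN⟩ := hle (ε / 2) (half_pos hε)
    refine ⟨N, fun n hn => ?_⟩
    rw [Real.dist_eq, sub_zero, abs_of_nonneg ENNReal.toReal_nonneg]
    have := ENNReal.toReal_mono ENNReal.ofReal_ne_top (hN n hn)
    rw [ENNReal.toReal_ofReal (half_pos hε).le] at this
    linarith
  have h2 : Tendsto (fun n => ‖(u n - g : Lp ℝ 2 μ)‖ ^ 2) atTop (𝓝 0) := by
    have := (tendsto_iff_norm_sub_tendsto_zero.1 hg).pow 2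
    simpa using this
  have h3 := h1.add h2
  rw [add_zero] at h3
  refine h3.congr fun n => ?_
  rw [besovForm_energyOne]
  rfl

end Dirichlet

/-! ### Harmonic interpolation -/

/-- The values of a harmonic function at the corners of the `i`-th subcell, in terms of its values
at the corners of the cell. -/
noncomputable def harmonicStep (i : Fin 3) (b : Fin 3 → ℝ) (j : Fin 3) : ℝ :=
  if j = i then b i else (b i + b j + (b 0 + b 1 + b 2)) / 5

/-- The energy of the values at the three corners of a cell, each edge being counted twice. -/
def cornerEnergy (b : Fin 3 → ℝ) : ℝ := ∑ i, ∑ j, (b i - b j) ^ 2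

theorem cornerEnergy_nonneg (b : Fin 3 → ℝ) : 0 ≤ cornerEnergy b :=
  Finset.sum_nonneg fun _ _ => Finset.sum_nonneg fun _ _ => sq_nonneg _

theorem sq_sub_le_cornerEnergy (b : Fin 3 → ℝ) (i j : Fin 3) :
    (b i - b j) ^ 2 ≤ cornerEnergy b :=
  (Finset.single_le_sum (f := fun j => (b i - b j) ^ 2) (fun _ _ => sq_nonneg _)
    (Finset.mem_univ j)).trans (Finset.single_le_sum (f := fun i => ∑ j, (b i - b j) ^ 2)
      (fun _ _ => Finset.sum_nonneg fun _ _ => sq_nonneg _) (Finset.mem_univ i))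

/-- Energy renormalization of the gasket: with the 2/5-2/5-1/5 rule at midpoints the factor is
exactly 3/5, the one in `le_cellEnergy_succ`. -/
theorem sum_cornerEnergy_harmonicStep (b : Fin 3 → ℝ) :
    ∑ i, cornerEnergy (harmonicStep i b) = 3 / 5 * cornerEnergy b := by
  simp [cornerEnergy, harmonicStep, Fin.sum_univ_three]
  ring

theorem cornerEnergy_harmonicStep_le (i : Fin 3) (b : Fin 3 → ℝ) :
    cornerEnergy (harmonicStep i b) ≤ 3 / 5 * cornerEnergy b := by
  rw [← sum_cornerEnergy_harmonicStep]
  exact Finset.single_le_sum (f := fun i => cornerEnergy (harmonicStep i b))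
    (fun _ _ => cornerEnergy_nonneg _) (Finset.mem_univ i)

theorem harmonicStep_self (i : Fin 3) (b : Fin 3 → ℝ) : harmonicStep i b i = b i := if_pos rfl

theorem harmonicStep_comm (i j : Fin 3) (b : Fin 3 → ℝ) :
    harmonicStep i b j = harmonicStep j b i := by
  by_cases h : i = j
  · rw [h]
  · rw [harmonicStep, harmonicStep, if_neg h, if_neg (Ne.symm h)]
    ring

/-- The least of the three values. -/
def lower (b : Fin 3 → ℝ) : ℝ := min (b 0) (min (b 1) (b 2))

/-- The greatest of the three values. -/
def upper (b : Fin 3 → ℝ) : ℝ := max (b 0) (max (b 1) (b 2))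

theorem lower_le (b : Fin 3 → ℝ) (i : Fin 3) : lower b ≤ b i := by
  fin_cases i <;> simp [lower]

theorem le_upper (b : Fin 3 → ℝ) (i : Fin 3) : b i ≤ upper b := by
  fin_cases i <;> simp [upper]

theorem le_lower {b : Fin 3 → ℝ} {t : ℝ} (h : ∀ i, t ≤ b i) : t ≤ lower b :=
  le_min (h 0) (le_min (h 1) (h 2))

theorem upper_le {b : Fin 3 → ℝ} {t : ℝ} (h : ∀ i, b i ≤ t) : upper b ≤ t :=
  max_le (h 0) (max_le (h 1) (h 2))

/-- The extreme values are attained at corners, so the distance from t to b i is at most a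
difference of two corner values. -/
theorem sq_sub_le_of_mem {b : Fin 3 → ℝ} {t : ℝ} (h1 : lower b ≤ t) (h2 : t ≤ upper b)
    (i : Fin 3) : (t - b i) ^ 2 ≤ cornerEnergy b := by
  have hk : ∃ k, upper b = b k := by
    rcases max_choice (b 0) (max (b 1) (b 2)) with h | h
    · exact ⟨0, h⟩
    · rcases max_choice (b 1) (b 2) with h' | h'
      · exact ⟨1, h.trans h'⟩
      · exact ⟨2, h.trans h'⟩
  have hl : ∃ l, lower b = b l := by
    rcases min_choice (b 0) (min (b 1) (b 2)) with h | h
    · exact ⟨0, h⟩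
    · rcases min_choice (b 1) (b 2) with h' | h'
      · exact ⟨1, h.trans h'⟩
      · exact ⟨2, h.trans h'⟩
  obtain ⟨k, hk⟩ := hk
  obtain ⟨l, hl⟩ := hl
  rcases le_total (b i) t with h | h
  · refine le_trans ?_ (sq_sub_le_cornerEnergy b k i)
    exact pow_le_pow_left₀ (sub_nonneg.2 h) (by linarith) 2
  · refine le_trans ?_ (sq_sub_le_cornerEnergy b i l)
    rw [← neg_sub, neg_sq]
    exact pow_le_pow_left₀ (sub_nonneg.2 h) (by linarith) 2

theorem lower_le_lower_harmonicStep (i : Fin 3) (b : Fin 3 → ℝ) :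
    lower b ≤ lower (harmonicStep i b) := by
  refine le_lower fun j => ?_
  rw [harmonicStep]
  split_ifs
  · exact lower_le b i
  · linarith [lower_le b i, lower_le b j, lower_le b 0, lower_le b 1, lower_le b 2]

theorem upper_harmonicStep_le_upper (i : Fin 3) (b : Fin 3 → ℝ) :
    upper (harmonicStep i b) ≤ upper b := by
  refine upper_le fun j => ?_
  rw [harmonicStep]
  split_ifs
  · exact le_upper b i
  · linarith [le_upper b i, le_upper b j, le_upper b 0, le_upper b 1, le_upper b 2]

/-- The values at the corners of the `m`-cell of `σ` of the harmonic function with corner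
values `b`. -/
noncomputable def harmonicCorners : ℕ → (Fin 3 → ℝ) → Address → Fin 3 → ℝ
  | 0, b, _ => b
  | m + 1, b, σ => harmonicCorners m (harmonicStep (σ 0) b) (shift σ)

theorem cornerEnergy_harmonicCorners_le (m : ℕ) (b : Fin 3 → ℝ) (σ : Address) :
    cornerEnergy (harmonicCorners m b σ) ≤ (3 / 5) ^ m * cornerEnergy b := by
  induction m generalizing b σ with
  | zero => simp [harmonicCorners]
  | succ m ih =>
    refine (ih _ _).trans ?_
    rw [pow_succ, mul_assoc]
    exact mul_le_mul_of_nonneg_left (cornerEnergy_harmonicStep_le _ _) (by positivity)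

theorem lower_mono_harmonicCorners (k m : ℕ) (b : Fin 3 → ℝ) (σ : Address) :
    lower (harmonicCorners m b σ) ≤ lower (harmonicCorners (k + m) b σ) := by
  induction m generalizing b σ with
  | zero =>
    rw [add_zero]
    induction k generalizing b σ with
    | zero => exact le_rfl
    | succ k ih => exact (lower_le_lower_harmonicStep (σ 0) b).trans (ih _ (shift σ))
  | succ m ih => exact ih _ _

theorem upper_anti_harmonicCorners (k m : ℕ) (b : Fin 3 → ℝ) (σ : Address) :
    upper (harmonicCorners (k + m) b σ) ≤ upper (harmonicCorners m b σ) := by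
  induction m generalizing b σ with
  | zero =>
    rw [add_zero]
    induction k generalizing b σ with
    | zero => exact le_rfl
    | succ k ih => exact (ih _ (shift σ)).trans (upper_harmonicStep_le_upper (σ 0) b)
  | succ m ih => exact ih _ _

/-- By the maximum principle the ranges of corner values along σ are nested. Hence the supremum of
the lower ends lies in all of them and serves as the harmonic value. -/
theorem lower_le_upper_harmonicCorners (k m : ℕ) (b : Fin 3 → ℝ) (σ : Address) :
    lower (harmonicCorners k b σ) ≤ upper (harmonicCorners m b σ) := by
  have h1 := lower_mono_harmonicCorners m k b σ
  have h2 := upper_anti_harmonicCorners k m b σ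
  rw [add_comm] at h2
  exact h1.trans (((lower_le _ 0).trans (le_upper _ 0)).trans h2)

theorem harmonicCorners_of_corner {m : ℕ} {j : Fin 3} {σ : Address} (h : Corner m j σ)
    (b : Fin 3 → ℝ) : harmonicCorners m b σ j = b j := by
  induction m generalizing b σ with
  | zero => rfl
  | succ m ih =>
    obtain ⟨h0, h⟩ := corner_succ.1 h
    rw [harmonicCorners, ih h, h0, harmonicStep_self]

/-- Adjacent cells share a corner. Where the words part, the midpoint of i and j gets the same value
from both sides, and this value persists down the corner cells. -/
theorem exists_harmonicCorners_eq {m : ℕ} {σ τ : Address} (h : Adj m σ τ) (b : Fin 3 → ℝ) :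
    ∃ i j, harmonicCorners m b σ i = harmonicCorners m b τ j := by
  induction m generalizing b σ τ with
  | zero => exact ⟨0, 0, rfl⟩
  | succ m ih =>
    rcases h with ⟨h0, h⟩ | ⟨_, h1, h2⟩
    · rw [harmonicCorners, harmonicCorners, h0]
      exact ih h _
    · refine ⟨τ 0, σ 0, ?_⟩
      rw [harmonicCorners, harmonicCorners, harmonicCorners_of_corner h1,
        harmonicCorners_of_corner h2, harmonicStep_comm]

/-- The value at `σ` of the harmonic function with corner values `b`. -/
noncomputable def harmonicValue (b : Fin 3 → ℝ) (σ : Address) : ℝ :=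
  ⨆ m, lower (harmonicCorners m b σ)

theorem lower_le_harmonicValue (m : ℕ) (b : Fin 3 → ℝ) (σ : Address) :
    lower (harmonicCorners m b σ) ≤ harmonicValue b σ :=
  le_ciSup (f := fun m => lower (harmonicCorners m b σ)) ⟨upper (harmonicCorners 0 b σ), by
    rintro _ ⟨k, rfl⟩
    exact lower_le_upper_harmonicCorners k 0 b σ⟩ m

theorem harmonicValue_le_upper (m : ℕ) (b : Fin 3 → ℝ) (σ : Address) :
    harmonicValue b σ ≤ upper (harmonicCorners m b σ) :=
  ciSup_le fun k => lower_le_upper_harmonicCorners k m b σ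

/-! ### Interpolation from the corners of the n-cells. -/

/-- The vertices of the gasket. -/
noncomputable def vertex (j : Fin 3) : sierpinskiGasket := point fun _ => j

theorem contraction_vertex_comm (i j : Fin 3) :
    contraction i (vertex j) = contraction j (vertex i) := by
  refine Subtype.ext ?_
  change gasketMap i (gasketPoint fun _ => j) = gasketMap j (gasketPoint fun _ => i)
  rw [gasketPoint_const, gasketPoint_const, gasketMap_gasketVertex_comm]

theorem contraction_vertex_self (j : Fin 3) : contraction j (vertex j) = vertex j := by
  rw [vertex, ← point_cons]
  congr 1
  funext k
  cases k <;> rfl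

/-- The `j`-th corner of the `n`-cell of `σ`. -/
noncomputable def cornerPoint : ℕ → Address → Fin 3 → sierpinskiGasket
  | 0, _, j => vertex j
  | n + 1, σ, j => contraction (σ 0) (cornerPoint n (shift σ) j)

theorem dist_point_cornerPoint_le (n : ℕ) (σ : Address) (j : Fin 3) :
    dist (point σ) (cornerPoint n σ j) ≤ (1 / 2) ^ n := by
  induction n generalizing σ with
  | zero => simpa [cornerPoint, vertex, dist_point] using dist_gasketPoint_le_one σ fun _ => j
  | succ n ih =>
    rw [point_shift, cornerPoint, dist_contraction, pow_succ']
    exact mul_le_mul_of_nonneg_left (ih _) (by norm_num)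

/-- The corner values at level `n + m` of the function which is harmonic on `n`-cells and agrees
with `φ` at the corners of the `n`-cells. -/
noncomputable def interpCorners : ℕ → ℕ → (sierpinskiGasket → ℝ) → Address → Fin 3 → ℝ
  | 0, m, φ, σ => harmonicCorners m (fun j => φ (vertex j)) σ
  | n + 1, m, φ, σ => interpCorners n m (fun x => φ (contraction (σ 0) x)) (shift σ)

/-- The function which is harmonic on `n`-cells and agrees with `φ` at the corners of the
`n`-cells. -/
noncomputable def interp : ℕ → (sierpinskiGasket → ℝ) → Address → ℝ
  | 0, φ, σ => harmonicValue (fun j => φ (vertex j)) σ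
  | n + 1, φ, σ => interp n (fun x => φ (contraction (σ 0) x)) (shift σ)

theorem lower_le_interp (n m : ℕ) (φ : sierpinskiGasket → ℝ) (σ : Address) :
    lower (interpCorners n m φ σ) ≤ interp n φ σ := by
  induction n generalizing φ σ with
  | zero => exact lower_le_harmonicValue _ _ _
  | succ n ih => exact ih _ _

theorem interp_le_upper (n m : ℕ) (φ : sierpinskiGasket → ℝ) (σ : Address) :
    interp n φ σ ≤ upper (interpCorners n m φ σ) := by
  induction n generalizing φ σ with
  | zero => exact harmonicValue_le_upper _ _ _
  | succ n ih => exact ih _ _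

theorem interpCorners_zero (n : ℕ) (φ : sierpinskiGasket → ℝ) (σ : Address) (j : Fin 3) :
    interpCorners n 0 φ σ j = φ (cornerPoint n σ j) := by
  induction n generalizing φ σ with
  | zero => rfl
  | succ n ih => exact ih _ _

theorem interpCorners_of_corner {n m : ℕ} {j : Fin 3} {σ : Address} (h : Corner (m + n) j σ)
    (φ : sierpinskiGasket → ℝ) : interpCorners n m φ σ j = φ (vertex j) := by
  induction n generalizing φ σ with
  | zero => exact harmonicCorners_of_corner h _
  | succ n ih =>
    have h' : Corner (m + n + 1) j σ := h
    obtain ⟨h0, h⟩ := corner_succ.1 h'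
    rw [interpCorners, ih h, h0, contraction_vertex_self]

theorem exists_interpCorners_eq {n m : ℕ} {σ τ : Address} (h : Adj (m + n) σ τ)
    (φ : sierpinskiGasket → ℝ) :
    ∃ i j, interpCorners n m φ σ i = interpCorners n m φ τ j := by
  induction n generalizing φ σ τ with
  | zero => exact exists_harmonicCorners_eq h _
  | succ n ih =>
    have h' : Adj (m + n + 1) σ τ := h
    rcases h' with ⟨h0, h⟩ | ⟨_, h1, h2⟩
    · rw [interpCorners, interpCorners, h0]
      exact ih h _
    · refine ⟨τ 0, σ 0, ?_⟩
      rw [interpCorners, interpCorners, interpCorners_of_corner h1, interpCorners_of_corner h2,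
        contraction_vertex_comm]

/-- Compare both values with the one at a common corner of the two cells. -/
theorem interp_sub_sq_le {n m : ℕ} {σ τ : Address} (h : Adj (m + n) σ τ)
    (φ : sierpinskiGasket → ℝ) :
    (interp n φ σ - interp n φ τ) ^ 2 ≤
      2 * cornerEnergy (interpCorners n m φ σ) + 2 * cornerEnergy (interpCorners n m φ τ) := by
  obtain ⟨i, j, hij⟩ := exists_interpCorners_eq h φ
  have h1 := sq_sub_le_of_mem (lower_le_interp n m φ σ) (interp_le_upper n m φ σ) i
  have h2 := sq_sub_le_of_mem (lower_le_interp n m φ τ) (interp_le_upper n m φ τ) j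
  rw [hij] at h1
  nlinarith [sq_nonneg (interp n φ σ - interpCorners n m φ τ j +
    (interp n φ τ - interpCorners n m φ τ j))]

theorem cornerEnergy_interpCorners_le (n m : ℕ) (φ : sierpinskiGasket → ℝ) (σ : Address) :
    cornerEnergy (interpCorners n m φ σ) ≤ (3 / 5) ^ m * cornerEnergy (interpCorners n 0 φ σ) := by
  induction n generalizing φ σ with
  | zero => exact cornerEnergy_harmonicCorners_le _ _ _
  | succ n ih => exact ih _ _

theorem exists_cornerEnergy_le (n : ℕ) (φ : sierpinskiGasket → ℝ) :
    ∃ B, ∀ σ, cornerEnergy (interpCorners n 0 φ σ) ≤ B := by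
  induction n generalizing φ with
  | zero => exact ⟨cornerEnergy fun j => φ (vertex j), fun σ => le_rfl⟩
  | succ n ih =>
    choose B hB using fun i => ih fun x => φ (contraction i x)
    refine ⟨∑ i, |B i|, fun σ => (hB (σ 0) (shift σ)).trans ((le_abs_self _).trans ?_)⟩
    exact Finset.single_le_sum (f := fun i => |B i|) (fun _ _ => abs_nonneg _) (Finset.mem_univ _)

theorem measurable_harmonicCorners (m : ℕ) (b : Fin 3 → ℝ) (j : Fin 3) :
    Measurable fun σ => harmonicCorners m b σ j := by
  induction m generalizing b with
  | zero => exact measurable_const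
  | succ m ih => exact measurable_of_comp_cons fun i => ih (harmonicStep i b)

theorem measurable_interpCorners (n m : ℕ) (φ : sierpinskiGasket → ℝ) (j : Fin 3) :
    Measurable fun σ => interpCorners n m φ σ j := by
  induction n generalizing φ with
  | zero => exact measurable_harmonicCorners _ _ _
  | succ n ih => exact measurable_of_comp_cons fun i => ih fun x => φ (contraction i x)

theorem Measurable.cornerEnergy {b : Address → Fin 3 → ℝ} (h : ∀ j, Measurable fun σ => b σ j) :
    Measurable fun σ => cornerEnergy (b σ) :=
  Finset.measurable_fun_sum _ fun i _ => Finset.measurable_fun_sum _ fun j _ =>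
    ((h i).sub (h j)).pow_const 2

/-- Per level, the sum over the three subcells contributes 3/5 and the mean over letters 1/3:
together 1/5. -/
theorem lintegral_cornerEnergy_harmonicCorners (m : ℕ) (b : Fin 3 → ℝ) :
    ∫⁻ σ, ENNReal.ofReal (cornerEnergy (harmonicCorners m b σ)) ∂bernoulli =
      ENNReal.ofReal ((1 / 5) ^ m * cornerEnergy b) := by
  induction m generalizing b with
  | zero => simp [harmonicCorners]
  | succ m ih =>
    rw [lintegral_bernoulli (Measurable.cornerEnergy
      (measurable_harmonicCorners (m + 1) b)).ennreal_ofReal]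
    simp only [harmonicCorners, cons_zero, shift_cons, ih]
    rw [← ENNReal.ofReal_sum_of_nonneg fun i _ => mul_nonneg (by positivity)
      (cornerEnergy_nonneg _), ← Finset.mul_sum, sum_cornerEnergy_harmonicStep]
    have h3 : (3⁻¹ : ℝ≥0∞) = ENNReal.ofReal (1 / 3) := by simp
    rw [h3, ← ENNReal.ofReal_mul (by norm_num)]
    congr 1
    ring

theorem lintegral_cornerEnergy_interpCorners (n m : ℕ) (φ : sierpinskiGasket → ℝ) :
    ∫⁻ σ, ENNReal.ofReal (cornerEnergy (interpCorners n m φ σ)) ∂bernoulli =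
      ENNReal.ofReal ((1 / 5) ^ m) *
        ∫⁻ σ, ENNReal.ofReal (cornerEnergy (interpCorners n 0 φ σ)) ∂bernoulli := by
  induction n generalizing φ with
  | zero =>
    simp only [interpCorners, lintegral_cornerEnergy_harmonicCorners]
    rw [← ENNReal.ofReal_mul (by positivity), pow_zero, one_mul]
  | succ n ih =>
    rw [lintegral_bernoulli (Measurable.cornerEnergy
      (measurable_interpCorners (n + 1) m φ)).ennreal_ofReal, lintegral_bernoulli
      (Measurable.cornerEnergy (measurable_interpCorners (n + 1) 0 φ)).ennreal_ofReal]
    simp only [interpCorners, cons_zero, shift_cons, ih]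
    rw [← Finset.mul_sum]
    ring

/-- Words of one point are adjacent at every level, and the corner energies decay like (3/5)^m, so
the interpolation descends to the gasket. The same estimate gives its continuity. -/
theorem interp_eq_of_point_eq {n : ℕ} {σ τ : Address} (h : point σ = point τ)
    (φ : sierpinskiGasket → ℝ) : interp n φ σ = interp n φ τ := by
  obtain ⟨B, hB⟩ := exists_cornerEnergy_le n φ
  have hle : ∀ m : ℕ, (interp n φ σ - interp n φ τ) ^ 2 ≤ (3 / 5) ^ m * (4 * B) := fun m => by
    have hadj : Adj (m + n) σ τ := adj_of_dist_lt (by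
      rw [← dist_point, h, dist_self]
      positivity)
    have h1 := cornerEnergy_interpCorners_le n m φ σ
    have h2 := cornerEnergy_interpCorners_le n m φ τ
    have h3 := mul_le_mul_of_nonneg_left (hB σ) (show (0 : ℝ) ≤ (3 / 5) ^ m by positivity)
    have h4 := mul_le_mul_of_nonneg_left (hB τ) (show (0 : ℝ) ≤ (3 / 5) ^ m by positivity)
    linarith [interp_sub_sq_le hadj φ]
  have ht : Tendsto (fun m : ℕ => (3 / 5 : ℝ) ^ m * (4 * B)) atTop (𝓝 (0 * (4 * B))) :=
    (tendsto_pow_atTop_nhds_zero_of_lt_one (by norm_num) (by norm_num)).mul_const _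
  rw [zero_mul] at ht
  have := ge_of_tendsto' ht hle
  exact sub_eq_zero.1 (pow_eq_zero_iff (by norm_num) |>.1 (le_antisymm this (sq_nonneg _)))

/-- The harmonic interpolation as a function on the gasket. -/
noncomputable def interpFun (n : ℕ) (φ : sierpinskiGasket → ℝ) (x : sierpinskiGasket) : ℝ :=
  interp n φ (Function.surjInv point_surjective x)

theorem interpFun_point (n : ℕ) (φ : sierpinskiGasket → ℝ) (σ : Address) :
    interpFun n φ (point σ) = interp n φ σ :=
  interp_eq_of_point_eq (Function.surjInv_eq point_surjective _) φ

theorem continuous_interpFun (n : ℕ) (φ : sierpinskiGasket → ℝ) : Continuous (interpFun n φ) := by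
  obtain ⟨B, hB⟩ := exists_cornerEnergy_le n φ
  refine Metric.continuous_iff.2 fun x ε hε => ?_
  have ht : Tendsto (fun m : ℕ => (3 / 5 : ℝ) ^ m * (4 * B)) atTop (𝓝 (0 * (4 * B))) :=
    (tendsto_pow_atTop_nhds_zero_of_lt_one (by norm_num) (by norm_num)).mul_const _
  rw [zero_mul] at ht
  obtain ⟨m, hm⟩ := (ht.eventually (gt_mem_nhds (pow_pos hε 2))).exists
  refine ⟨(1 / 2) ^ (m + n) / 2, by positivity, fun y hy => ?_⟩
  obtain ⟨σ, rfl⟩ := point_surjective x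
  obtain ⟨τ, rfl⟩ := point_surjective y
  have hadj : Adj (m + n) τ σ := adj_of_dist_lt hy
  have h1 := cornerEnergy_interpCorners_le n m φ σ
  have h2 := cornerEnergy_interpCorners_le n m φ τ
  have h3 := mul_le_mul_of_nonneg_left (hB σ) (show (0 : ℝ) ≤ (3 / 5) ^ m by positivity)
  have h4 := mul_le_mul_of_nonneg_left (hB τ) (show (0 : ℝ) ≤ (3 / 5) ^ m by positivity)
  rw [interpFun_point, interpFun_point, Real.dist_eq]
  refine abs_lt_of_sq_lt_sq ?_ hε.le
  linarith [interp_sub_sq_le hadj φ]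

theorem abs_sub_interp_le {n : ℕ} {φ : sierpinskiGasket → ℝ} {ε : ℝ}
    (h : ∀ x y, dist x y ≤ (1 / 2) ^ n → |φ x - φ y| ≤ ε) (σ : Address) :
    |φ (point σ) - interp n φ σ| ≤ ε := by
  have hc : ∀ j, |φ (point σ) - interpCorners n 0 φ σ j| ≤ ε := fun j => by
    rw [interpCorners_zero]
    exact h _ _ (dist_point_cornerPoint_le n σ j)
  have h1 : φ (point σ) - ε ≤ interp n φ σ :=
    (le_lower fun j => by linarith [(abs_le.1 (hc j)).2]).trans (lower_le_interp n 0 φ σ)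
  have h2 : interp n φ σ ≤ φ (point σ) + ε :=
    (interp_le_upper n 0 φ σ).trans (upper_le fun j => by linarith [(abs_le.1 (hc j)).1])
  exact abs_le.2 ⟨by linarith, by linarith⟩

/-! ### Energy estimates -/

theorem lintegral_adj_const_le (m : ℕ) (σ : Address) (c : ℝ≥0∞) :
    ∫⁻ τ, {τ | Adj m σ τ}.indicator (fun _ => c) τ ∂bernoulli ≤ 4 * 3⁻¹ ^ m * c := by
  have hm : MeasurableSet {τ | Adj m σ τ} := measurable_prodMk_left (measurableSet_adj m)
  rw [lintegral_indicator_const hm, mul_comm]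
  exact mul_le_mul_left (bernoulli_adj_le m σ) c

/-- Each variable in turn is integrated over an adjacency class of mass at most 4·3^(-m). -/
theorem setLIntegral_adj_add_le (m : ℕ) {G : Address → ℝ≥0∞} (hG : Measurable G) :
    ∫⁻ p in {p | Adj m p.1 p.2}, (G p.1 + G p.2) ∂bernoulli₂ ≤
      8 * 3⁻¹ ^ m * ∫⁻ σ, G σ ∂bernoulli := by
  have hG1 : Measurable fun p : Address × Address => G p.1 := hG.comp measurable_fst
  have hG2 : Measurable fun p : Address × Address => G p.2 := hG.comp measurable_snd
  have h1 : ∫⁻ p in {p | Adj m p.1 p.2}, G p.1 ∂bernoulli₂ ≤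
      4 * 3⁻¹ ^ m * ∫⁻ σ, G σ ∂bernoulli := by
    rw [← lintegral_indicator (measurableSet_adj m), lintegral_prod _
      (hG1.indicator (measurableSet_adj m)).aemeasurable,
      ← lintegral_const_mul _ hG]
    exact lintegral_mono fun σ => lintegral_adj_const_le m σ (G σ)
  have h2 : ∫⁻ p in {p | Adj m p.1 p.2}, G p.2 ∂bernoulli₂ ≤
      4 * 3⁻¹ ^ m * ∫⁻ σ, G σ ∂bernoulli := by
    rw [← lintegral_indicator (measurableSet_adj m), lintegral_prod_symm _
      (hG2.indicator (measurableSet_adj m)).aemeasurable,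
      ← lintegral_const_mul _ hG]
    refine lintegral_mono fun τ => le_trans (lintegral_mono fun σ => ?_)
      (lintegral_adj_const_le m τ (G τ))
    simp only [indicator, mem_ofPred_eq]
    by_cases h : Adj m σ τ
    · rw [if_pos h, if_pos h.symm]
    · rw [if_neg h, if_neg fun h' => h h'.symm]
  rw [lintegral_add_left hG1]
  refine (add_le_add h1 h2).trans (le_of_eq ?_)
  rw [← add_mul, ← add_mul]
  norm_num

theorem adjEnergy_le_of_sq_le {m : ℕ} {U : Address → ℝ} {q : Address → ℝ} (hq : Measurable q)
    (hq0 : ∀ σ, 0 ≤ q σ) (h : ∀ σ τ, Adj m σ τ → (U σ - U τ) ^ 2 ≤ 2 * q σ + 2 * q τ) :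
    adjEnergy m U ≤ ENNReal.ofReal (16 * (1 / 3) ^ m) *
      ∫⁻ σ, ENNReal.ofReal (q σ) ∂bernoulli := by
  have h1 : adjEnergy m U ≤ ∫⁻ p in {p | Adj m p.1 p.2},
      (ENNReal.ofReal (2 * q p.1) + ENNReal.ofReal (2 * q p.2)) ∂bernoulli₂ := by
    refine setLIntegral_mono' (measurableSet_adj m) fun p hp => ?_
    rw [← ENNReal.ofReal_add (mul_nonneg zero_le_two (hq0 _)) (mul_nonneg zero_le_two (hq0 _))]
    exact ENNReal.ofReal_le_ofReal (h _ _ hp)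
  refine h1.trans ((setLIntegral_adj_add_le m (hq.const_mul 2).ennreal_ofReal).trans ?_)
  have h2 : ∀ σ, ENNReal.ofReal (2 * q σ) = 2 * ENNReal.ofReal (q σ) := fun σ => by
    rw [ENNReal.ofReal_mul zero_le_two, ENNReal.ofReal_ofNat]
  simp only [h2]
  rw [lintegral_const_mul _ hq.ennreal_ofReal, ENNReal.ofReal_mul (by norm_num),
    ofReal_third_pow, ENNReal.ofReal_ofNat]
  refine le_of_eq ?_
  have : (16 : ℝ≥0∞) = 8 * 2 := by norm_num
  rw [this]
  ring

theorem adjEnergy_le_lintegral_sq (m : ℕ) {U : Address → ℝ} (hU : Measurable U) :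
    adjEnergy m U ≤ ENNReal.ofReal (16 * (1 / 3) ^ m) *
      ∫⁻ σ, ENNReal.ofReal (U σ ^ 2) ∂bernoulli :=
  adjEnergy_le_of_sq_le (hU.pow_const 2) (fun _ => sq_nonneg _) fun σ τ _ => by
    nlinarith [sq_nonneg (U σ + U τ)]

theorem adjEnergy_interp_le (n m : ℕ) (φ : sierpinskiGasket → ℝ) :
    adjEnergy (m + n) (interp n φ) ≤ ENNReal.ofReal (16 * (1 / 3) ^ (m + n) * (1 / 5) ^ m) *
      ∫⁻ σ, ENNReal.ofReal (cornerEnergy (interpCorners n 0 φ σ)) ∂bernoulli := by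
  refine (adjEnergy_le_of_sq_le (Measurable.cornerEnergy (measurable_interpCorners n m φ))
    (fun _ => cornerEnergy_nonneg _) fun σ τ h => interp_sub_sq_le h φ).trans ?_
  rw [lintegral_cornerEnergy_interpCorners, ← mul_assoc, ← ENNReal.ofReal_mul (by positivity)]

/-! ### Dyadic decomposition of the Besov energy. -/

theorem besovDensity_le {s : ℝ} (hs : 0 ≤ s) (U : Address → ℝ) {m : ℕ} {p : Address × Address}
    (h : ¬ Adj (m + 1) p.1 p.2) :
    besovDensity s U p ≤
      ENNReal.ofReal (4 ^ s * (2 ^ s) ^ m) * ENNReal.ofReal ((U p.1 - U p.2) ^ 2) := by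
  have hd := le_dist_of_not_adj h
  have hd0 : (0 : ℝ) < (1 / 2) ^ (m + 1) / 2 := by positivity
  rw [besovDensity, ← ENNReal.ofReal_mul (by positivity)]
  refine ENNReal.ofReal_le_ofReal ?_
  rw [div_le_iff₀ (Real.rpow_pos_of_pos (hd0.trans_le hd) s), mul_right_comm]
  refine le_mul_of_one_le_left (sq_nonneg _) ?_
  have h1 : (4 : ℝ) ^ s * (2 ^ s) ^ m * ((1 / 2) ^ (m + 1) / 2) ^ s = 1 := by
    rw [← Real.rpow_natCast, ← Real.rpow_mul (by norm_num), mul_comm s, Real.rpow_mul (by norm_num),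
      Real.rpow_natCast, ← Real.mul_rpow (by norm_num) (by positivity),
      ← Real.mul_rpow (by positivity) hd0.le]
    have : (4 : ℝ) * 2 ^ m * ((1 / 2) ^ (m + 1) / 2) = (2 * (1 / 2)) ^ m := by
      rw [pow_succ, mul_pow]
      ring
    rw [this]
    norm_num
  rw [← h1]
  exact mul_le_mul_of_nonneg_left (Real.rpow_le_rpow hd0.le hd hs) (by positivity)

theorem exists_adj_not_adj_succ {σ τ : Address} (h : gasketPoint σ ≠ gasketPoint τ) :
    ∃ k, Adj k σ τ ∧ ¬ Adj (k + 1) σ τ := by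
  by_contra hcon
  push Not at hcon
  have hall : ∀ k, Adj k σ τ := fun k => by
    induction k with
    | zero => trivial
    | succ k ih => exact hcon k ih
  have ht : Tendsto (fun n : ℕ => 2 * (1 / 2 : ℝ) ^ n) atTop (𝓝 (2 * 0)) :=
    (tendsto_pow_atTop_nhds_zero_of_lt_one (by norm_num) (by norm_num)).const_mul _
  have := ge_of_tendsto' ht fun n => dist_le_of_adj (hall n)
  rw [mul_zero] at this
  exact h (dist_le_zero.1 this)

theorem besovDensity_eq_zero {s : ℝ} (hs : s ≠ 0) (U : Address → ℝ) {p : Address × Address}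
    (h : gasketPoint p.1 = gasketPoint p.2) : besovDensity s U p = 0 := by
  simp [besovDensity, h, Real.zero_rpow hs]

/-- Each pair of words of distinct points has a last level k of adjacency; there the density is at
most 4^s·2^(sk) times the squared difference. Here k ≥ n; the far part has k < n. -/
theorem setLIntegral_adj_besovDensity_le {s : ℝ} (hs : 0 < s) {U : Address → ℝ}
    (hU : Measurable U) (n : ℕ) :
    ∫⁻ p in {p | Adj n p.1 p.2}, besovDensity s U p ∂bernoulli₂ ≤
      ∑' m, ENNReal.ofReal (4 ^ s * (2 ^ s) ^ (m + n)) * adjEnergy (m + n) U := by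
  have hm := measurable_sub_sq hU hU
  have hind : ∀ m, Measurable ({p : Address × Address | Adj m p.1 p.2}.indicator
      fun p => ENNReal.ofReal ((U p.1 - U p.2) ^ 2)) := fun m =>
    hm.indicator (measurableSet_adj m)
  have h1 : ∀ m, adjEnergy m U = ∫⁻ p, {p : Address × Address | Adj m p.1 p.2}.indicator
      (fun p => ENNReal.ofReal ((U p.1 - U p.2) ^ 2)) p ∂bernoulli₂ := fun m =>
    (lintegral_indicator (measurableSet_adj m) _).symm
  simp only [h1, ← lintegral_const_mul _ (hind _)]
  rw [← lintegral_tsum fun m => ((hind _).const_mul _).aemeasurable,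
    ← lintegral_indicator (measurableSet_adj n)]
  refine lintegral_mono fun p => ?_
  by_cases hp : Adj n p.1 p.2
  · rw [indicator_of_mem (show p ∈ {p : Address × Address | Adj n p.1 p.2} from hp)]
    by_cases hd : gasketPoint p.1 = gasketPoint p.2
    · rw [besovDensity_eq_zero hs.ne' U hd]
      exact zero_le
    · obtain ⟨k, hk, hk'⟩ := exists_adj_not_adj_succ hd
      have hnk : n ≤ k := by
        by_contra hlt
        exact hk' (hp.mono (by omega))
      refine le_trans ?_ (ENNReal.le_tsum (k - n))
      rw [Nat.sub_add_cancel hnk,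
        indicator_of_mem (show p ∈ {p : Address × Address | Adj k p.1 p.2} from hk)]
      exact besovDensity_le hs.le U hk'
  · rw [indicator_of_notMem (show p ∉ {p : Address × Address | Adj n p.1 p.2} from hp)]
    exact zero_le

theorem setLIntegral_not_adj_besovDensity_le {s : ℝ} (hs : 0 < s) {U : Address → ℝ}
    (hU : Measurable U) (n : ℕ) :
    ∫⁻ p in {p | Adj n p.1 p.2}ᶜ, besovDensity s U p ∂bernoulli₂ ≤
      ∑ m ∈ Finset.range n, ENNReal.ofReal (4 ^ s * (2 ^ s) ^ m) * adjEnergy m U := by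
  have hm := measurable_sub_sq hU hU
  have hind : ∀ m, Measurable ({p : Address × Address | Adj m p.1 p.2}.indicator
      fun p => ENNReal.ofReal ((U p.1 - U p.2) ^ 2)) := fun m =>
    hm.indicator (measurableSet_adj m)
  have h1 : ∀ m, adjEnergy m U = ∫⁻ p, {p : Address × Address | Adj m p.1 p.2}.indicator
      (fun p => ENNReal.ofReal ((U p.1 - U p.2) ^ 2)) p ∂bernoulli₂ := fun m =>
    (lintegral_indicator (measurableSet_adj m) _).symm
  simp only [h1, ← lintegral_const_mul _ (hind _)]
  rw [← lintegral_finsetSum _ fun m _ => (hind _).const_mul _,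
    ← lintegral_indicator (measurableSet_adj n).compl]
  refine lintegral_mono fun p => ?_
  by_cases hp : Adj n p.1 p.2
  · rw [indicator_of_notMem (fun h : p ∈ {p : Address × Address | Adj n p.1 p.2}ᶜ => h hp)]
    exact zero_le
  · rw [indicator_of_mem (show p ∈ {p : Address × Address | Adj n p.1 p.2}ᶜ from hp)]
    by_cases hd : gasketPoint p.1 = gasketPoint p.2
    · rw [besovDensity_eq_zero hs.ne' U hd]
      exact zero_le
    · obtain ⟨k, hk, hk'⟩ := exists_adj_not_adj_succ hd
      have hkn : k < n := by
        by_contra hlt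
        exact hp (hk.mono (by omega))
      refine le_trans ?_ (Finset.single_le_sum (f := fun m =>
        ENNReal.ofReal (4 ^ s * (2 ^ s) ^ m) * {p : Address × Address | Adj m p.1 p.2}.indicator
          (fun p => ENNReal.ofReal ((U p.1 - U p.2) ^ 2)) p) (fun _ _ => zero_le)
        (Finset.mem_range.2 hkn))
      simp only
      rw [indicator_of_mem (show p ∈ {p : Address × Address | Adj k p.1 p.2} from hk)]
      exact besovDensity_le hs.le U hk'

theorem lintegral_besovDensity_eq_add {s : ℝ} (U : Address → ℝ) (n : ℕ) :
    ∫⁻ p, besovDensity s U p ∂bernoulli₂ =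
      ∫⁻ p in {p | Adj n p.1 p.2}, besovDensity s U p ∂bernoulli₂ +
        ∫⁻ p in {p | Adj n p.1 p.2}ᶜ, besovDensity s U p ∂bernoulli₂ :=
  (lintegral_add_compl _ (measurableSet_adj n)).symm

theorem measurable_interp (n : ℕ) (φ : sierpinskiGasket → ℝ) : Measurable (interp n φ) := by
  have : interp n φ = fun σ => interpFun n φ (point σ) :=
    funext fun σ => (interpFun_point n φ σ).symm
  rw [this]
  exact ((continuous_interpFun n φ).comp continuous_point).measurable

theorem two_rpow_gasketDim_add (β : ℝ) : (2 : ℝ) ^ (gasketDim + β) = 3 * 2 ^ β := by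
  rw [Real.rpow_add (by norm_num), two_rpow_gasketDim]

/-- At level m the weight 2^((α+β)m) meets the mass 3^(-m), leaving 2^(βm); the geometric sum over m
< n is at most 2^(βn)/(2^β - 1). -/
theorem far_le {β : ℝ} (hβ : 0 < β) {U : Address → ℝ} (hU : Measurable U) (n : ℕ) :
    ∫⁻ p in {p | Adj n p.1 p.2}ᶜ, besovDensity (gasketDim + β) U p ∂bernoulli₂ ≤
      ENNReal.ofReal (16 * 4 ^ (gasketDim + β) * (2 ^ β - 1)⁻¹ * (2 ^ β) ^ n) *
        ∫⁻ σ, ENNReal.ofReal (U σ ^ 2) ∂bernoulli := by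
  have hs : 0 < gasketDim + β := add_pos gasketDim_pos hβ
  have hb : 1 < (2 : ℝ) ^ β := Real.one_lt_rpow (by norm_num) hβ
  refine (setLIntegral_not_adj_besovDensity_le hs hU n).trans ?_
  have h1 : ∀ m ∈ Finset.range n, ENNReal.ofReal (4 ^ (gasketDim + β) *
      (2 ^ (gasketDim + β)) ^ m) * adjEnergy m U ≤
      ENNReal.ofReal (16 * 4 ^ (gasketDim + β) * (2 ^ β) ^ m) *
        ∫⁻ σ, ENNReal.ofReal (U σ ^ 2) ∂bernoulli := fun m _ => by
    refine (mul_le_mul_right (adjEnergy_le_lintegral_sq m hU) _).trans (le_of_eq ?_)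
    rw [← mul_assoc, ← ENNReal.ofReal_mul (by positivity), two_rpow_gasketDim_add]
    congr 2
    have : (3 * (2 : ℝ) ^ β) ^ m * (1 / 3) ^ m = (2 ^ β) ^ m := by
      rw [← mul_pow]
      congr 1
      ring
    rw [← this]
    ring
  refine (Finset.sum_le_sum h1).trans ?_
  rw [← Finset.sum_mul, ← ENNReal.ofReal_sum_of_nonneg fun m _ => by positivity, ← Finset.mul_sum,
    geom_sum_eq hb.ne']
  refine mul_le_mul_left (ENNReal.ofReal_le_ofReal ?_) _
  rw [mul_assoc _ (2 ^ β - 1)⁻¹, div_eq_inv_mul]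
  have : 0 < (2 ^ β - 1 : ℝ)⁻¹ := inv_pos.2 (by linarith)
  gcongr
  linarith

/-- Beyond level n harmonicity adds the decay 5^(-m), so the series is geometric of ratio 2^β/5. -/
theorem near_interp_le {β : ℝ} (hβ : 0 < β) (hβ5 : (2 : ℝ) ^ β < 5) (n : ℕ)
    (φ : sierpinskiGasket → ℝ) :
    ∫⁻ p in {p | Adj n p.1 p.2}, besovDensity (gasketDim + β) (interp n φ) p ∂bernoulli₂ ≤
      ENNReal.ofReal (16 * 4 ^ (gasketDim + β) * (1 - 2 ^ β / 5)⁻¹ * (2 ^ β) ^ n) *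
        ∫⁻ σ, ENNReal.ofReal (cornerEnergy (interpCorners n 0 φ σ)) ∂bernoulli := by
  have hs : 0 < gasketDim + β := add_pos gasketDim_pos hβ
  have hr0 : (0 : ℝ) ≤ 2 ^ β / 5 := by positivity
  have hr1 : (2 : ℝ) ^ β / 5 < 1 := by linarith
  refine (setLIntegral_adj_besovDensity_le hs (measurable_interp n φ) n).trans ?_
  have h1 : ∀ m, ENNReal.ofReal (4 ^ (gasketDim + β) *
      (2 ^ (gasketDim + β)) ^ (m + n)) * adjEnergy (m + n) (interp n φ) ≤
      ENNReal.ofReal (16 * 4 ^ (gasketDim + β) * (2 ^ β) ^ n * (2 ^ β / 5) ^ m) *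
        ∫⁻ σ, ENNReal.ofReal (cornerEnergy (interpCorners n 0 φ σ)) ∂bernoulli := fun m => by
    refine (mul_le_mul_right (adjEnergy_interp_le n m φ) _).trans (le_of_eq ?_)
    rw [← mul_assoc, ← ENNReal.ofReal_mul (by positivity), two_rpow_gasketDim_add]
    congr 2
    have h3 : (3 * (2 : ℝ) ^ β) ^ (m + n) * (1 / 3) ^ (m + n) = (2 ^ β) ^ (m + n) := by
      rw [← mul_pow]
      congr 1
      ring
    have h5 : ((2 : ℝ) ^ β / 5) ^ m = (2 ^ β) ^ m * (1 / 5) ^ m := by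
      rw [← mul_pow]
      congr 1
      ring
    rw [h5]
    calc _ = 16 * 4 ^ (gasketDim + β) * ((3 * (2 : ℝ) ^ β) ^ (m + n) * (1 / 3) ^ (m + n)) *
          (1 / 5) ^ m := by ring
      _ = _ := by
        rw [h3, pow_add]
        ring
  refine (ENNReal.tsum_le_tsum h1).trans ?_
  rw [ENNReal.tsum_mul_right, ← ENNReal.ofReal_tsum_of_nonneg (fun m => by positivity)
    ((summable_geometric_of_lt_one hr0 hr1).mul_left _), tsum_mul_left,
    tsum_geometric_of_lt_one hr0 hr1]
  refine le_of_eq ?_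
  congr 2
  ring

theorem lintegral_besovDensity_interp_lt_top {β : ℝ} (hβ : 0 < β) (hβ5 : (2 : ℝ) ^ β < 5) (n : ℕ)
    (φ : sierpinskiGasket → ℝ) :
    ∫⁻ p, besovDensity (gasketDim + β) (interp n φ) p ∂bernoulli₂ < ⊤ := by
  rw [lintegral_besovDensity_eq_add _ n, ENNReal.add_lt_top]
  constructor
  · refine (near_interp_le hβ hβ5 n φ).trans_lt (ENNReal.mul_lt_top ENNReal.ofReal_lt_top ?_)
    obtain ⟨B, hB⟩ := exists_cornerEnergy_le n φ
    refine (lintegral_mono fun σ => ENNReal.ofReal_le_ofReal (hB σ)).trans_lt ?_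
    simp
  · refine (far_le hβ (measurable_interp n φ) n).trans_lt
      (ENNReal.mul_lt_top ENNReal.ofReal_lt_top ?_)
    obtain ⟨C, hC⟩ := isCompact_univ.exists_bound_of_continuousOn
      (continuous_interpFun n φ).continuousOn
    have : ∀ σ, interp n φ σ ^ 2 ≤ C ^ 2 := fun σ => by
      rw [← interpFun_point, ← sq_abs]
      exact pow_le_pow_left₀ (abs_nonneg _) (hC (point σ) (mem_univ _)) 2
    refine (lintegral_mono fun σ => ENNReal.ofReal_le_ofReal (this σ)).trans_lt ?_
    simp

/-! ### Approximation by harmonic interpolation of local averages -/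

/-- The average of `u` over the closed ball of radius `2 ^ (-n)`. -/
noncomputable def ballAverage (n : ℕ) (u : sierpinskiGasket → ℝ) (q : sierpinskiGasket) : ℝ :=
  ∫ x, u x ∂(ProbabilityTheory.cond gasketMeasure (Metric.closedBall q ((1 / 2) ^ n)))

/-- Jensen's inequality on a ball of mass at least 3^(-n). Its points and the point of σ are all
within 2^(-n) of the corner, hence form near pairs. -/
theorem ofReal_ballAverage_sub_sq_le (n : ℕ) {u : sierpinskiGasket → ℝ} (hu : Measurable u)
    (hi : Integrable u gasketMeasure) (σ : Address) (j : Fin 3) :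
    ENNReal.ofReal ((ballAverage n u (cornerPoint n σ j) - u (point σ)) ^ 2) ≤
      3 ^ n * ∫⁻ τ in {τ | (σ, τ) ∈ nearSet n},
        ENNReal.ofReal ((u (point σ) - u (point τ)) ^ 2) ∂bernoulli := by
  set q := cornerPoint n σ j with hq
  set B := Metric.closedBall q ((1 / 2 : ℝ) ^ n) with hB
  have hBm : MeasurableSet B := Metric.isClosed_closedBall.measurableSet
  have hlow : (3⁻¹ : ℝ≥0∞) ^ n ≤ gasketMeasure B := le_gasketMeasure_closedBall n q
  have h0 : gasketMeasure B ≠ 0 := (lt_of_lt_of_le (by simp [ENNReal.pow_pos]) hlow).ne'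
  have hprob := ProbabilityTheory.cond_isProbabilityMeasure h0
  have hint : Integrable u (ProbabilityTheory.cond gasketMeasure B) :=
    (hi.restrict).smul_measure (ENNReal.inv_ne_top.2 h0)
  have hd : ballAverage n u q - u (point σ) =
      ∫ x, (u x - u (point σ)) ∂(ProbabilityTheory.cond gasketMeasure B) := by
    rw [integral_sub hint (integrable_const _), ballAverage, integral_const, probReal_univ,
      one_smul]
  rw [hd]
  refine (ofReal_integral_sq_le (hu.sub_const _).aestronglyMeasurable).trans ?_
  rw [ProbabilityTheory.cond, lintegral_smul_measure, smul_eq_mul]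
  have hinv : (gasketMeasure B)⁻¹ ≤ 3 ^ n := by
    rw [← inv_inv ((3 : ℝ≥0∞) ^ n), ENNReal.inv_pow]
    exact ENNReal.inv_le_inv' hlow
  refine mul_le_mul' hinv ?_
  have hnm : MeasurableSet {τ | (σ, τ) ∈ nearSet n} :=
    measurable_prodMk_left (measurableSet_nearSet n)
  rw [← lintegral_indicator hBm, ← map_point_bernoulli, lintegral_map
    (((hu.sub_const _).pow_const 2).ennreal_ofReal.indicator hBm) measurable_point,
    ← lintegral_indicator hnm]
  refine lintegral_mono fun τ => ?_
  by_cases hτ : point τ ∈ B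
  · have hnear : dist (point σ) (point τ) ≤ 2 * (1 / 2) ^ n := by
      have h1 := dist_point_cornerPoint_le n σ j
      have h2 : dist (point τ) q ≤ (1 / 2) ^ n := hτ
      have h3 := dist_triangle_right (point σ) (point τ) q
      linarith
    rw [indicator_of_mem hτ, indicator_of_mem (show τ ∈ {τ | (σ, τ) ∈ nearSet n} from hnear),
      ← neg_sub, neg_sq]
  · rw [indicator_of_notMem hτ]
    exact zero_le

theorem lintegral_ballAverage_sub_sq_le {β : ℝ} (hβ : 0 < β) (n : ℕ) {u : sierpinskiGasket → ℝ}
    (hu : Measurable u) (hi : Integrable u gasketMeasure) :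
    ∫⁻ σ, ENNReal.ofReal (∑ j, (ballAverage n u (cornerPoint n σ j) - u (point σ)) ^ 2)
        ∂bernoulli ≤
      ENNReal.ofReal (9 * 2 ^ β * ((2 ^ β) ^ n)⁻¹) *
        nearEnergy (gasketDim + β) (fun σ => u (point σ)) n := by
  have hU : Measurable fun σ => u (point σ) := hu.comp measurable_point
  have hm := measurable_sub_sq hU hU
  calc ∫⁻ σ, ENNReal.ofReal (∑ j, (ballAverage n u (cornerPoint n σ j) - u (point σ)) ^ 2)
        ∂bernoulli
      ≤ ∫⁻ σ, 3 * (3 ^ n * ∫⁻ τ in {τ | (σ, τ) ∈ nearSet n},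
        ENNReal.ofReal ((u (point σ) - u (point τ)) ^ 2) ∂bernoulli) ∂bernoulli := by
        refine lintegral_mono fun σ => ?_
        rw [ENNReal.ofReal_sum_of_nonneg fun _ _ => sq_nonneg _]
        refine (Finset.sum_le_sum fun j _ =>
          ofReal_ballAverage_sub_sq_le n hu hi σ j).trans (le_of_eq ?_)
        simp
    _ = 3 * (3 ^ n * ∫⁻ p in nearSet n,
        ENNReal.ofReal ((u (point p.1) - u (point p.2)) ^ 2) ∂bernoulli₂) := by
        rw [lintegral_const_mul' _ _ (by norm_num),
          lintegral_const_mul' _ _ (ENNReal.pow_ne_top (by norm_num)),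
          ← lintegral_indicator (measurableSet_nearSet n),
          lintegral_prod _ (hm.indicator (measurableSet_nearSet n)).aemeasurable]
        congr 2
        refine lintegral_congr fun σ => ?_
        exact (lintegral_indicator (measurable_prodMk_left (measurableSet_nearSet n)) _).symm
    _ ≤ 3 * (3 ^ n * (ENNReal.ofReal ((2 * (1 / 2) ^ n) ^ (gasketDim + β)) *
        nearEnergy (gasketDim + β) (fun σ => u (point σ)) n)) := by
        gcongr
        exact setLIntegral_nearSet_le (add_pos gasketDim_pos hβ).le
          (fun σ τ h => congrArg u (Subtype.ext h)) n
    _ = _ := by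
        rw [two_mul_half_pow_rpow, ← mul_assoc, ← mul_assoc]
        congr 1
        rw [← ENNReal.ofReal_ofNat 3, ← ENNReal.ofReal_pow (by norm_num),
          ← ENNReal.ofReal_mul (by norm_num), ← ENNReal.ofReal_mul (by positivity)]
        congr 1
        have : (3 : ℝ) ^ n * (1 / 3) ^ n = 1 := by
          rw [← mul_pow]
          norm_num
        calc _ = 9 * 2 ^ β * ((3 : ℝ) ^ n * (1 / 3) ^ n * ((2 ^ β) ^ n)⁻¹) := by ring
          _ = _ := by rw [this, one_mul]

theorem cornerEnergy_le_sum_sq (b : Fin 3 → ℝ) (t : ℝ) :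
    cornerEnergy b ≤ 6 * ∑ j, (b j - t) ^ 2 := by
  simp only [cornerEnergy, Fin.sum_univ_three]
  nlinarith [sq_nonneg (b 0 - t + (b 1 - t) + (b 2 - t))]

theorem besovDensity_sub_le (s : ℝ) (U V : Address → ℝ) (p : Address × Address) :
    besovDensity s (fun σ => U σ - V σ) p ≤ 2 * besovDensity s U p + 2 * besovDensity s V p := by
  simp only [besovDensity]
  have h2 : ∀ t : ℝ, 2 * ENNReal.ofReal t = ENNReal.ofReal (2 * t) := fun t => by
    rw [ENNReal.ofReal_mul zero_le_two, ENNReal.ofReal_ofNat]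
  rw [← mul_add, ← ENNReal.ofReal_add (by positivity) (by positivity), h2, ← add_div,
    mul_div_assoc']
  refine ENNReal.ofReal_le_ofReal ?_
  gcongr
  nlinarith [sq_nonneg (U p.1 - U p.2 + (V p.1 - V p.2))]

/-- Split the energy of the error at level n. The far part and the near part of the interpolant cost
2^(βn) times an L² quantity, itself of size 2^(-βn) times the near energy; the near part of u is at
most the near energy. -/
theorem exists_interp_approx {β : ℝ} (hβ : 0 < β) (hβ5 : (2 : ℝ) ^ β < 5) :
    ∃ C : ℝ, 0 ≤ C ∧ ∀ (n : ℕ) (u : sierpinskiGasket → ℝ), Measurable u →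
      Integrable u gasketMeasure →
      ∫⁻ p, besovDensity (gasketDim + β)
          (fun σ => u (point σ) - interp n (ballAverage n u) σ) p ∂bernoulli₂ ≤
        ENNReal.ofReal C * nearEnergy (gasketDim + β) (fun σ => u (point σ)) n ∧
      ∫⁻ σ, ENNReal.ofReal ((u (point σ) - interp n (ballAverage n u) σ) ^ 2) ∂bernoulli ≤
        ENNReal.ofReal C * nearEnergy (gasketDim + β) (fun σ => u (point σ)) n := by
  have hb : 1 < (2 : ℝ) ^ β := Real.one_lt_rpow (by norm_num) hβ
  have hs : 0 < gasketDim + β := add_pos gasketDim_pos hβ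
  set b : ℝ := 2 ^ β with hbdef
  set A : ℝ := 16 * 4 ^ (gasketDim + β) with hA
  have hA0 : 0 < A := by positivity
  have hb1 : 0 < (b - 1)⁻¹ := inv_pos.2 (by linarith)
  have hb5 : 0 < (1 - b / 5)⁻¹ := inv_pos.2 (by linarith)
  set C₁ : ℝ := A * (1 - b / 5)⁻¹ with hC₁
  set C₂ : ℝ := A * (b - 1)⁻¹ with hC₂
  have hC₁0 : 0 < C₁ := mul_pos hA0 hb5
  have hC₂0 : 0 < C₂ := mul_pos hA0 hb1
  -- In order: near part of u, near part of the interpolant, far part of the error, squared L²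
  -- error. The factor 9b = 3·(3·2^β) accounts for three corners.
  refine ⟨2 + 2 * (C₁ * (6 * (9 * b))) + C₂ * (14 * (9 * b)) + 14 * (9 * b), by positivity,
    fun n u hu hi => ?_⟩
  set U : Address → ℝ := fun σ => u (point σ) with hU
  set g := interp n (ballAverage n u) with hg
  set N := nearEnergy (gasketDim + β) U n with hN
  set R := ∫⁻ σ, ENNReal.ofReal (∑ j, (ballAverage n u (cornerPoint n σ j) - u (point σ)) ^ 2)
        ∂bernoulli with hR
  have hbn : 0 < b ^ n := by positivity
  have hRN : R ≤ ENNReal.ofReal (9 * b * (b ^ n)⁻¹) * N :=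
    lintegral_ballAverage_sub_sq_le hβ n hu hi
  have hUm : Measurable U := hu.comp measurable_point
  have hgm : Measurable g := measurable_interp n _
  have hQ : ∀ σ, cornerEnergy (interpCorners n 0 (ballAverage n u) σ) ≤
      6 * ∑ j, (ballAverage n u (cornerPoint n σ j) - u (point σ)) ^ 2 := fun σ => by
    refine (cornerEnergy_le_sum_sq _ (u (point σ))).trans (le_of_eq ?_)
    simp only [interpCorners_zero]
  have hQR : ∫⁻ σ, ENNReal.ofReal (cornerEnergy (interpCorners n 0 (ballAverage n u) σ))
      ∂bernoulli ≤ ENNReal.ofReal 6 * R := by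
    rw [hR, ← lintegral_const_mul' _ _ ENNReal.ofReal_ne_top]
    refine lintegral_mono fun σ => ?_
    rw [← ENNReal.ofReal_mul (by norm_num)]
    exact ENNReal.ofReal_le_ofReal (hQ σ)
  have hW : ∫⁻ σ, ENNReal.ofReal ((U σ - g σ) ^ 2) ∂bernoulli ≤ ENNReal.ofReal 14 * R := by
    rw [hR, ← lintegral_const_mul' _ _ ENNReal.ofReal_ne_top]
    refine lintegral_mono fun σ => ?_
    rw [← ENNReal.ofReal_mul (by norm_num)]
    refine ENNReal.ofReal_le_ofReal ?_
    -- Passing through the value at corner 0 costs 2·6 + 2 = 14.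
    have h1 := sq_sub_le_of_mem (lower_le_interp n 0 (ballAverage n u) σ)
      (interp_le_upper n 0 (ballAverage n u) σ) 0
    rw [interpCorners_zero] at h1
    have h2 := hQ σ
    have h3 := Finset.single_le_sum (f := fun j =>
      (ballAverage n u (cornerPoint n σ j) - u (point σ)) ^ 2) (fun _ _ => sq_nonneg _)
      (Finset.mem_univ 0)
    have h4 : (U σ - g σ) ^ 2 ≤ 2 * (g σ - ballAverage n u (cornerPoint n σ 0)) ^ 2 +
        2 * (ballAverage n u (cornerPoint n σ 0) - u (point σ)) ^ 2 := by
      simp only [hU]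
      nlinarith [sq_nonneg (g σ - ballAverage n u (cornerPoint n σ 0) -
        (ballAverage n u (cornerPoint n σ 0) - u (point σ)))]
    linarith
  have hmul : ∀ c d : ℝ, 0 ≤ c → 0 ≤ d → ∀ X : ℝ≥0∞, X ≤ ENNReal.ofReal d * R →
      ENNReal.ofReal (c * b ^ n) * X ≤ ENNReal.ofReal (c * (d * (9 * b))) * N := by
    intro c d hc hd X hX
    refine (mul_le_mul_right (hX.trans (mul_le_mul_right hRN _)) _).trans (le_of_eq ?_)
    rw [← mul_assoc, ← mul_assoc, ← ENNReal.ofReal_mul (by positivity),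
      ← ENNReal.ofReal_mul (by positivity)]
    congr 2
    field_simp
  constructor
  · rw [lintegral_besovDensity_eq_add _ n]
    have hfar := (far_le hβ (hUm.sub hgm) n).trans (hmul C₂ 14 hC₂0.le (by norm_num) _ hW)
    have hnearU : ∫⁻ p in {p | Adj n p.1 p.2}, besovDensity (gasketDim + β) U p ∂bernoulli₂ ≤ N :=
      lintegral_mono_set fun _ hp => dist_le_of_adj hp
    have hnearg := (near_interp_le hβ hβ5 n (ballAverage n u)).trans
      (hmul C₁ 6 hC₁0.le (by norm_num) _ hQR)
    have hnear : ∫⁻ p in {p | Adj n p.1 p.2},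
        besovDensity (gasketDim + β) (fun σ => U σ - g σ) p ∂bernoulli₂ ≤
        2 * N + 2 * (ENNReal.ofReal (C₁ * (6 * (9 * b))) * N) := by
      refine (lintegral_mono fun p => besovDensity_sub_le _ U g p).trans ?_
      rw [lintegral_add_left ((measurable_besovDensity _ hUm).const_mul 2),
        lintegral_const_mul' _ _ (by norm_num), lintegral_const_mul' _ _ (by norm_num)]
      gcongr
    refine (add_le_add hnear hfar).trans ?_
    rw [← mul_assoc, ← add_mul, ← add_mul, ← ENNReal.ofReal_ofNat 2,
      ← ENNReal.ofReal_mul (by norm_num), ← ENNReal.ofReal_add (by norm_num) (by positivity),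
      ← ENNReal.ofReal_add (by positivity) (by positivity)]
    refine mul_le_mul_left (ENNReal.ofReal_le_ofReal ?_) _
    have : 0 < 14 * (9 * b) := by positivity
    linarith
  · refine hW.trans ((mul_le_mul_right hRN _).trans ?_)
    rw [← mul_assoc, ← ENNReal.ofReal_mul (by norm_num)]
    refine mul_le_mul_left (ENNReal.ofReal_le_ofReal ?_) _
    have h1 : (b ^ n)⁻¹ ≤ 1 := inv_le_one_of_one_le₀ (one_le_pow₀ hb.le)
    have h2 : 14 * (9 * b * (b ^ n)⁻¹) ≤ 14 * (9 * b * 1) := by gcongr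
    have h3 : 0 < C₁ * (6 * (9 * b)) := by positivity
    have h4 : 0 < C₂ * (14 * (9 * b)) := by positivity
    linarith

/-! ### The Besov-type forms on the gasket -/

theorem five_le_two_rpow_iff {β : ℝ} : 5 ≤ (2 : ℝ) ^ β ↔ Real.log 5 / Real.log 2 ≤ β := by
  rw [Real.le_rpow_iff_log_le (by norm_num) (by norm_num), div_le_iff₀ log_two_pos]

theorem lintegral_gasketMeasure {f : sierpinskiGasket → ℝ≥0∞} (hf : Measurable f) :
    ∫⁻ x, f x ∂gasketMeasure = ∫⁻ σ, f (point σ) ∂bernoulli := by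
  rw [← map_point_bernoulli, lintegral_map hf measurable_point]

theorem ae_gasketMeasure {s : Set sierpinskiGasket} (hs : MeasurableSet s)
    (h : ∀ᵐ σ ∂bernoulli, point σ ∈ s) : ∀ᵐ x ∂gasketMeasure, x ∈ s := by
  rw [← map_point_bernoulli]
  exact (ae_map_iff measurable_point.aemeasurable hs).2 h

theorem sqInt_comp_point (u : Lp ℝ 2 gasketMeasure) : SqInt fun σ => u (point σ) := by
  have hu := (Lp.stronglyMeasurable u).measurable
  refine ⟨hu.comp measurable_point, ?_⟩
  rw [← lintegral_gasketMeasure (f := fun x => ENNReal.ofReal (u x ^ 2))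
    (hu.pow_const 2).ennreal_ofReal, lintegral_ofReal_sq]
  exact ENNReal.pow_lt_top (Lp.eLpNorm_lt_top u)

theorem besovEnergy_const (β c : ℝ) :
    besovEnergy gasketMeasure gasketDim β (fun _ => c) = 0 := by
  simp [besovEnergy]

theorem mem_domain_iff_of_five_le {β : ℝ} (hβ0 : 0 < β) (hβ : 5 ≤ (2 : ℝ) ^ β)
    (u : Lp ℝ 2 gasketMeasure) :
    u ∈ (besovForm gasketMeasure gasketDim β).domain ↔
      ∃ c : ℝ, u =ᵐ[gasketMeasure] fun _ => c := by
  have hu := (Lp.stronglyMeasurable u).measurable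
  rw [mem_besovForm_domain]
  constructor
  · intro h
    rw [besovEnergy_eq β hu] at h
    obtain ⟨c, hc⟩ := ae_eq_const_of_besov_finite hβ0 hβ (sqInt_comp_point u)
      (fun σ τ h => congrArg u (Subtype.ext h)) h
    exact ⟨c, ae_gasketMeasure (hu (measurableSet_singleton c)) hc⟩
  · rintro ⟨c, hc⟩
    rw [besovEnergy_congr gasketDim β hc, besovEnergy_const]
    exact ENNReal.zero_lt_top

theorem exists_eq_const_of_ae {g : sierpinskiGasket → ℝ} {c : ℝ}
    (h : g =ᵐ[gasketMeasure] fun _ => c) (n : ℕ) (q : sierpinskiGasket) :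
    ∃ x, dist x q ≤ (1 / 2) ^ n ∧ g x = c := by
  by_contra hcon
  push Not at hcon
  have h0 : gasketMeasure (Metric.closedBall q ((1 / 2) ^ n)) = 0 :=
    measure_mono_null (fun x hx => hcon x hx) (ae_iff.1 h)
  have h1 := le_gasketMeasure_closedBall n q
  rw [h0] at h1
  exact absurd h1 (not_le.2 (ENNReal.pow_pos (by simp) n))

/-- The domain contains only constants, and the distance to a vertex is not within 1/4 of one: near
that vertex this forces c < 1/2, near another vertex c > 1/2. -/
theorem not_isRegularDirichlet {β : ℝ} (hβ0 : 0 < β) (hβ : 5 ≤ (2 : ℝ) ^ β) :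
    ¬ (besovForm gasketMeasure gasketDim β).IsRegularDirichlet := by
  intro hreg
  obtain ⟨v, g, _, _, hvg, hfg⟩ := hreg.dense_uniform (fun x => dist x (vertex 0))
    (continuous_id.dist continuous_const) (HasCompactSupport.of_compactSpace _) (1 / 4)
    (by norm_num)
  obtain ⟨c, hc⟩ := (mem_domain_iff_of_five_le hβ0 hβ v).1 v.2
  have hgc : g =ᵐ[gasketMeasure] fun _ => c := hvg.symm.trans hc
  -- Level 2 means radius 1/4; balls have positive mass, so the almost everywhere value c is
  -- attained in them.
  obtain ⟨x, hx, hxc⟩ := exists_eq_const_of_ae hgc 2 (vertex 0)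
  obtain ⟨y, hy, hyc⟩ := exists_eq_const_of_ae hgc 2 (vertex 1)
  have hd : dist (vertex 1) (vertex 0) = 1 := by
    change dist (gasketPoint fun _ => 1) (gasketPoint fun _ => 0) = 1
    rw [gasketPoint_const, gasketPoint_const, EuclideanSpace.dist_eq, Fin.sum_univ_two]
    simp [gasketVertex]
  have h1 := (abs_lt.1 (hfg x)).1
  have h2 := (abs_lt.1 (hfg y)).2
  have h3 := dist_triangle_left (vertex 1) (vertex 0) y
  rw [hxc] at h1
  rw [hyc] at h2
  norm_num at hx hy
  linarith

theorem exists_domain_interpFun {β : ℝ} (hβ : 0 < β) (hβ5 : (2 : ℝ) ^ β < 5) (n : ℕ)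
    (φ : sierpinskiGasket → ℝ) : ∃ v : (besovForm gasketMeasure gasketDim β).domain,
      (v : Lp ℝ 2 gasketMeasure) =ᵐ[gasketMeasure] interpFun n φ := by
  set f : C(sierpinskiGasket, ℝ) := ⟨interpFun n φ, continuous_interpFun n φ⟩
  have hae : (ContinuousMap.toLp 2 gasketMeasure ℝ f : Lp ℝ 2 gasketMeasure) =ᵐ[gasketMeasure]
      interpFun n φ := ContinuousMap.coeFn_toLp gasketMeasure f
  refine ⟨⟨ContinuousMap.toLp 2 gasketMeasure ℝ f, ?_⟩, hae⟩
  rw [mem_besovForm_domain, besovEnergy_congr _ _ hae,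
    besovEnergy_eq β (continuous_interpFun n φ).measurable]
  simp only [interpFun_point]
  exact lintegral_besovDensity_interp_lt_top hβ hβ5 n φ

theorem exists_domain_uniform_approx {β : ℝ} (hβ : 0 < β) (hβ5 : (2 : ℝ) ^ β < 5)
    {f : sierpinskiGasket → ℝ} (hf : Continuous f) {ε : ℝ} (hε : 0 < ε) :
    ∃ v : (besovForm gasketMeasure gasketDim β).domain, ∃ g : sierpinskiGasket → ℝ,
      Continuous g ∧ HasCompactSupport g ∧
        ((v : Lp ℝ 2 gasketMeasure) =ᵐ[gasketMeasure] g) ∧ ∀ x, |f x - g x| < ε := by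
  obtain ⟨δ, hδ, h⟩ := Metric.uniformContinuous_iff.1
    (CompactSpace.uniformContinuous_of_continuous hf) (ε / 2) (half_pos hε)
  obtain ⟨n, hn⟩ := exists_pow_lt_of_lt_one hδ (one_half_lt_one (α := ℝ))
  obtain ⟨v, hv⟩ := exists_domain_interpFun hβ hβ5 n f
  refine ⟨v, interpFun n f, continuous_interpFun n f, HasCompactSupport.of_compactSpace _, hv,
    fun x => ?_⟩
  obtain ⟨σ, rfl⟩ := point_surjective x
  rw [interpFun_point]
  exact (abs_sub_interp_le (fun x y hxy => (h (hxy.trans_lt hn)).le) σ).trans_lt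
    (half_lt_self hε)

theorem dense_domain {β : ℝ} (hβ : 0 < β) (hβ5 : (2 : ℝ) ^ β < 5) :
    Dense ((besovForm gasketMeasure gasketDim β).domain : Set (Lp ℝ 2 gasketMeasure)) := by
  -- Continuous functions are dense in L² and lie in the closure of the domain, because uniform
  -- approximation bounds the L² error for a probability measure.
  refine dense_closure.1 (Dense.mono ?_
    (ContinuousMap.toLp_denseRange ℝ gasketMeasure ℝ (p := 2) (by norm_num)))
  rintro _ ⟨f, rfl⟩
  refine Metric.mem_closure_iff.2 fun ε hε => ?_
  obtain ⟨v, g, _, _, hvg, hfg⟩ := exists_domain_uniform_approx hβ hβ5 f.continuous (half_pos hε)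
  refine ⟨v, v.2, ?_⟩
  rw [dist_eq_norm]
  have hb : ∀ᵐ x ∂gasketMeasure,
      ‖(ContinuousMap.toLp 2 gasketMeasure ℝ f - v : Lp ℝ 2 gasketMeasure) x‖ ≤ ε / 2 := by
    filter_upwards [
      Lp.coeFn_sub (ContinuousMap.toLp 2 gasketMeasure ℝ f) (v : Lp ℝ 2 gasketMeasure),
      ContinuousMap.coeFn_toLp (p := 2) (𝕜 := ℝ) gasketMeasure f, hvg] with x h1 h2 h3
    rw [h1, Pi.sub_apply, h2, h3]
    exact (hfg x).le
  have h1 := Lp.norm_le_of_ae_bound (half_pos hε).le hb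
  have h2 : measureUnivNNReal gasketMeasure = 1 := by simp [measureUnivNNReal]
  rw [h2] at h1
  simp at h1
  linarith

theorem exists_domain_energyOne_lt {β : ℝ} (hβ : 0 < β) (hβ5 : (2 : ℝ) ^ β < 5)
    (u : (besovForm gasketMeasure gasketDim β).domain) {ε : ℝ} (hε : 0 < ε) :
    ∃ v : (besovForm gasketMeasure gasketDim β).domain, ∃ f : sierpinskiGasket → ℝ,
      Continuous f ∧ HasCompactSupport f ∧ ((v : Lp ℝ 2 gasketMeasure) =ᵐ[gasketMeasure] f) ∧
        (besovForm gasketMeasure gasketDim β).energyOne (u - v) < ε := by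
  have hu := (Lp.stronglyMeasurable (u : Lp ℝ 2 gasketMeasure)).measurable
  have hi : Integrable (u : Lp ℝ 2 gasketMeasure) gasketMeasure :=
    (Lp.memLp (u : Lp ℝ 2 gasketMeasure)).integrable (by norm_num)
  have hfin : besovEnergy gasketMeasure gasketDim β (u : Lp ℝ 2 gasketMeasure) < ⊤ := u.2
  rw [besovEnergy_eq β hu] at hfin
  obtain ⟨C, hC, happ⟩ := exists_interp_approx hβ hβ5
  have ht := ENNReal.Tendsto.const_mul (tendsto_nearEnergy (add_pos gasketDim_pos hβ).ne' hfin)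
    (Or.inr (ENNReal.ofReal_ne_top (r := C)))
  rw [mul_zero] at ht
  obtain ⟨n, hn⟩ := (ht.eventually (gt_mem_nhds (ENNReal.ofReal_pos.2
    (show 0 < ε / 3 by positivity)))).exists
  obtain ⟨h1, h2⟩ := happ n _ hu hi
  obtain ⟨v, hv⟩ := exists_domain_interpFun hβ hβ5 n (ballAverage n (u : Lp ℝ 2 gasketMeasure))
  refine ⟨v, _, continuous_interpFun n _, HasCompactSupport.of_compactSpace _, hv, ?_⟩
  set w : sierpinskiGasket → ℝ := fun x => (u : Lp ℝ 2 gasketMeasure) x -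
    interpFun n (ballAverage n (u : Lp ℝ 2 gasketMeasure)) x with hw
  have hwm : Measurable w := hu.sub (continuous_interpFun n _).measurable
  have hae : (u - v : Lp ℝ 2 gasketMeasure) =ᵐ[gasketMeasure] w := by
    filter_upwards [Lp.coeFn_sub (u : Lp ℝ 2 gasketMeasure) (v : Lp ℝ 2 gasketMeasure), hv]
      with x hx hx'
    rw [hx, Pi.sub_apply, hx']
  have hE : besovEnergy gasketMeasure gasketDim β (u - v : Lp ℝ 2 gasketMeasure) ≤
      ENNReal.ofReal (ε / 3) := by
    rw [besovEnergy_congr _ _ hae, besovEnergy_eq β hwm]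
    simp only [hw, interpFun_point]
    exact h1.trans hn.le
  have hL : eLpNorm (u - v : Lp ℝ 2 gasketMeasure) 2 gasketMeasure ^ 2 ≤
      ENNReal.ofReal (ε / 3) := by
    rw [eLpNorm_congr_ae hae, ← lintegral_ofReal_sq,
      lintegral_gasketMeasure (hwm.pow_const 2).ennreal_ofReal]
    simp only [hw, interpFun_point]
    exact h2.trans hn.le
  have hE' := ENNReal.toReal_mono ENNReal.ofReal_ne_top hE
  have hL' := ENNReal.toReal_mono ENNReal.ofReal_ne_top hL
  rw [ENNReal.toReal_ofReal (by positivity)] at hE' hL'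
  rw [ENNReal.toReal_pow, ← Lp.norm_def] at hL'
  rw [besovForm_energyOne]
  change (besovEnergy gasketMeasure gasketDim β (u - v : Lp ℝ 2 gasketMeasure)).toReal +
    ‖(u - v : Lp ℝ 2 gasketMeasure)‖ ^ 2 < ε
  linarith

theorem isRegularDirichlet {β : ℝ} (hβ : 0 < β) (hβ5 : (2 : ℝ) ^ β < 5) :
    (besovForm gasketMeasure gasketDim β).IsRegularDirichlet where
  dense := dense_domain hβ hβ5
  symm := besovForm_symm
  nonneg := besovForm_nonneg
  closed := besovForm_closed
  markov := besovForm_markov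
  dense_domain u _ hε := exists_domain_energyOne_lt hβ hβ5 u hε
  dense_uniform _ hf _ _ hε := exists_domain_uniform_approx hβ hβ5 hf hε

theorem isWalkDimension_gasket :
    IsWalkDimension gasketMeasure gasketDim (ENNReal.ofReal (Real.log 5 / Real.log 2)) := by
  refine ⟨isAlphaRegular_gasketMeasure, ?_⟩
  ext β
  refine and_congr_right fun hβ => ?_
  rw [ENNReal.ofReal_lt_ofReal_iff (div_pos (Real.log_pos (by norm_num)) log_two_pos), ← not_le,
    ← five_le_two_rpow_iff]
  exact ⟨fun h h5 => not_isRegularDirichlet hβ h5 h, fun h => isRegularDirichlet hβ (not_le.1 h)⟩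

theorem lt_one_fifth_iff {lam : ℝ} (h0 : 0 < lam) :
    lam < 1 / 5 ↔ Real.log 5 / Real.log 2 < -Real.log lam / Real.log 2 := by
  rw [div_lt_div_iff_of_pos_right log_two_pos, lt_neg, ← Real.log_inv, one_div,
    Real.log_lt_log_iff h0 (by norm_num)]

theorem mem_domain_iff {β : ℝ} (hβ : Real.log 5 / Real.log 2 < β) (u : Lp ℝ 2 gasketMeasure) :
    u ∈ (besovForm gasketMeasure gasketDim β).domain ↔
      ∃ c : ℝ, u =ᵐ[gasketMeasure] fun _ => c :=
  mem_domain_iff_of_five_le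
    ((div_pos (Real.log_pos (by norm_num)) log_two_pos).trans hβ) (five_le_two_rpow_iff.2 hβ.le) u

end Gasket

theorem mainTheorem1 :
    -- with `β = -log λ / log 2`, the conditions `λ ∈ (0, 1/5)` and `β > log 5 / log 2` agree
    (∀ lam : ℝ, 0 < lam → lam < 1 →
      (lam < 1 / 5 ↔ Real.log 5 / Real.log 2 < -Real.log lam / Real.log 2)) ∧
    -- triviality for `λ ∈ (0, 1/5)` and `β = -log λ / log 2`
    (∀ lam : ℝ, 0 < lam → lam < 1 / 5 → ∀ u : Lp ℝ 2 gasketMeasure,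
      u ∈ (besovForm gasketMeasure gasketDim (-Real.log lam / Real.log 2)).domain ↔
        ∃ c : ℝ, u =ᵐ[gasketMeasure] fun _ => c) ∧
    -- triviality for `β > log 5 / log 2`
    (∀ β : ℝ, Real.log 5 / Real.log 2 < β → ∀ u : Lp ℝ 2 gasketMeasure,
      u ∈ (besovForm gasketMeasure gasketDim β).domain ↔
        ∃ c : ℝ, u =ᵐ[gasketMeasure] fun _ => c) ∧
    -- the walk dimension of the Sierpiński gasket
    IsWalkDimension gasketMeasure gasketDim (ENNReal.ofReal (Real.log 5 / Real.log 2)) := by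
  exact ⟨fun _ h0 _ => Gasket.lt_one_fifth_iff h0,
    fun _ h0 h5 u => Gasket.mem_domain_iff ((Gasket.lt_one_fifth_iff h0).1 h5) u,
    fun _ hβ u => Gasket.mem_domain_iff hβ u, Gasket.isWalkDimension_gasket⟩
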